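/- **Setting.** Let $\mathcal S,\mathcal A$ be finite sets with $S=|\mathcal S|\ge 1$, $A=|\mathcal A|\ge 1$ elements, $H\ge 1$ a horizon, $s_1\in\mathcal S$ an initial state, $p_h(\cdot|s,a)$ ($1\le h\le H$) transition probabilities, unknown to the learner, and $r_h(s,a)\in[0,r_{\max}]$ known deterministic rewards. Let $\kappa\ge 0$, $\lambda>0$, and let $\Phi:\Delta_{\mathcal A}\to\mathbb R$, $\Phi\le 0$, be a mirror map: closed, $1$-strongly convex with respect to some norm, differentiable in the relative interior of the simplex $\Delta_{\mathcal A}$, with a gradient (taken along the simplex, so determined up to adding constant vectors) that takes all values in $\mathbb R^{\mathcal A}$ and whose norm tends to infinity at the relative boundary. Write $\mathcal H(q)=\sum_x q_x\log(1/q_x)$, $qf=\sum_x q_xf(x)$, $\mathrm{Var}_q(f)=q(f-qf)^2$, $\mathrm{clip}(x,m,M)=\max(\min(x,M),m)$, $R_\Phi=\max_{\Delta_{\mathcal A}}|\Phi|$ and $R_{\max}=r_{\max}+\kappa\log S+\lambda R_\Phi$. For a Markovian policy $\pi=(\pi_h:\mathcal S\to\Delta_{\mathcal A})_{h\le H}$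 let $$V^\pi_{\lambda,1}(s_1)=\mathbb E_\pi\Big[\sum_{h=1}^H r_h(s_h,a_h)+\kappa\mathcal H(p_h(s_h,a_h))-\lambda\Phi(\pi_h(s_h))\Big],\qquad V^\star_{\lambda,1}(s_1)=\max_\pi V^\pi_{\lambda,1}(s_1).$$ **Algorithm.** Fix $\varepsilon>0$, $\delta\in(0,1)$. After $t\ge 0$ episodes let $n=n^t_h(s,a)$ be the number of visits of $(s,a)$ at step $h$ and $\hat p=\hat p^t_h(\cdot|s,a)$ the empirical transition distribution (uniform if $n=0$). Put $\beta^{KL}(n)=\log\frac{4SAH}\delta+S\log(e(1+n))$, $\beta^{c}(n)=\log\frac{4SAH}\delta+\log(4en(2n+1))$, $\beta^{\mathcal H}(n)=\log^2(n)\big(\log\frac{4SAH}\delta+\log(n(n+1))\big)$. UCBVI-Ent computes backwards, with $\overline V^t_{H+1}=\underline V^t_{H+1}=0$, $G^t_{H+1}=0$, the quantities (omitting $(s,a)$, and with $n=n^t_h(s,a)$) $$b^{\mathcal H}=\sqrt{\tfrac{2\beta^{\mathcal H}(n)}n}+\min\big(\tfrac{\beta^{KL}(n)}n,\log S\big),\quad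 b^B=3\sqrt{\mathrm{Var}_{\hat p}(\overline V^t_{h+1})\tfrac{\beta^{c}(n)}n}+\tfrac{9H^2R_{\max}\beta^{KL}(n)}n,\quad b^p=b^B+\tfrac1H\hat p(\overline V^t_{h+1}-\underline V^t_{h+1}),$$ $$\overline Q^t_h=\mathrm{clip}\big(r_h+\kappa\mathcal H(\hat p)+\hat p\overline V^t_{h+1}+b^p+\kappa b^{\mathcal H},0,HR_{\max}\big),\quad \underline Q^t_h=\mathrm{clip}\big(r_h+\kappa\mathcal H(\hat p)+\hat p\underline V^t_{h+1}-b^p-\kappa b^{\mathcal H},0,HR_{\max}\big),$$ $$\overline V^t_h(s)=\max_{\pi\in\Delta_{\mathcal A}}\{\pi\overline Q^t_h(s)-\lambda\Phi(\pi)\},\quad \underline V^t_h(s)=\max_{\pi\in\Delta_{\mathcal A}}\{\pi\underline Q^t_h(s)-\lambda\Phi(\pi)\},\quad \pi^{t+1}_h(s)=\operatorname*{argmax}_{\pi\in\Delta_{\mathcal A}}\{\pi\overline Q^t_h(s)-\lambda\Phi(\pi)\},$$ $$G^t_h=\mathrm{clip}\Big(2b^B+\tfrac{4H^2R_{\max}\beta^{KL}(n)}n+2\kappa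 b^{\mathcal H}+\big(1+\tfrac3H\big)\hat p\,[\pi^{t+1}_{h+1}G^t_{h+1}],0,HR_{\max}\Big),$$ where for $n=0$ the bonuses are $+\infty$, that is, $\overline Q^t_h=G^t_h=HR_{\max}$ and $\underline Q^t_h=0$. Episode $t+1$ is played with $\pi^{t+1}$. The (regularization-agnostic) stopping time is $\tau=\min\{t\ge 0:\pi^{t+1}_1G^t_1(s_1)\le\varepsilon\}$, and the output is $\hat\pi=\pi^{\tau+1}$. **Theorem.** (i) UCBVI-Ent is $(\varepsilon,\delta)$-PAC for best policy identification in regularized MDPs: for all transition probabilities, with probability at least $1-\delta$, $\tau<\infty$ and $V^\star_{\lambda,1}(s_1)-V^{\hat\pi}_{\lambda,1}(s_1)\le\varepsilon$. (ii) There is a universal constant $C>0$ such that, if moreover $S\ge 2$ or $\kappa=0$, with probability at least $1-\delta$, $$\tau\le C\left(\frac{H^3SAR_{\max}^2\log(SAH/\delta)L^4}{\varepsilon^2}+\frac{H^3SAR_{\max}\big(\log(SAH/\delta)+SL\big)L}{\varepsilon}\right),$$ where $L=1+\log\big(SAH\max(1,R_{\max}/\varepsilon)\big)+\max\big(0,\log\log(SAH/\delta)\big)$.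 -/

import Mathlib

open MeasureTheory ProbabilityTheory
open scoped Topology

noncomputable section

namespace RegMDP

/-! ### Elementary notions on a finite set -/

/-- `clip(x, m, M) = max(min(x, M), m)`. -/
def clip (x m M : ℝ) : ℝ := max (min x M) m

/-- Expectation `q f = 𝔼_{x ∼ q} f(x)` for a vector of weights `q`. -/
def mean {X : Type*} [Fintype X] (q f : X → ℝ) : ℝ := ∑ x, q x * f x

/-- Variance `Var_q(f) = 𝔼_{x ∼ q} (f(x) - q f)²`. -/
def variance {X : Type*} [Fintype X] (q f : X → ℝ) : ℝ :=
  ∑ x, q x * (f x - mean q f) ^ 2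

/-- Shannon entropy `∑ q_x log (1 / q_x)`, with `0 log (1 / 0) = 0`. -/
def entropy {X : Type*} [Fintype X] (q : X → ℝ) : ℝ := ∑ x, Real.negMulLog (q x)

/-! ### Mirror maps on the simplex -/

/-- The relative interior of the simplex: probability vectors with positive entries. -/
def openSimplex (A : Type*) [Fintype A] : Set (A → ℝ) :=
  {x | x ∈ stdSimplex ℝ A ∧ ∀ a, 0 < x a}

/-- Mirror maps `Φ : Δ_A → ℝ` (only the values of `Φ` on the simplex matter). The simplex spans an
affine hyperplane, so a linear functional `g` is a gradient of `Φ` at `x` when it is a derivative of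
`Φ` *within the simplex*; such a `g` is determined up to adding multiples of `v ↦ ∑ a, v a`. -/
structure IsMirrorMap {A : Type*} [Fintype A] (Φ : (A → ℝ) → ℝ) : Prop where
  /-- `Φ` is closed. -/
  closed : LowerSemicontinuousOn Φ (stdSimplex ℝ A)
  /-- `Φ` is `1`-strongly convex with respect to some norm. -/
  strongly_convex : ∃ N : Seminorm ℝ (A → ℝ), (∀ v, N v = 0 → v = 0) ∧
    ∀ x ∈ stdSimplex ℝ A, ∀ y ∈ stdSimplex ℝ A, ∀ c ∈ Set.Icc (0 : ℝ) 1,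
      Φ (c • x + (1 - c) • y) ≤
        c * Φ x + (1 - c) * Φ y - 1 / 2 * (c * (1 - c)) * N (x - y) ^ 2
  /-- The gradient exists in the relative interior. -/
  differentiable : ∀ x ∈ openSimplex A, DifferentiableWithinAt ℝ Φ (stdSimplex ℝ A) x
  /-- The gradient takes all possible values. -/
  gradient_surjective : ∀ g : (A → ℝ) →L[ℝ] ℝ,
    ∃ x ∈ openSimplex A, HasFDerivWithinAt Φ g (stdSimplex ℝ A) x
  /-- The gradient diverges at the relative boundary. -/
  gradient_diverges : ∀ y ∈ stdSimplex ℝ A, y ∉ openSimplex A → ∀ M : ℝ,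
    ∀ᶠ x in 𝓝[openSimplex A] y, ∀ g : (A → ℝ) →L[ℝ] ℝ,
      HasFDerivWithinAt Φ g (stdSimplex ℝ A) x → M ≤ ‖g‖

/-! ### Episodes, policies, and the regularized value -/

/-- Markovian policies `π = (π_h)_h` with `π_h : S → Δ_A`. Steps `1, …, H` are indexed
by `Fin H`, i.e. by `0, …, H - 1`. -/
abbrev Policy (S A : Type*) [Fintype A] (H : ℕ) := Fin H → S → stdSimplex ℝ A

/-- Transition probabilities `p_h(s' | s, a)`. -/
abbrev Transitions (S A : Type*) [Fintype S] (H : ℕ) := Fin H → S → A → stdSimplex ℝ S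

/-- An episode `(s_1, a_1, …, s_H, a_H, s_{H+1})`: its `H + 1` states and its `H` actions. -/
def Episode (S A : Type*) (H : ℕ) := (Fin (H + 1) → S) × (Fin H → A)

namespace Episode

variable {S A : Type*} {H : ℕ}

/-- The state `s_h` in which the action of step `h` is taken. -/
def state (e : Episode S A H) (h : Fin H) : S := e.1 h.castSucc

/-- The action `a_h`. -/
def action (e : Episode S A H) (h : Fin H) : A := e.2 h

/-- The state `s_{h+1}` observed after the action of step `h`. -/
def next (e : Episode S A H) (h : Fin H) : S := e.1 h.succ

instance [Finite S] [Finite A] : Finite (Episode S A H) :=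
  inferInstanceAs (Finite ((Fin (H + 1) → S) × (Fin H → A)))

open Classical in
instance [Fintype S] [Fintype A] : Fintype (Episode S A H) :=
  inferInstanceAs (Fintype ((Fin (H + 1) → S) × (Fin H → A)))

instance : MeasurableSpace (Episode S A H) := ⊤

instance : DiscreteMeasurableSpace (Episode S A H) := ⟨fun _ => trivial⟩

end Episode

section Law

variable {S A : Type*} [Fintype S] [Fintype A] {H : ℕ}

open Classical in
/-- Probability of an episode when `π` is played from the initial state `s₁`. -/
def episodeProb (s₁ : S) (p : Transitions S A H) (π : Policy S A H) (e : Episode S A H) : ℝ :=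
  (if e.1 0 = s₁ then 1 else 0) *
    ∏ h, π h (e.state h) (e.action h) * p h (e.state h) (e.action h) (e.next h)

theorem episodeProb_nonneg (s₁ : S) (p : Transitions S A H) (π : Policy S A H)
    (e : Episode S A H) : 0 ≤ episodeProb s₁ p π e := by
  unfold episodeProb
  refine mul_nonneg (by split_ifs <;> norm_num) (Finset.prod_nonneg fun h _ => ?_)
  exact mul_nonneg ((π h _).2.1 _) ((p h _ _).2.1 _)

theorem sum_episodeProb (s₁ : S) (p : Transitions S A H) (π : Policy S A H) :
    ∑ e, episodeProb s₁ p π e = 1 := by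
  classical
  have key : ∀ (n : ℕ) (p : Transitions S A n) (π : Policy S A n),
      ∑ st : Fin (n + 1) → S, ∑ ac : Fin n → A, (if st 0 = s₁ then (1 : ℝ) else 0) *
        ∏ h, π h (st h.castSucc) (ac h) * p h (st h.castSucc) (ac h) (st h.succ) = 1 := by
    intro n
    induction n with
    | zero =>
      intro p π
      rw [← (Equiv.funUnique (Fin 1) S).symm.sum_comp]
      simp
    | succ n ih =>
      intro p π
      refine Eq.trans ?_ (ih (fun h => p h.castSucc) (fun h => π h.castSucc))
      rw [← (Fin.snocEquiv fun _ => S).sum_comp, Fintype.sum_prod_type_right]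
      refine Finset.sum_congr rfl fun st _ => ?_
      have hπ : ∑ a, π (Fin.last n) (st (Fin.last n)) a *
          ∑ s', p (Fin.last n) (st (Fin.last n)) a s' = 1 := by
        simp only [stdSimplex.sum_eq_one, mul_one]
      rw [Finset.sum_comm, ← (Fin.snocEquiv fun _ => A).sum_comp, Fintype.sum_prod_type_right]
      refine Finset.sum_congr rfl fun ac _ => ?_
      have h0 : ∀ s' : S, (Fin.snoc st s' : Fin (n + 2) → S) 0 = st 0 := fun s' =>
        Fin.snoc_castSucc (α := fun _ => S) s' st 0
      simp only [Fin.snocEquiv, Equiv.coe_fn_mk, Fin.prod_univ_castSucc, Fin.snoc_castSucc,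
        Fin.snoc_last, Fin.succ_castSucc, Fin.succ_last, h0]
      refine Eq.trans ?_ (mul_one _)
      refine Eq.trans ?_ (congrArg _ hπ)
      rw [Finset.mul_sum]
      refine Finset.sum_congr rfl fun a _ => ?_
      rw [Finset.mul_sum, Finset.mul_sum]
      exact Finset.sum_congr rfl fun s' _ => by ring
  have := key H p π
  rw [← Fintype.sum_prod_type'] at this
  exact this

/-- Law of one episode played with `π`. -/
def episodeLaw (s₁ : S) (p : Transitions S A H) (π : Policy S A H) : Measure (Episode S A H) :=
  (PMF.ofFintype (fun e => ENNReal.ofReal (episodeProb s₁ p π e)) (by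
    rw [← ENNReal.ofReal_sum_of_nonneg fun e _ => episodeProb_nonneg s₁ p π e,
      sum_episodeProb, ENNReal.ofReal_one])).toMeasure

instance (s₁ : S) (p : Transitions S A H) (π : Policy S A H) :
    IsProbabilityMeasure (episodeLaw s₁ p π) := by
  unfold episodeLaw; infer_instance

end Law

/-- Everything about a regularized MDP that the learner knows, i.e. all but the transitions. -/
structure Problem (S A : Type*) [Fintype A] (H : ℕ) where
  /-- the initial state `s_1` -/
  start : S
  /-- the deterministic rewards `r_h(s, a)` -/
  reward : Fin H → S → A → ℝ
  /-- the bound `r_max` on the rewards -/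
  rmax : ℝ
  reward_mem : ∀ h s a, reward h s a ∈ Set.Icc 0 rmax
  /-- the weight `κ` of the transition entropy in the rewards -/
  kap : ℝ
  kap_nonneg : 0 ≤ kap
  /-- the regularization parameter `λ` -/
  lam : ℝ
  lam_pos : 0 < lam
  /-- the regularizer `Φ` -/
  Φ : (A → ℝ) → ℝ
  mirror : IsMirrorMap Φ
  Φ_nonpos : ∀ x ∈ stdSimplex ℝ A, Φ x ≤ 0

namespace Problem

variable {S A : Type*} [Fintype S] [Fintype A] {H : ℕ} (P : Problem S A H)

/-- `R_Φ`, the maximum of `|Φ|` on the simplex. -/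
def RΦ : ℝ := ⨆ x : stdSimplex ℝ A, |P.Φ x|

/-- `R_max = r_max + κ log S + λ R_Φ`. -/
def Rmax : ℝ := P.rmax + P.kap * Real.log (Fintype.card S) + P.lam * P.RΦ

/-- The regularized value `V^π_{λ,1}(s_1)`, the expectation under `π` of
`∑_h (r_h(s_h, a_h) + κ 𝓗(p_h(s_h, a_h)) - λ Φ(π_h(s_h)))`. -/
def value (p : Transitions S A H) (π : Policy S A H) : ℝ :=
  ∑ e, episodeProb P.start p π e *
    ∑ h, (P.reward h (e.state h) (e.action h) + P.kap * entropy (p h (e.state h) (e.action h))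
      - P.lam * P.Φ (π h (e.state h)))

/-- The optimal regularized value `V*_{λ,1}(s_1) = max_π V^π_{λ,1}(s_1)`. -/
def optValue (p : Transitions S A H) : ℝ := ⨆ π : Policy S A H, P.value p π

end Problem

/-! ### Learning algorithms and their interaction with the MDP -/

/-- The data of the first `t` episodes. -/
abbrev Data (S A : Type*) (H t : ℕ) := Fin t → Episode S A H

/-- A learning algorithm `((π^t)_t, τ, π̂)`, given as functions of the data collected so far. -/
structure Algorithm (S A : Type*) [Fintype A] (H : ℕ) where
  /-- sampling rule: the policy `π^{t+1}` played in episode `t + 1`, given the first `t` episodes -/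
  policy : ∀ {t : ℕ}, Data S A H t → Policy S A H
  /-- stopping rule: whether the algorithm may stop after `t` episodes -/
  halts : ∀ {t : ℕ}, Data S A H t → Prop
  /-- decision rule: the policy returned when the algorithm stops after `t` episodes -/
  output : ∀ {t : ℕ}, Data S A H t → Policy S A H

namespace Algorithm

variable {S A : Type*} [Fintype S] [Fintype A] {H : ℕ}

/-- The first `t` episodes of an infinite run (episode number `i + 1` has index `i`). -/
def firstEpisodes (ω : ℕ → Episode S A H) (t : ℕ) : Data S A H t := fun i => ω i

/-- Law of episode `n + 2` given the first `n + 1` episodes. -/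
def nextEpisode (alg : Algorithm S A H) (s₁ : S) (p : Transitions S A H) (n : ℕ) :
    Kernel ((i : Finset.Iic n) → Episode S A H) (Episode S A H) :=
  Kernel.ofFunOfCountable fun x => episodeLaw s₁ p
    (alg.policy (t := n + 1) fun i => x ⟨i, Finset.mem_Iic.2 (Nat.lt_succ_iff.1 i.2)⟩)

instance (alg : Algorithm S A H) (s₁ : S) (p : Transitions S A H) (n : ℕ) :
    IsMarkovKernel (alg.nextEpisode s₁ p n) :=
  ⟨fun _ => by unfold nextEpisode Kernel.ofFunOfCountable; dsimp; infer_instance⟩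

/-- Law of the sequence of all episodes when, for every `t`, episode `t + 1` is played with
`π^{t+1}` (the sequence is continued after the stopping time). -/
def law (alg : Algorithm S A H) (s₁ : S) (p : Transitions S A H) :
    Measure (ℕ → Episode S A H) :=
  Kernel.trajMeasure (X := fun _ => Episode S A H)
    (episodeLaw s₁ p (alg.policy (t := 0) Fin.elim0)) (alg.nextEpisode s₁ p)

/-- The stopping time `τ`, the least number of episodes after which the stopping rule holds
(`⊤` if there is none). -/
def stoppingTime (alg : Algorithm S A H) (ω : ℕ → Episode S A H) : ℕ∞ :=
  ⨅ (t : ℕ) (_ : alg.halts (firstEpisodes ω t)), (t : ℕ∞)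

/-- `(ε, δ)`-PAC for best policy identification in the regularized MDP: whatever the transitions,
with probability at least `1 - δ` the algorithm stops and returns an `ε`-optimal policy. -/
def IsPAC (alg : Algorithm S A H) (P : Problem S A H) (ε δ : ℝ) : Prop :=
  ∀ p : Transitions S A H, ENNReal.ofReal (1 - δ) ≤ alg.law P.start p
    {ω | ∃ t : ℕ, alg.stoppingTime ω = t ∧
      P.optValue p - P.value p (alg.output (firstEpisodes ω t)) ≤ ε}

end Algorithm

/-! ### The algorithm UCBVI-Ent -/

section UCBVIEnt

variable {S A : Type*} [Fintype S] [Fintype A] {H t : ℕ}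

open Classical in
/-- The count `n_h^t(s, a)`. -/
def visits (D : Data S A H t) (h : Fin H) (s : S) (a : A) : ℕ :=
  (Finset.univ.filter fun i => (D i).state h = s ∧ (D i).action h = a).card

open Classical in
/-- The count `n_h^t(s' | s, a)`. -/
def transits (D : Data S A H t) (h : Fin H) (s : S) (a : A) (s' : S) : ℕ :=
  (Finset.univ.filter fun i =>
    (D i).state h = s ∧ (D i).action h = a ∧ (D i).next h = s').card

/-- The empirical transitions `p̂_h^t(s' | s, a)`, uniform if `(s, a)` was not visited. -/
def empirical (D : Data S A H t) (h : Fin H) (s : S) (a : A) (s' : S) : ℝ :=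
  if visits D h s a = 0 then 1 / (Fintype.card S : ℝ)
  else (transits D h s a s' : ℝ) / (visits D h s a : ℝ)

/-- The product `S A H` of the number of states, the number of actions and the horizon. -/
def size (S A : Type*) [Fintype S] [Fintype A] (H : ℕ) : ℝ :=
  (Fintype.card S : ℝ) * (Fintype.card A : ℝ) * (H : ℝ)

/-- `β^KL(δ, n) = log(4SAH/δ) + S log(e(1+n))`. -/
def betaKL (S A : Type*) [Fintype S] [Fintype A] (H : ℕ) (δ : ℝ) (n : ℕ) : ℝ :=
  Real.log (4 * size S A H / δ) + (Fintype.card S : ℝ) * Real.log (Real.exp 1 * (1 + (n : ℝ)))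

/-- `β^conc(δ, n) = log(4SAH/δ) + log(4 e n (2n+1))`. -/
def betaConc (S A : Type*) [Fintype S] [Fintype A] (H : ℕ) (δ : ℝ) (n : ℕ) : ℝ :=
  Real.log (4 * size S A H / δ) + Real.log (4 * Real.exp 1 * (n : ℝ) * (2 * (n : ℝ) + 1))

/-- `β^𝓗(δ, n) = log²(n) (log(4SAH/δ) + log(n(n+1)))`. -/
def betaEnt (S A : Type*) [Fintype S] [Fintype A] (H : ℕ) (δ : ℝ) (n : ℕ) : ℝ :=
  Real.log (n : ℝ) ^ 2 *
    (Real.log (4 * size S A H / δ) + Real.log ((n : ℝ) * ((n : ℝ) + 1)))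

/-- The solution `x_1, …, x_{H+1}` of a backward recursion `x_h = F_h(x_{h+1})` with given
final value `x_{H+1}`. -/
def backward {X : Type*} (F : Fin H → X → X) (final : X) : Fin (H + 1) → X :=
  Fin.reverseInduction final F

variable (P : Problem S A H) (δ : ℝ) (D : Data S A H t)

/-- The entropy bonus
`b^{𝓗,t}_h(s,a) = √(2 β^𝓗(δ, n) / n) + min(β^KL(δ, n) / n, log S)` with `n = n_h^t(s,a) > 0`. -/
def bonusEnt (h : Fin H) (s : S) (a : A) : ℝ :=
  √(2 * betaEnt S A H δ (visits D h s a) / (visits D h s a : ℝ)) +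
    min (betaKL S A H δ (visits D h s a) / (visits D h s a : ℝ)) (Real.log (Fintype.card S))

/-- The Bernstein bonus
`b^{B,t}_h(s,a) = 3 √(Var_{p̂_h^t}(V)(s,a) β^conc(δ, n) / n) + 9 H² R_max β^KL(δ, n) / n`
with `n = n_h^t(s,a) > 0`, where `V` is the upper bound on the value at step `h + 1`. -/
def bonusBern (V : S → ℝ) (h : Fin H) (s : S) (a : A) : ℝ :=
  3 * √(variance (empirical D h s a) V *
      (betaConc S A H δ (visits D h s a) / (visits D h s a : ℝ))) +
    9 * (H : ℝ) ^ 2 * P.Rmax * betaKL S A H δ (visits D h s a) / (visits D h s a : ℝ)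

/-- The bonus `b^{p,t}_h = b^{B,t}_h + b^{corr,t}_h` with the correction
`b^{corr,t}_h(s,a) = (1/H) p̂_h^t (V_up - V_low)(s,a)`. -/
def bonusTrans (Vup Vlow : S → ℝ) (h : Fin H) (s : S) (a : A) : ℝ :=
  bonusBern P δ D Vup h s a + 1 / (H : ℝ) * mean (empirical D h s a) (fun s' => Vup s' - Vlow s')

/-- The empirical entropy-augmented reward `r_h(s,a) + κ 𝓗(p̂_h^t(s,a))`. -/
def empiricalReward (h : Fin H) (s : S) (a : A) : ℝ :=
  P.reward h s a + P.kap * entropy (empirical D h s a)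

/-- Upper confidence bound on the `Q`-function at step `h`, from the bounds `Vup`, `Vlow` at step
`h + 1`. The bonuses are `+∞` if `(s,a)` was not visited, so clipping then gives `H R_max`. -/
def upperQ (Vup Vlow : S → ℝ) (h : Fin H) (s : S) (a : A) : ℝ :=
  if visits D h s a = 0 then (H : ℝ) * P.Rmax
  else clip (empiricalReward P D h s a + mean (empirical D h s a) Vup
    + bonusTrans P δ D Vup Vlow h s a + P.kap * bonusEnt δ D h s a) 0 ((H : ℝ) * P.Rmax)

/-- Lower confidence bound on the `Q`-function at step `h`, from the bounds `Vup`, `Vlow` at step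
`h + 1`. The bonuses are `+∞` if `(s,a)` was not visited, so clipping then gives `0`. -/
def lowerQ (Vup Vlow : S → ℝ) (h : Fin H) (s : S) (a : A) : ℝ :=
  if visits D h s a = 0 then 0
  else clip (empiricalReward P D h s a + mean (empirical D h s a) Vlow
    - bonusTrans P δ D Vup Vlow h s a - P.kap * bonusEnt δ D h s a) 0 ((H : ℝ) * P.Rmax)

/-- `F_λ(q) = max_{π ∈ Δ_A} (⟨π, q⟩ - λ Φ(π))`. -/
def conjugate (q : A → ℝ) : ℝ := ⨆ x : stdSimplex ℝ A, (mean x q - P.lam * P.Φ x)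

/-- `argmax_{π ∈ Δ_A} (⟨π, q⟩ - λ Φ(π))`. -/
def argmaxDist [Nonempty A] (q : A → ℝ) : stdSimplex ℝ A :=
  Classical.epsilon fun x : stdSimplex ℝ A =>
    ∀ y : stdSimplex ℝ A, mean y q - P.lam * P.Φ y ≤ mean x q - P.lam * P.Φ x

/-- The pairs of upper and lower confidence bounds on the value functions at steps `1, …, H + 1`;
they vanish at step `H + 1` and are `F_λ` of the bounds on the `Q`-functions at steps `h ≤ H`. -/
def confidenceV : Fin (H + 1) → (S → ℝ) × (S → ℝ) :=
  backward (fun h V => (fun s => conjugate P (upperQ P δ D V.1 V.2 h s),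
    fun s => conjugate P (lowerQ P δ D V.1 V.2 h s))) (fun _ => 0, fun _ => 0)

/-- The optimistic policy `π^{t+1}`: the greedy policy for the upper confidence bounds. -/
def optimisticPolicy [Nonempty A] : Policy S A H := fun h s =>
  argmaxDist P
    (upperQ P δ D (confidenceV P δ D h.succ).1 (confidenceV P δ D h.succ).2 h s)

/-- The regularization-agnostic gap `G_h^t(s,a)`, from `W = π_{h+1}^{t+1} G_{h+1}^t`. The bonuses
are `+∞` if `(s,a)` was not visited, so clipping then gives `H R_max`. -/
def gapQ (W : S → ℝ) (h : Fin H) (s : S) (a : A) : ℝ :=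
  if visits D h s a = 0 then (H : ℝ) * P.Rmax
  else clip (2 * bonusBern P δ D (confidenceV P δ D h.succ).1 h s a
    + 4 * (H : ℝ) ^ 2 * P.Rmax * betaKL S A H δ (visits D h s a) / (visits D h s a : ℝ)
    + 2 * P.kap * bonusEnt δ D h s a
    + (1 + 3 / (H : ℝ)) * mean (empirical D h s a) W) 0 ((H : ℝ) * P.Rmax)

/-- The averaged gaps `s ↦ π_h^{t+1} G_h^t(s)` at steps `1, …, H + 1`, with `G_{H+1}^t = 0`. -/
def gapV [Nonempty A] : Fin (H + 1) → S → ℝ :=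
  backward (fun h W s => mean (optimisticPolicy P δ D h s) (gapQ P δ D W h s)) (fun _ => 0)

/-- UCBVI-Ent with Bernstein bonuses and the regularization-agnostic stopping rule: play the
optimistic policy `π^{t+1}`, stop at the first `t` with `π_1^{t+1} G_1^t(s_1) ≤ ε`, and return
`π^{t+1}` for this `t`. -/
def ucbviEnt [Nonempty A] (P : Problem S A H) (ε δ : ℝ) : Algorithm S A H where
  policy D := optimisticPolicy P δ D
  halts D := gapV P δ D 0 P.start ≤ ε
  output D := optimisticPolicy P δ D

/-- The logarithmic factor `L = 1 + log(SAH max(1, R_max / ε)) + max(0, log log(SAH / δ))`. -/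
def logFactor (P : Problem S A H) (ε δ : ℝ) : ℝ :=
  1 + Real.log (size S A H * max 1 (P.Rmax / ε)) +
    max 0 (Real.log (Real.log (size S A H / δ)))

/-- The sample complexity rate
`H³SA R_max² log(SAH/δ) L⁴ / ε² + H³SA R_max (log(SAH/δ) + S L) L / ε`. -/
def rate (P : Problem S A H) (ε δ : ℝ) : ℝ :=
  (H : ℝ) ^ 3 * (Fintype.card S : ℝ) * (Fintype.card A : ℝ) * P.Rmax ^ 2 *
      Real.log (size S A H / δ) * logFactor P ε δ ^ 4 / ε ^ 2 +
    (H : ℝ) ^ 3 * (Fintype.card S : ℝ) * (Fintype.card A : ℝ) * P.Rmax *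
      (Real.log (size S A H / δ) + (Fintype.card S : ℝ) * logFactor P ε δ) *
      logFactor P ε δ / ε

end UCBVIEnt

end RegMDP

end

noncomputable section

set_option linter.unusedSectionVars false

namespace RegMDP

/-! ### Means, variances, entropy and change of measure on a finite set -/

section Elementary

variable {X : Type*} [Fintype X]

/-! Everything happens on one event, `goodEvent`, on which four confidence statements hold for all
triples `(h, s, a)` after every number of episodes: a Kullback-Leibler bound between empirical and
true transitions, in dual form (`KLBound`); Bernstein's inequality for the single fixed function V*;
concentration of the empirical entropy; and a lower bound on the number of visits by half its
predictable expectation. Each fails with probability at most δ/(4SAH) per triple. All four come from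
Ville's inequality for explicit nonnegative supermartingales: a Dirichlet mixture for KL,
exponential processes for the rest, with a union bound over the number of visits for Bernstein and
entropy.

On this event, backward induction traps V* between the lower and upper bounds
(`Confident.optimism`), and a second induction shows that the gap dominates both upper minus lower
bound and upper bound minus the value of the optimistic policy (`Confident.gap`). The KL bound moves
unobservable quantities from p to the empirical p̂ at the price of a factor 1 + O(1/H) and a term of
order H² R_max β^KL/n; the correction bonus and the factor 1 + 3/H in the gap pay for this. So a gap
of at most ε certifies ε-optimality.

For the sample complexity the transfer is run in the opposite direction: the gap obeys a recursion
with the true transitions and the true variances of the value of the played policy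
(`Confident.gapQ_le`), and unrolling it costs (1 + 9/H)^H ≤ e^9. The variances along an episode add
up to at most (H R_max)² in expectation (`sum_occupancy_mul_variance_le`), which saves a factor H
over the termwise bound. Cauchy-Schwarz and the pigeonhole bound ∑ o_t/N_t ≤ 2 log(1+T) then bound
the sum of the first T gaps by O(√(Ta) Λ² + b), where Λ = 1 + log(1+T) (`sum_gapV_le`). Before
stopping this sum is at least εT. Solving for T leaves Λ on the right; since T enters there only
through a logarithm, Λ is in turn bounded by a multiple of L.

The entropy bonus is proportional to κ, so the stated rate needs κ ≤ 2 R_max, which `S ≥ 2 or κ = 0`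
provides. Termination alone does not: there R_max + κ takes the place of R_max (`exists_halts`). -/

theorem mean_mono {q f g : X → ℝ} (hq : ∀ x, 0 ≤ q x) (h : ∀ x, f x ≤ g x) :
    mean q f ≤ mean q g :=
  Finset.sum_le_sum fun x _ => mul_le_mul_of_nonneg_left (h x) (hq x)

theorem mean_nonneg {q f : X → ℝ} (hq : ∀ x, 0 ≤ q x) (h : ∀ x, 0 ≤ f x) : 0 ≤ mean q f :=
  Finset.sum_nonneg fun x _ => mul_nonneg (hq x) (h x)

theorem mean_const {q : X → ℝ} (hq : q ∈ stdSimplex ℝ X) (c : ℝ) : mean q (fun _ => c) = c := by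
  simp [mean, ← Finset.sum_mul, hq.2]

theorem mean_add (q f g : X → ℝ) : mean q (fun x => f x + g x) = mean q f + mean q g := by
  simp [mean, mul_add, Finset.sum_add_distrib]

theorem mean_sub (q f g : X → ℝ) : mean q (fun x => f x - g x) = mean q f - mean q g := by
  simp [mean, mul_sub, Finset.sum_sub_distrib]

theorem mean_const_mul (q : X → ℝ) (c : ℝ) (f : X → ℝ) :
    mean q (fun x => c * f x) = c * mean q f := by
  simp only [mean, Finset.mul_sum]
  exact Finset.sum_congr rfl fun x _ => by ring

theorem mean_add_const {q : X → ℝ} (hq : q ∈ stdSimplex ℝ X) (f : X → ℝ) (c : ℝ) :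
    mean q (fun x => f x + c) = mean q f + c := by
  rw [mean_add q f (fun _ => c), mean_const hq]

theorem mean_const_apply (q : stdSimplex ℝ X) (c : ℝ) : mean q (fun _ => c) = c :=
  mean_const q.2 c

theorem mean_add_const_apply (q : stdSimplex ℝ X) (f : X → ℝ) (c : ℝ) :
    mean q (fun x => f x + c) = mean q f + c :=
  mean_add_const q.2 f c

theorem mean_le {q f : X → ℝ} (hq : q ∈ stdSimplex ℝ X) {c : ℝ} (h : ∀ x, f x ≤ c) :
    mean q f ≤ c :=
  (mean_mono hq.1 h).trans_eq (mean_const hq c)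

theorem le_mean {q f : X → ℝ} (hq : q ∈ stdSimplex ℝ X) {c : ℝ} (h : ∀ x, c ≤ f x) :
    c ≤ mean q f :=
  (mean_const hq c).symm.le.trans (mean_mono hq.1 h)

theorem variance_nonneg {q : X → ℝ} (hq : ∀ x, 0 ≤ q x) (f : X → ℝ) : 0 ≤ variance q f :=
  Finset.sum_nonneg fun x _ => mul_nonneg (hq x) (sq_nonneg _)

theorem variance_eq {q : X → ℝ} (hq : q ∈ stdSimplex ℝ X) (f : X → ℝ) :
    variance q f = mean q (fun x => f x ^ 2) - mean q f ^ 2 := by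
  have : ∀ x, q x * (f x - mean q f) ^ 2
      = q x * f x ^ 2 + (-(2 * mean q f) * (q x * f x) + mean q f ^ 2 * q x) := fun x => by ring
  simp only [variance, this, Finset.sum_add_distrib, ← Finset.mul_sum, hq.2]
  change mean q (fun x => f x ^ 2) + (-(2 * mean q f) * mean q f + mean q f ^ 2 * 1) = _
  ring

theorem variance_le_mean_sq {q : X → ℝ} (hq : q ∈ stdSimplex ℝ X) (f : X → ℝ) (c : ℝ) :
    variance q f ≤ mean q (fun x => (f x - c) ^ 2) := by
  have : mean q (fun x => (f x - c) ^ 2)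
      = mean q (fun x => f x ^ 2) + -(2 * c) * mean q f + c ^ 2 := by
    rw [← mean_const_mul, ← mean_add, ← mean_add_const hq]
    congr 1; funext x; ring
  rw [this, variance_eq hq]
  nlinarith [sq_nonneg (mean q f - c)]

theorem variance_le_two_mul {q : X → ℝ} (hq : q ∈ stdSimplex ℝ X) (f g : X → ℝ) :
    variance q f ≤ 2 * variance q g + 2 * variance q (fun x => f x - g x) := by
  simp only [variance, Finset.mul_sum, ← Finset.sum_add_distrib, mean_sub]
  refine Finset.sum_le_sum fun x _ => ?_
  have := hq.1 x
  nlinarith [mul_nonneg this (sq_nonneg ((g x - mean q g) - (f x - g x - (mean q f - mean q g))))]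

theorem variance_le_mul_mean {q f : X → ℝ} (hq : q ∈ stdSimplex ℝ X) {B : ℝ}
    (h0 : ∀ x, 0 ≤ f x) (hB : ∀ x, f x ≤ B) : variance q f ≤ B * mean q f := by
  refine (variance_le_mean_sq hq f 0).trans ?_
  rw [← mean_const_mul]
  exact mean_mono hq.1 fun x => by nlinarith [h0 x, hB x]

theorem variance_add_const {q : X → ℝ} (hq : q ∈ stdSimplex ℝ X) (f : X → ℝ) (c : ℝ) :
    variance q (fun x => f x + c) = variance q f := by
  simp [variance, mean_add_const hq]

theorem variance_neg (q f : X → ℝ) : variance q (fun x => - f x) = variance q f := by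
  have : mean q (fun x => - f x) = - mean q f := by simp [mean]
  simp only [variance, this]
  exact Finset.sum_congr rfl fun x _ => by ring

theorem variance_of_subsingleton [Subsingleton X] {q : X → ℝ} (hq : q ∈ stdSimplex ℝ X)
    (f : X → ℝ) : variance q f = 0 := by
  refine Finset.sum_eq_zero fun x _ => ?_
  have : mean q f = f x := by
    rw [← mean_const hq (f x)]; congr 1; funext y; rw [Subsingleton.elim x y]
  simp [this]

theorem entropy_nonneg {q : X → ℝ} (hq : q ∈ stdSimplex ℝ X) : 0 ≤ entropy q :=
  Finset.sum_nonneg fun x _ => Real.negMulLog_nonneg (hq.1 x) (mem_Icc_of_mem_stdSimplex hq x).2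

theorem entropy_le_log_card [Nonempty X] {q : X → ℝ} (hq : q ∈ stdSimplex ℝ X) :
    entropy q ≤ Real.log (Fintype.card X) := by
  have hc : (0 : ℝ) < Fintype.card X := by exact_mod_cast Fintype.card_pos
  -- Gibbs' inequality against the uniform distribution, summand by summand; the corrections 1/|X| -
  -- q x cancel in the sum.
  have h : ∀ x, Real.negMulLog (q x) ≤ q x * Real.log (Fintype.card X)
      + ((Fintype.card X : ℝ)⁻¹ - q x) := by
    intro x
    rcases (hq.1 x).eq_or_lt with h0 | h0
    · rw [← h0]; simp
    · have := Real.log_le_sub_one_of_pos (x := ((Fintype.card X : ℝ) * q x)⁻¹) (by positivity)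
      rw [Real.log_inv, Real.log_mul hc.ne' h0.ne'] at this
      have h2 := mul_le_mul_of_nonneg_left this h0.le
      have h3 : q x * ((Fintype.card X : ℝ) * q x)⁻¹ = (Fintype.card X : ℝ)⁻¹ := by
        field_simp
      rw [mul_sub, h3] at h2
      simp only [Real.negMulLog]
      linarith
  refine (Finset.sum_le_sum fun x _ => h x).trans ?_
  rw [Finset.sum_add_distrib, ← Finset.sum_mul, hq.2, Finset.sum_sub_distrib, hq.2]
  simp [hc.ne']

theorem exp_le_one_add_mul {u θ : ℝ} (h0 : 0 ≤ u) (hu : u ≤ θ) (hθ : θ ≤ 1) :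
    Real.exp u ≤ 1 + (1 + θ) * u := by
  have h := Real.norm_exp_sub_one_sub_id_le (x := u)
    (by rw [Real.norm_eq_abs, abs_of_nonneg h0]; linarith)
  rw [Real.norm_eq_abs, Real.norm_eq_abs, abs_of_nonneg h0] at h
  have := (abs_le.1 h).2
  nlinarith

theorem exp_neg_le_one_sub_mul {u θ : ℝ} (h0 : 0 ≤ u) (hu : u ≤ θ) :
    Real.exp (-u) ≤ 1 - (1 - θ / 2) * u := by
  -- From (1 - u + u²/2)(1 + u + u²/2) = 1 + u⁴/4 ≥ 1 and e^u ≥ 1 + u + u²/2.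
  have : Real.exp (-u) ≤ 1 - u + u ^ 2 / 2 := by
    have h1 := Real.quadratic_le_exp_of_nonneg h0
    have h2 : Real.exp (-u) * Real.exp u = 1 := by rw [← Real.exp_add]; simp
    have h3 : 0 < Real.exp (-u) := Real.exp_pos _
    have h4 : 0 ≤ 1 - u + u ^ 2 / 2 := by nlinarith [sq_nonneg (u - 1)]
    have h5 : Real.exp (-u) * (1 + u + u ^ 2 / 2) ≤ 1 := by
      nlinarith
    nlinarith [mul_nonneg h4 (by positivity : 0 ≤ 1 + u + u ^ 2 / 2), sq_nonneg (u^2),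
      mul_nonneg h3.le (sq_nonneg (u ^ 2))]
  nlinarith

/-- The dual form of `KL(q, p) ≤ k`. -/
def KLBound (q p : X → ℝ) (k : ℝ) : Prop :=
  ∀ g : X → ℝ, mean q g ≤ Real.log (mean p fun x => Real.exp (g x)) + k

theorem mean_exp_pos {p : X → ℝ} (hp : p ∈ stdSimplex ℝ X) (g : X → ℝ) :
    0 < mean p fun x => Real.exp (g x) := by
  by_contra h
  have h0 : ∀ x, 0 ≤ p x * Real.exp (g x) := fun x => mul_nonneg (hp.1 x) (Real.exp_pos _).le
  have h1 : mean p (fun x => Real.exp (g x)) = 0 :=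
    le_antisymm (not_lt.1 h) (Finset.sum_nonneg fun x _ => h0 x)
  have h2 := (Finset.sum_eq_zero_iff_of_nonneg fun x _ => h0 x).1 h1
  have h3 : ∑ x, p x = 0 := Finset.sum_eq_zero fun x hx => by
    have := h2 x hx
    simpa [(Real.exp_pos _).ne'] using this
  rw [hp.2] at h3
  norm_num at h3

/-- The dual form is tested at (θ/B) g, whose values lie in [0, θ], where the exponential is linear
up to a relative error θ. With θ = 1/H the multiplicative loss survives H steps of recursion; with θ
= 1 it serves for variances. -/
theorem KLBound.mean_le {q p : X → ℝ} {k B θ : ℝ} (hp : p ∈ stdSimplex ℝ X) (h : KLBound q p k)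
    {g : X → ℝ} (hg : ∀ x, 0 ≤ g x) (hB : ∀ x, g x ≤ B) (hB0 : 0 ≤ B)
    (hθ : 0 < θ) (hθ1 : θ ≤ 1) : mean q g ≤ (1 + θ) * mean p g + B * k / θ := by
  rcases hB0.eq_or_lt with rfl | hB0
  · have : g = fun _ => 0 := funext fun x => le_antisymm (hB x) (hg x)
    simp [this, mean]
  have h1 := h fun x => θ / B * g x
  have hpos := mean_exp_pos hp fun x => θ / B * g x
  have h2 : mean p (fun x => Real.exp (θ / B * g x)) ≤ 1 + (1 + θ) * (θ / B * mean p g) := by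
    rw [← mean_const_mul, ← mean_const_mul, add_comm, ← mean_add_const hp]
    refine mean_mono hp.1 fun x => ?_
    rw [add_comm]
    refine exp_le_one_add_mul (mul_nonneg (by positivity) (hg x)) ?_ hθ1
    calc θ / B * g x ≤ θ / B * B := by gcongr; exact hB x
      _ = θ := by field_simp
  have h3 := Real.log_le_sub_one_of_pos hpos
  rw [mean_const_mul] at h1
  have h4 : θ / B * mean q g ≤ (1 + θ) * (θ / B * mean p g) + k := by linarith
  have h5 := mul_le_mul_of_nonneg_left h4 (by positivity : 0 ≤ B / θ)
  have e1 : B / θ * (θ / B * mean q g) = mean q g := by field_simp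
  have e2 : B / θ * ((1 + θ) * (θ / B * mean p g) + k) = (1 + θ) * mean p g + B * k / θ := by
    field_simp
  rwa [e1, e2] at h5

theorem KLBound.le_mean {q p : X → ℝ} {k B θ : ℝ} (hp : p ∈ stdSimplex ℝ X)
    (hq : q ∈ stdSimplex ℝ X) (h : KLBound q p k)
    {g : X → ℝ} (hg : ∀ x, 0 ≤ g x) (hB : ∀ x, g x ≤ B) (hB0 : 0 ≤ B)
    (hθ : 0 < θ) (hθ1 : θ ≤ 1) : mean p g ≤ (1 + θ) * (mean q g + B * k / θ) := by
  have hq0 := mean_nonneg hq.1 hg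
  rcases hB0.eq_or_lt with rfl | hB0
  · have : g = fun _ => 0 := funext fun x => le_antisymm (hB x) (hg x)
    simp [this, mean]
  have h1 := h fun x => -(θ / B) * g x
  have hpos := mean_exp_pos hp fun x => -(θ / B) * g x
  have h2 : mean p (fun x => Real.exp (-(θ / B) * g x)) ≤
      -((1 - θ / 2) * (θ / B)) * mean p g + 1 := by
    rw [← mean_const_mul, ← mean_add_const hp]
    refine mean_mono hp.1 fun x => ?_
    have := exp_neg_le_one_sub_mul (u := θ / B * g x) (θ := θ)
      (mul_nonneg (by positivity) (hg x)) (by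
        calc θ / B * g x ≤ θ / B * B := by gcongr; exact hB x
          _ = θ := by field_simp)
    rw [neg_mul]
    linarith
  have h3 := Real.log_le_sub_one_of_pos hpos
  rw [mean_const_mul] at h1
  have h4 : (1 - θ / 2) * (θ / B) * mean p g ≤ θ / B * mean q g + k := by linarith
  have h5 := mul_le_mul_of_nonneg_left h4 (by positivity : 0 ≤ B / θ)
  have e1 : B / θ * ((1 - θ / 2) * (θ / B) * mean p g) = (1 - θ / 2) * mean p g := by field_simp
  have e2 : B / θ * (θ / B * mean q g + k) = mean q g + B * k / θ := by field_simp
  rw [e1, e2] at h5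
  have h6 : 0 ≤ mean p g := mean_nonneg hp.1 hg
  have h7 := mul_le_mul_of_nonneg_left h5 (by positivity : 0 ≤ 1 + θ)
  -- (1 + θ)(1 - θ/2) ≥ 1 because θ ≤ 1.
  nlinarith [mul_nonneg h6 (mul_nonneg hθ.le (sub_nonneg.2 hθ1))]

/-- Centring at the mean of the other distribution only increases the second moment, and makes (f -
p f)² a fixed function bounded by B² to which the change of measure applies with θ = 1. -/
theorem KLBound.variance_le {q p : X → ℝ} {k B : ℝ} (hp : p ∈ stdSimplex ℝ X)
    (hq : q ∈ stdSimplex ℝ X) (h : KLBound q p k) {f : X → ℝ}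
    (hf : ∀ x, f x ∈ Set.Icc 0 B) :
    variance q f ≤ 2 * variance p f + B ^ 2 * k := by
  have hm : mean p f ∈ Set.Icc 0 B :=
    ⟨mean_nonneg hp.1 fun x => (hf x).1, RegMDP.mean_le hp fun x => (hf x).2⟩
  refine (variance_le_mean_sq hq f (mean p f)).trans ?_
  have := h.mean_le (B := B ^ 2) (θ := 1) hp (g := fun x => (f x - mean p f) ^ 2)
    (fun x => sq_nonneg _) (fun x => sq_le_sq' (by linarith [(hf x).1, hm.2])
      (by linarith [(hf x).2, hm.1])) (by positivity) one_pos le_rfl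
  have e : mean p (fun x => (f x - mean p f) ^ 2) = variance p f := rfl
  rw [e] at this
  linarith

theorem KLBound.variance_le' {q p : X → ℝ} {k B : ℝ} (hp : p ∈ stdSimplex ℝ X)
    (hq : q ∈ stdSimplex ℝ X) (h : KLBound q p k) {f : X → ℝ}
    (hf : ∀ x, f x ∈ Set.Icc 0 B) :
    variance p f ≤ 2 * variance q f + 2 * B ^ 2 * k := by
  have hm : mean q f ∈ Set.Icc 0 B :=
    ⟨mean_nonneg hq.1 fun x => (hf x).1, RegMDP.mean_le hq fun x => (hf x).2⟩
  refine (variance_le_mean_sq hp f (mean q f)).trans ?_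
  have := h.le_mean (B := B ^ 2) (θ := 1) hp hq (g := fun x => (f x - mean q f) ^ 2)
    (fun x => sq_nonneg _) (fun x => sq_le_sq' (by linarith [(hf x).1, hm.2])
      (by linarith [(hf x).2, hm.1])) (by positivity) one_pos le_rfl
  have e : mean q (fun x => (f x - mean q f) ^ 2) = variance q f := rfl
  rw [e] at this
  linarith

theorem clip_mem {x M : ℝ} (hM : 0 ≤ M) : clip x 0 M ∈ Set.Icc 0 M :=
  ⟨le_max_right _ _, max_le (min_le_right _ _) hM⟩

theorem le_clip {x y M : ℝ} (h : y ≤ x) (hM : y ≤ M) : y ≤ clip x 0 M :=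
  le_max_of_le_left (le_min h hM)

theorem clip_le {x y M : ℝ} (h : x ≤ y) (h0 : 0 ≤ y) : clip x 0 M ≤ y :=
  max_le ((min_le_left _ _).trans h) h0

theorem clip_sub_clip_le {x y M c : ℝ} (h : x - y ≤ c) (hM : 0 ≤ M) (hc : 0 ≤ c) :
    clip x 0 M - clip y 0 M ≤ c := by
  have h1 : y ≤ M → y ≤ clip y 0 M := fun h => le_clip le_rfl h
  rcases le_total y M with hy | hy
  · have := h1 hy
    rcases le_total x 0 with hx | hx
    · have : clip x 0 M ≤ 0 := clip_le hx le_rfl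
      linarith [(clip_mem (x := y) hM).1]
    · have : clip x 0 M ≤ x := clip_le le_rfl hx
      linarith
  · have : M ≤ clip y 0 M := le_clip hy le_rfl
    linarith [(clip_mem (x := x) hM).2]

/-- A weighted form of the inequality between arithmetic and geometric means. -/
theorem sqrt_mul_le_add {a b : ℝ} (ha : 0 ≤ a) (hb : 0 ≤ b) : 2 * √(a * b) ≤ a + b := by
  rw [Real.sqrt_mul ha]
  nlinarith [sq_nonneg (√a - √b), Real.sq_sqrt ha, Real.sq_sqrt hb]

theorem sqrt_add_le (a b : ℝ) (ha : 0 ≤ a) (hb : 0 ≤ b) : √(a + b) ≤ √a + √b := by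
  rw [Real.sqrt_le_left (by positivity)]
  nlinarith [Real.sq_sqrt ha, Real.sq_sqrt hb, mul_nonneg (Real.sqrt_nonneg a) (Real.sqrt_nonneg b)]

end Elementary

/-! ### Backward recursions -/

section Backward

variable {X : Type*} {H : ℕ}

theorem backward_last (F : Fin H → X → X) (x : X) : backward F x (Fin.last H) = x := by
  simp [backward]

theorem backward_castSucc (F : Fin H → X → X) (x : X) (h : Fin H) :
    backward F x h.castSucc = F h (backward F x h.succ) := by
  simp [backward]

end Backward

/-! ### The conjugate of the regularizer and the Bellman equations -/

namespace Problem

variable {S A : Type*} [Fintype A] {H : ℕ} (P : Problem S A H)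

theorem Φ_apply_nonpos (x : stdSimplex ℝ A) : P.Φ x ≤ 0 := P.Φ_nonpos _ x.2

/-- A lower semicontinuous function attains its minimum on the compact simplex. Taking g = 0 bounds
`Φ` below; taking g linear provides the argmax. -/
theorem exists_isMinOn [Nonempty A] {g : (A → ℝ) → ℝ} (hg : Continuous g) :
    ∃ x : stdSimplex ℝ A, ∀ y : stdSimplex ℝ A,
      P.lam * P.Φ x + g x ≤ P.lam * P.Φ y + g y := by
  have h1 : LowerSemicontinuousOn (fun x => P.lam * P.Φ x + g x) (stdSimplex ℝ A) := by
    refine LowerSemicontinuousOn.add ?_ hg.continuousOn.lowerSemicontinuousOn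
    exact (continuous_const_mul P.lam).comp_lowerSemicontinuousOn P.mirror.closed
      fun _ _ h => mul_le_mul_of_nonneg_left h P.lam_pos.le
  have hne : (stdSimplex ℝ A).Nonempty := Set.nonempty_coe_sort.1 inferInstance
  obtain ⟨x, hx, hmin⟩ := h1.exists_isMinOn hne (isCompact_stdSimplex ℝ A)
  exact ⟨⟨x, hx⟩, fun y => hmin y.2⟩

theorem neg_Φ_le [Nonempty A] (x : stdSimplex ℝ A) : - P.Φ x ≤ P.RΦ := by
  obtain ⟨x₀, h₀⟩ := P.exists_isMinOn (g := fun _ => 0) continuous_const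
  -- A real `⨆` over an unbounded family would be the default value 0, so boundedness of |Φ| has to
  -- be established before `RΦ` means anything.
  have hb : BddAbove (Set.range fun x : stdSimplex ℝ A => |P.Φ x|) := by
    refine ⟨- P.Φ x₀, ?_⟩
    rintro _ ⟨y, rfl⟩
    have := h₀ y
    simp only [add_zero] at this
    change |P.Φ y| ≤ _
    rw [abs_of_nonpos (P.Φ_apply_nonpos y)]
    exact neg_le_neg (le_of_mul_le_mul_left this P.lam_pos)
  exact (neg_le_abs _).trans (le_ciSup hb x)

theorem RΦ_nonneg [Nonempty A] : 0 ≤ P.RΦ :=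
  (neg_nonneg.2 (P.Φ_apply_nonpos (Classical.arbitrary (stdSimplex ℝ A)))).trans (P.neg_Φ_le _)

variable [Nonempty A]

theorem argmaxDist_spec (q : A → ℝ) (y : stdSimplex ℝ A) :
    mean y q - P.lam * P.Φ y ≤ mean (argmaxDist P q) q - P.lam * P.Φ (argmaxDist P q) := by
  refine Classical.epsilon_spec (p := fun x : stdSimplex ℝ A =>
    ∀ y : stdSimplex ℝ A, mean y q - P.lam * P.Φ y ≤ mean x q - P.lam * P.Φ x) ?_ y
  obtain ⟨x, hx⟩ := P.exists_isMinOn (g := fun x => - mean x q) (by unfold mean; fun_prop)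
  exact ⟨x, fun y => by have := hx y; change P.lam * P.Φ x + -mean x q ≤ P.lam * P.Φ y + -mean y q at this; linarith⟩

theorem conjugate_eq (q : A → ℝ) :
    conjugate P q = mean (argmaxDist P q) q - P.lam * P.Φ (argmaxDist P q) := by
  refine le_antisymm (ciSup_le fun y => P.argmaxDist_spec q y) ?_
  exact le_ciSup (f := fun x : stdSimplex ℝ A => mean x q - P.lam * P.Φ x)
    ⟨_, by rintro _ ⟨y, rfl⟩; exact P.argmaxDist_spec q y⟩ _

theorem le_conjugate (q : A → ℝ) (x : stdSimplex ℝ A) :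
    mean x q - P.lam * P.Φ x ≤ conjugate P q :=
  (P.argmaxDist_spec q x).trans_eq (P.conjugate_eq q).symm

theorem conjugate_mono {q q' : A → ℝ} (h : ∀ a, q a ≤ q' a) : conjugate P q ≤ conjugate P q' := by
  rw [P.conjugate_eq q]
  exact (sub_le_sub_right (mean_mono (argmaxDist P q).2.1 h) _).trans (P.le_conjugate q' _)

/-- Evaluating both conjugates at the maximizer for `q` makes the regularizer cancel. -/
theorem conjugate_sub_le {q q' : A → ℝ} {c : ℝ} (h : ∀ a, q a - q' a ≤ c) :
    conjugate P q - conjugate P q' ≤ c := by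
  rw [P.conjugate_eq q]
  have h1 := P.le_conjugate q' (argmaxDist P q)
  have h2 := RegMDP.mean_le (argmaxDist P q).2 h
  rw [mean_sub] at h2
  change mean (argmaxDist P q) q - mean (argmaxDist P q) q' ≤ c at h2
  linarith

theorem conjugate_le {q : A → ℝ} {c : ℝ} (h : ∀ a, q a ≤ c) :
    conjugate P q ≤ c + P.lam * P.RΦ := by
  rw [P.conjugate_eq q]
  have h1 := RegMDP.mean_le (argmaxDist P q).2 h
  have h2 := mul_le_mul_of_nonneg_left (P.neg_Φ_le (argmaxDist P q)) P.lam_pos.le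
  change mean (argmaxDist P q) q ≤ c at h1
  linarith

variable [Fintype S]

/-- The entropy-augmented reward `r_h(s, a) + κ 𝓗(p_h(s, a))`. -/
def augReward (p : Transitions S A H) (h : Fin H) (s : S) (a : A) : ℝ :=
  P.reward h s a + P.kap * entropy (p h s a)

/-- The Bellman backup `r_h + κ 𝓗(p_h) + p_h W`. -/
def bellmanQ (p : Transitions S A H) (W : S → ℝ) (h : Fin H) (s : S) (a : A) : ℝ :=
  P.augReward p h s a + mean (p h s a) W

/-- The optimal regularized value functions. -/
def optV (p : Transitions S A H) : Fin (H + 1) → S → ℝ :=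
  backward (fun h W s => conjugate P (P.bellmanQ p W h s)) fun _ => 0

/-- The regularized value functions of a policy. -/
def polV (p : Transitions S A H) (π : Policy S A H) : Fin (H + 1) → S → ℝ :=
  backward (fun h W s => mean (π h s) (P.bellmanQ p W h s) - P.lam * P.Φ (π h s)) fun _ => 0

theorem augReward_nonneg (p : Transitions S A H) (h : Fin H) (s : S) (a : A) :
    0 ≤ P.augReward p h s a :=
  add_nonneg (P.reward_mem h s a).1 (mul_nonneg P.kap_nonneg (entropy_nonneg (p h s a).2))

theorem augReward_le (p : Transitions S A H) (h : Fin H) (s : S) (a : A) :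
    P.augReward p h s a ≤ P.rmax + P.kap * Real.log (Fintype.card S) :=
  haveI : Nonempty S := ⟨s⟩
  add_le_add (P.reward_mem h s a).2
    (mul_le_mul_of_nonneg_left (entropy_le_log_card (p h s a).2) P.kap_nonneg)

theorem augReward_le_Rmax (p : Transitions S A H) (h : Fin H) (s : S) (a : A) :
    P.augReward p h s a ≤ P.Rmax := by
  have := P.augReward_le p h s a
  have := mul_nonneg P.lam_pos.le P.RΦ_nonneg
  simp only [Rmax]
  linarith

theorem Rmax_nonneg (hH : 1 ≤ H) : 0 ≤ P.Rmax :=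
  have p : Transitions S A H := fun _ _ _ =>
    haveI : Nonempty S := ⟨P.start⟩
    Classical.arbitrary _
  (P.augReward_nonneg p ⟨0, hH⟩ P.start (Classical.arbitrary A)).trans
    (P.augReward_le_Rmax p _ _ _)

theorem rmax_nonneg (hH : 1 ≤ H) : 0 ≤ P.rmax :=
  let m := P.reward_mem ⟨0, hH⟩ P.start (Classical.arbitrary A)
  m.1.trans m.2

theorem optV_castSucc (p : Transitions S A H) (h : Fin H) (s : S) :
    P.optV p h.castSucc s = conjugate P (P.bellmanQ p (P.optV p h.succ) h s) := by
  rw [optV, backward_castSucc]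

theorem polV_castSucc (p : Transitions S A H) (π : Policy S A H) (h : Fin H) (s : S) :
    P.polV p π h.castSucc s =
      mean (π h s) (P.bellmanQ p (P.polV p π h.succ) h s) - P.lam * P.Φ (π h s) := by
  rw [polV, backward_castSucc]

theorem optV_last (p : Transitions S A H) (s : S) : P.optV p (Fin.last H) s = 0 := by
  rw [optV, backward_last]

theorem polV_last (p : Transitions S A H) (π : Policy S A H) (s : S) :
    P.polV p π (Fin.last H) s = 0 := by
  rw [polV, backward_last]

theorem polV_le_optV (p : Transitions S A H) (π : Policy S A H) (h : Fin (H + 1)) :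
    ∀ s, P.polV p π h s ≤ P.optV p h s := by
  induction h using Fin.reverseInduction with
  | last => intro s; rw [optV_last, polV_last]
  | cast h ih =>
    intro s
    rw [optV_castSucc, polV_castSucc]
    refine (P.le_conjugate _ _).trans (P.conjugate_mono fun a => ?_)
    exact add_le_add_right (mean_mono (p h s a).2.1 ih) _

theorem polV_nonneg (p : Transitions S A H) (π : Policy S A H) (h : Fin (H + 1)) :
    ∀ s, 0 ≤ P.polV p π h s := by
  induction h using Fin.reverseInduction with
  | last => intro s; rw [polV_last]
  | cast h ih =>
    intro s
    rw [polV_castSucc]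
    have h1 : 0 ≤ mean (π h s) (P.bellmanQ p (P.polV p π h.succ) h s) :=
      mean_nonneg (π h s).2.1 fun a =>
        add_nonneg (P.augReward_nonneg p h s a) (mean_nonneg (p h s a).2.1 ih)
    have h2 := mul_nonneg P.lam_pos.le (neg_nonneg.2 (P.Φ_apply_nonpos (π h s)))
    linarith

/-- Each remaining step costs one `Rmax`: r_max + κ log S from the augmented reward and λ R_Φ from
the conjugate. -/
theorem optV_le (p : Transitions S A H) (h : Fin (H + 1)) :
    ∀ s, P.optV p h s ≤ ((H : ℝ) - (h : ℕ)) * P.Rmax := by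
  induction h using Fin.reverseInduction with
  | last => intro s; simp [optV_last]
  | cast h ih =>
    intro s
    rw [optV_castSucc]
    refine (P.conjugate_le (c := P.rmax + P.kap * Real.log (Fintype.card S)
      + ((H : ℝ) - (h.succ : ℕ)) * P.Rmax) fun a => ?_).trans_eq ?_
    · exact add_le_add (P.augReward_le p h s a) (RegMDP.mean_le (p h s a).2 ih)
    · simp only [Fin.val_succ, Fin.val_castSucc]
      push_cast
      rw [Rmax]; ring

theorem optV_le_mul (hH : 1 ≤ H) (p : Transitions S A H) (h : Fin (H + 1)) (s : S) :
    P.optV p h s ≤ H * P.Rmax := by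
  refine (P.optV_le p h s).trans ?_
  have := P.Rmax_nonneg hH
  gcongr
  simp

theorem optV_nonneg (p : Transitions S A H) (h : Fin (H + 1)) (s : S) : 0 ≤ P.optV p h s :=
  haveI : Nonempty (Policy S A H) := ⟨fun _ _ => Classical.arbitrary _⟩
  (P.polV_nonneg p (Classical.arbitrary _) h s).trans (P.polV_le_optV p _ h s)

theorem bellmanQ_optV_nonneg (p : Transitions S A H) (h : Fin H) (s : S) (a : A) :
    0 ≤ P.bellmanQ p (P.optV p h.succ) h s a :=
  add_nonneg (P.augReward_nonneg p h s a) (mean_nonneg (p h s a).2.1 (P.optV_nonneg p _))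

theorem bellmanQ_polV_nonneg (p : Transitions S A H) (π : Policy S A H) (h : Fin H) (s : S)
    (a : A) : 0 ≤ P.bellmanQ p (P.polV p π h.succ) h s a :=
  add_nonneg (P.augReward_nonneg p h s a) (mean_nonneg (p h s a).2.1 (P.polV_nonneg p π _))

theorem bellmanQ_optV_le (hH : 1 ≤ H) (p : Transitions S A H) (h : Fin H) (s : S) (a : A) :
    P.bellmanQ p (P.optV p h.succ) h s a ≤ H * P.Rmax := by
  refine (add_le_add (P.augReward_le_Rmax p h s a)
    (RegMDP.mean_le (p h s a).2 (P.optV_le p h.succ))).trans ?_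
  have := P.Rmax_nonneg hH
  have h2 : 0 ≤ ((h : ℕ) : ℝ) * P.Rmax := by positivity
  simp only [Fin.val_succ]
  push_cast
  linarith

end Problem

/-! ### Comparison of the thresholds -/

section Betas

variable {S A : Type*} [Fintype S] [Fintype A] {H : ℕ} {δ : ℝ}

theorem one_le_size [Nonempty S] [Nonempty A] (hH : 1 ≤ H) : 1 ≤ size S A H := by
  have h1 : (1 : ℝ) ≤ Fintype.card S := by exact_mod_cast Fintype.card_pos (α := S)
  have h2 : (1 : ℝ) ≤ Fintype.card A := by exact_mod_cast Fintype.card_pos (α := A)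
  have h3 : (1 : ℝ) ≤ H := by exact_mod_cast hH
  unfold size
  nlinarith [mul_nonneg (sub_nonneg.2 h1) (sub_nonneg.2 h2),
    mul_le_mul h1 h2 zero_le_one (by linarith)]

theorem log_four_le [Nonempty S] [Nonempty A] (hH : 1 ≤ H) (hδ : δ ∈ Set.Ioo (0 : ℝ) 1) :
    Real.log 4 ≤ Real.log (4 * size S A H / δ) := by
  refine Real.log_le_log (by norm_num) ?_
  rw [le_div_iff₀ hδ.1]
  nlinarith [one_le_size (S := S) (A := A) hH, hδ.2]

theorem one_le_log_four : 1 ≤ Real.log 4 := by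
  have : Real.log 4 = 2 * Real.log 2 := by
    rw [show (4 : ℝ) = 2 ^ 2 by norm_num, Real.log_pow]; norm_num
  linarith [Real.log_two_gt_d9]

theorem one_le_logSize [Nonempty S] [Nonempty A] (hH : 1 ≤ H) (hδ : δ ∈ Set.Ioo (0 : ℝ) 1) :
    1 ≤ Real.log (4 * size S A H / δ) :=
  one_le_log_four.trans (log_four_le hH hδ)

theorem log_exp_one_mul (n : ℕ) :
    Real.log (Real.exp 1 * (1 + (n : ℝ))) = 1 + Real.log (1 + (n : ℝ)) := by
  rw [Real.log_mul (Real.exp_pos 1).ne' (by positivity), Real.log_exp]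

theorem log_one_add_nonneg (n : ℕ) : 0 ≤ Real.log (1 + (n : ℝ)) :=
  Real.log_nonneg (by linarith [n.cast_nonneg (α := ℝ)])

theorem betaKL_pos [Nonempty S] [Nonempty A] (hH : 1 ≤ H) (hδ : δ ∈ Set.Ioo (0 : ℝ) 1) (n : ℕ) :
    0 < betaKL S A H δ n := by
  have := one_le_logSize (S := S) (A := A) hH hδ
  have := log_one_add_nonneg n
  unfold betaKL
  rw [log_exp_one_mul]
  positivity

/-- 4en(2n+1) ≤ 4 (e(1+n))², so the concentration threshold is at most twice the KL threshold, and
every lower-order term can be expressed by the latter. -/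
theorem log_conc_le {n : ℕ} (hn : n ≠ 0) :
    Real.log (4 * Real.exp 1 * (n : ℝ) * (2 * (n : ℝ) + 1)) ≤
      Real.log 4 + 2 * (1 + Real.log (1 + (n : ℝ))) := by
  have h1 : (1 : ℝ) ≤ n := by exact_mod_cast Nat.one_le_iff_ne_zero.2 hn
  have e : 2 * Real.log (Real.exp 1 * (1 + (n : ℝ))) =
      Real.log ((Real.exp 1 * (1 + (n : ℝ))) ^ 2) := by
    rw [Real.log_pow]; norm_num
  rw [← log_exp_one_mul, e, ← Real.log_mul (by norm_num) (by positivity)]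
  refine Real.log_le_log (by positivity) ?_
  have he := Real.add_one_le_exp 1
  have : (n : ℝ) * (2 * n + 1) ≤ Real.exp 1 * (1 + n) ^ 2 := by nlinarith [sq_nonneg (n : ℝ)]
  nlinarith [mul_le_mul_of_nonneg_left this (Real.exp_pos 1).le]

theorem betaConc_nonneg [Nonempty S] [Nonempty A] (hH : 1 ≤ H) (hδ : δ ∈ Set.Ioo (0 : ℝ) 1)
    {n : ℕ} (hn : n ≠ 0) : 0 ≤ betaConc S A H δ n := by
  have h1 : (1 : ℝ) ≤ n := by exact_mod_cast Nat.one_le_iff_ne_zero.2 hn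
  refine add_nonneg (zero_le_one.trans (one_le_logSize hH hδ)) (Real.log_nonneg ?_)
  have he := Real.add_one_le_exp 1
  nlinarith [mul_le_mul he h1 zero_le_one (Real.exp_pos 1).le]

theorem betaConc_le [Nonempty S] [Nonempty A] (hH : 1 ≤ H) (hδ : δ ∈ Set.Ioo (0 : ℝ) 1)
    {n : ℕ} (hn : n ≠ 0) : betaConc S A H δ n ≤ 2 * betaKL S A H δ n := by
  have h1 := log_conc_le hn
  have h2 := log_four_le (S := S) (A := A) hH hδ
  have h3 : (1 : ℝ) ≤ Fintype.card S := by exact_mod_cast Fintype.card_pos (α := S)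
  have h4 := log_one_add_nonneg n
  unfold betaConc betaKL
  rw [log_exp_one_mul]
  nlinarith

end Betas

/-! ### Empirical transitions and the transfer of Bernstein's bound -/

theorem sum_transits {S A : Type*} [Fintype S] {H t : ℕ} (D : Data S A H t)
    (h : Fin H) (s : S) (a : A) : ∑ x, transits D h s a x = visits D h s a := by
  classical
  unfold transits visits
  rw [Finset.card_eq_sum_card_fiberwise (f := fun i => (D i).next h) (t := Finset.univ)
    (fun _ _ => Finset.mem_univ _)]
  refine Finset.sum_congr rfl fun x _ => ?_
  rw [Finset.filter_filter]
  congr 1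
  ext i
  simp [and_assoc]

theorem empirical_mem {S A : Type*} [Fintype S] {H t : ℕ} (D : Data S A H t)
    (h : Fin H) (s : S) (a : A) : empirical D h s a ∈ stdSimplex ℝ S := by
  have : Nonempty S := ⟨s⟩
  constructor
  · intro x
    unfold empirical
    split_ifs <;> positivity
  · unfold empirical
    split_ifs with h0
    · have : (Fintype.card S : ℝ) ≠ 0 := by exact_mod_cast Fintype.card_ne_zero
      simp [this]
    · rw [← Finset.sum_div, ← Nat.cast_sum, sum_transits]
      exact div_self (by exact_mod_cast h0)

/-- Passing from the true variance of `f` to the empirical variance of an upper bound `g`. -/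
theorem bernstein_transfer {X : Type*} [Fintype X] {q p f g : X → ℝ} {k c H R : ℝ}
    (hp : p ∈ stdSimplex ℝ X) (hq : q ∈ stdSimplex ℝ X) (h : KLBound q p k) (hk : 0 ≤ k)
    (hc : 0 ≤ c) (hck : c ≤ 2 * k) (hH : 1 ≤ H) (hR : 0 ≤ R)
    (hf : ∀ x, f x ∈ Set.Icc 0 (H * R)) (hg : ∀ x, g x - f x ∈ Set.Icc 0 (H * R)) :
    √(2 * variance p f * c) + H * R * c / 3 ≤
      3 * √(variance q g * c) + 9 * H ^ 2 * R * k + 1 / H * mean q (fun x => g x - f x) := by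
  have hH0 : 0 < H := by linarith
  set M := mean q (fun x => g x - f x) with hM
  have hM0 : 0 ≤ M := mean_nonneg hq.1 fun x => (hg x).1
  have h1 := h.variance_le' hp hq hf
  have h2 := variance_le_two_mul hq f g
  have h3 : variance q (fun x => f x - g x) ≤ H * R * M := by
    rw [show (fun x => f x - g x) = fun x => - (g x - f x) from funext fun x => by ring,
      variance_neg]
    exact variance_le_mul_mean hq (fun x => (hg x).1) fun x => (hg x).2
  have hV := variance_nonneg hq.1 g
  -- The cross term H R M c is written as (M/H)(H² R c), so that the arithmetic-geometric inequality
  -- splits its root into M/H, which is the correction bonus, and a multiple of H² R c. The constant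
  -- 9 leaves room for 4 from this term, 3 from the KL error of the variance and 2/3 from the linear
  -- term of Bernstein's inequality.
  have e1 : 2 * variance p f * c ≤
      (8 * (variance q g * c) + 4 * ((M / H) * (2 * (H ^ 2 * R * c)))) + 4 * ((H * R) ^ 2 * k * c) := by
    have : M / H * (2 * (H ^ 2 * R * c)) = 2 * (H * R * M * c) := by field_simp
    rw [this]
    nlinarith
  have e2 : √(8 * (variance q g * c)) ≤ 3 * √(variance q g * c) := by
    rw [Real.sqrt_le_left (by positivity), mul_pow, Real.sq_sqrt (by positivity)]
    nlinarith [mul_nonneg hV hc]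
  have e3 : √(4 * ((M / H) * (2 * (H ^ 2 * R * c)))) ≤ M / H + 2 * (H ^ 2 * R * c) := by
    rw [Real.sqrt_mul (by norm_num), show √(4 : ℝ) = 2 by
      rw [show (4 : ℝ) = 2 ^ 2 by norm_num]; exact Real.sqrt_sq (by norm_num)]
    exact sqrt_mul_le_add (by positivity) (by positivity)
  have e4 : √(4 * ((H * R) ^ 2 * k * c)) ≤ 3 * (H * R * k) := by
    rw [Real.sqrt_le_left (by positivity)]
    have : (H * R) ^ 2 * k * c ≤ (H * R) ^ 2 * k * (2 * k) :=
      mul_le_mul_of_nonneg_left hck (by positivity)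
    nlinarith [mul_nonneg (sq_nonneg (H * R)) (sq_nonneg k)]
  have e5 := Real.sqrt_le_sqrt e1
  have e6 := sqrt_add_le (8 * (variance q g * c) + 4 * ((M / H) * (2 * (H ^ 2 * R * c))))
    (4 * ((H * R) ^ 2 * k * c)) (by positivity) (by positivity)
  have e7 := sqrt_add_le (8 * (variance q g * c)) (4 * ((M / H) * (2 * (H ^ 2 * R * c))))
    (by positivity) (by positivity)
  have e8 : H * R * k ≤ H ^ 2 * R * k := by
    have := mul_le_mul_of_nonneg_left hH (by positivity : 0 ≤ H * R * k)
    nlinarith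
  have e9 : H ^ 2 * R * c ≤ 2 * (H ^ 2 * R * k) := by
    have := mul_le_mul_of_nonneg_left hck (by positivity : 0 ≤ H ^ 2 * R)
    linarith
  have e10 : H * R * c ≤ 2 * (H * R * k) := by
    have := mul_le_mul_of_nonneg_left hck (by positivity : 0 ≤ H * R)
    linarith
  have e11 : 1 / H * M = M / H := by ring
  have e12 : 9 * H ^ 2 * R * k = 9 * (H ^ 2 * R * k) := by ring
  have e13 : 0 ≤ H * R * k := by positivity
  rw [e11, e12]
  linarith

/-! ### Optimism and the gap on the confidence event -/

section GoodEvent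

variable {S A : Type*} [Fintype S] [Fintype A] [Nonempty A] {H t : ℕ}

/-- The confidence regions for the transitions hold at the data `D`. -/
structure Confident (P : Problem S A H) (p : Transitions S A H) (δ : ℝ) (D : Data S A H t) :
    Prop where
  kl : ∀ h s a, visits D h s a ≠ 0 →
    KLBound (empirical D h s a) (p h s a) (betaKL S A H δ (visits D h s a) / visits D h s a)
  conc : ∀ h s a, visits D h s a ≠ 0 →
    |mean (empirical D h s a) (P.optV p h.succ) - mean (p h s a) (P.optV p h.succ)| ≤
      √(2 * variance (p h s a) (P.optV p h.succ) *
        (betaConc S A H δ (visits D h s a) / visits D h s a)) +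
      H * P.Rmax * (betaConc S A H δ (visits D h s a) / visits D h s a) / 3
  ent : ∀ h s a, visits D h s a ≠ 0 →
    |entropy (empirical D h s a) - entropy (p h s a)| ≤ bonusEnt δ D h s a

variable {P : Problem S A H} {p : Transitions S A H} {δ : ℝ} {D : Data S A H t}

/-- The upper confidence bounds on the value functions. -/
def upperV (P : Problem S A H) (δ : ℝ) (D : Data S A H t) (h : Fin (H + 1)) : S → ℝ :=
  (confidenceV P δ D h).1

/-- The lower confidence bounds on the value functions. -/
def lowerV (P : Problem S A H) (δ : ℝ) (D : Data S A H t) (h : Fin (H + 1)) : S → ℝ :=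
  (confidenceV P δ D h).2

theorem upperV_castSucc (h : Fin H) (s : S) : upperV P δ D h.castSucc s =
    conjugate P (upperQ P δ D (upperV P δ D h.succ) (lowerV P δ D h.succ) h s) := by
  rw [upperV, confidenceV, backward_castSucc]; rfl

theorem lowerV_castSucc (h : Fin H) (s : S) : lowerV P δ D h.castSucc s =
    conjugate P (lowerQ P δ D (upperV P δ D h.succ) (lowerV P δ D h.succ) h s) := by
  rw [lowerV, confidenceV, backward_castSucc]; rfl

theorem upperV_last (s : S) : upperV P δ D (Fin.last H) s = 0 := by
  rw [upperV, confidenceV, backward_last]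

theorem lowerV_last (s : S) : lowerV P δ D (Fin.last H) s = 0 := by
  rw [lowerV, confidenceV, backward_last]

theorem gapV_last (s : S) : gapV P δ D (Fin.last H) s = 0 := by
  rw [gapV, backward_last]

theorem gapV_castSucc (h : Fin H) (s : S) : gapV P δ D h.castSucc s =
    mean (optimisticPolicy P δ D h s) (gapQ P δ D (gapV P δ D h.succ) h s) := by
  rw [gapV, backward_castSucc]

theorem gapQ_mem (hH : 1 ≤ H) (W : S → ℝ) (h : Fin H) (s : S) (a : A) :
    gapQ P δ D W h s a ∈ Set.Icc 0 (H * P.Rmax) := by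
  have : 0 ≤ H * P.Rmax := mul_nonneg (by positivity) (P.Rmax_nonneg hH)
  unfold gapQ
  split_ifs
  · exact ⟨this, le_rfl⟩
  · exact clip_mem this

theorem gapV_mem (hH : 1 ≤ H) (h : Fin (H + 1)) (s : S) :
    gapV P δ D h s ∈ Set.Icc 0 (H * P.Rmax) := by
  have hR : 0 ≤ H * P.Rmax := mul_nonneg (by positivity) (P.Rmax_nonneg hH)
  induction h using Fin.lastCases with
  | last => rw [gapV_last]; exact ⟨le_rfl, hR⟩
  | cast h =>
    rw [gapV_castSucc]
    exact ⟨le_mean (optimisticPolicy P δ D h s).2 fun a => (gapQ_mem hH _ h s a).1,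
      mean_le (optimisticPolicy P δ D h s).2 fun a => (gapQ_mem hH _ h s a).2⟩

theorem upperQ_mem (hH : 1 ≤ H) (V W : S → ℝ) (h : Fin H) (s : S) (a : A) :
    upperQ P δ D V W h s a ∈ Set.Icc 0 (H * P.Rmax) := by
  have : 0 ≤ H * P.Rmax := mul_nonneg (by positivity) (P.Rmax_nonneg hH)
  unfold upperQ
  split_ifs
  · exact ⟨this, le_rfl⟩
  · exact clip_mem this

theorem lowerQ_mem (hH : 1 ≤ H) (V W : S → ℝ) (h : Fin H) (s : S) (a : A) :
    lowerQ P δ D V W h s a ∈ Set.Icc 0 (H * P.Rmax) := by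
  have : 0 ≤ H * P.Rmax := mul_nonneg (by positivity) (P.Rmax_nonneg hH)
  unfold lowerQ
  split_ifs
  · exact ⟨le_rfl, this⟩
  · exact clip_mem this

/-- Concentration is available only for the deterministic function `optV`, and with its unknown
variance under p. The transfer replaces that variance by the empirical one of an upper bound `V`,
which is what the algorithm computes. -/
theorem Confident.abs_sub_le (hD : Confident P p δ D) (hH : 1 ≤ H) (hδ : δ ∈ Set.Ioo (0 : ℝ) 1)
    {V : S → ℝ} (h : Fin H) (hV : ∀ s, V s - P.optV p h.succ s ∈ Set.Icc 0 (H * P.Rmax))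
    (s : S) (a : A) (hn : visits D h s a ≠ 0) :
    |mean (empirical D h s a) (P.optV p h.succ) - mean (p h s a) (P.optV p h.succ)| ≤
      bonusBern P δ D V h s a +
        1 / H * mean (empirical D h s a) (fun x => V x - P.optV p h.succ x) := by
  have : Nonempty S := ⟨s⟩
  have hn0 : (0 : ℝ) < visits D h s a := by exact_mod_cast Nat.pos_of_ne_zero hn
  refine (hD.conc h s a hn).trans ?_
  have := bernstein_transfer (H := H) (R := P.Rmax) (p h s a).2 (empirical_mem D h s a)
    (hD.kl h s a hn) (f := P.optV p h.succ) (g := V)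
    (c := betaConc S A H δ (visits D h s a) / visits D h s a)
    (div_nonneg (betaKL_pos hH hδ _).le hn0.le) (div_nonneg (betaConc_nonneg hH hδ hn) hn0.le)
    (by rw [← mul_div_assoc]; gcongr; exact betaConc_le hH hδ hn)
    (by exact_mod_cast hH) (P.Rmax_nonneg hH)
    (fun x => ⟨P.optV_nonneg p _ x, P.optV_le_mul hH p _ x⟩) hV
  refine this.trans_eq ?_
  unfold bonusBern
  ring

theorem Confident.kap_ent (hD : Confident P p δ D) {h : Fin H} {s : S} {a : A}
    (hn : visits D h s a ≠ 0) :
    |P.kap * entropy (empirical D h s a) - P.kap * entropy (p h s a)| ≤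
      P.kap * bonusEnt δ D h s a := by
  rw [← mul_sub, abs_mul, abs_of_nonneg P.kap_nonneg]
  exact mul_le_mul_of_nonneg_left (hD.ent h s a hn) P.kap_nonneg

theorem Confident.bellmanQ_le_upperQ (hD : Confident P p δ D) (hH : 1 ≤ H)
    (hδ : δ ∈ Set.Ioo (0 : ℝ) 1) {V W : S → ℝ} (h : Fin H)
    (hV : ∀ s, V s - P.optV p h.succ s ∈ Set.Icc 0 (H * P.Rmax))
    (hW : ∀ s, W s ≤ P.optV p h.succ s) (s : S) (a : A) :
    P.bellmanQ p (P.optV p h.succ) h s a ≤ upperQ P δ D V W h s a := by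
  have hle := P.bellmanQ_optV_le hH p h s a
  unfold upperQ
  split_ifs with hn
  · exact hle
  refine le_clip ?_ hle
  have h1 := (abs_le.1 (hD.abs_sub_le hH hδ h hV s a hn)).1
  have h2 := (abs_le.1 (hD.kap_ent hn)).1
  have hq := (empirical_mem D h s a).1
  have h3 : mean (empirical D h s a) (fun x => V x - P.optV p h.succ x) ≤
      mean (empirical D h s a) (fun x => V x - W x) := mean_mono hq fun x => by linarith [hW x]
  have h4 : mean (empirical D h s a) (P.optV p h.succ) ≤ mean (empirical D h s a) V :=
    mean_mono hq fun x => by linarith [(hV x).1]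
  have h5 := mul_le_mul_of_nonneg_left h3 (by positivity : 0 ≤ 1 / (H : ℝ))
  simp only [Problem.bellmanQ, Problem.augReward, empiricalReward, bonusTrans]
  linarith

theorem Confident.lowerQ_le_bellmanQ (hD : Confident P p δ D) (hH : 1 ≤ H)
    (hδ : δ ∈ Set.Ioo (0 : ℝ) 1) {V W : S → ℝ} (h : Fin H)
    (hV : ∀ s, V s - P.optV p h.succ s ∈ Set.Icc 0 (H * P.Rmax))
    (hW : ∀ s, W s ≤ P.optV p h.succ s) (s : S) (a : A) :
    lowerQ P δ D V W h s a ≤ P.bellmanQ p (P.optV p h.succ) h s a := by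
  have hle := P.bellmanQ_optV_nonneg p h s a
  unfold lowerQ
  split_ifs with hn
  · exact hle
  refine clip_le ?_ hle
  have h1 := (abs_le.1 (hD.abs_sub_le hH hδ h hV s a hn)).2
  have h2 := (abs_le.1 (hD.kap_ent hn)).2
  have hq := (empirical_mem D h s a).1
  have h3 : mean (empirical D h s a) (fun x => V x - P.optV p h.succ x) ≤
      mean (empirical D h s a) (fun x => V x - W x) := mean_mono hq fun x => by linarith [hW x]
  have h4 : mean (empirical D h s a) W ≤ mean (empirical D h s a) (P.optV p h.succ) :=
    mean_mono hq hW
  have h5 := mul_le_mul_of_nonneg_left h3 (by positivity : 0 ≤ 1 / (H : ℝ))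
  simp only [Problem.bellmanQ, Problem.augReward, empiricalReward, bonusTrans]
  linarith

/-- The two bounds must be proved together, since the correction bonus involves upper minus lower
bound at the next step. The upper value may exceed `H * Rmax` because the conjugate adds -λΦ, so
what is controlled is its distance to `optV`: the regularizer cancels there and only the clipped
Q-functions remain. -/
theorem Confident.optimism (hD : Confident P p δ D) (hH : 1 ≤ H) (hδ : δ ∈ Set.Ioo (0 : ℝ) 1)
    (h : Fin (H + 1)) : (∀ s, upperV P δ D h s - P.optV p h s ∈ Set.Icc 0 (H * P.Rmax)) ∧
      ∀ s, lowerV P δ D h s ≤ P.optV p h s := by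
  induction h using Fin.reverseInduction with
  | last =>
    have : 0 ≤ H * P.Rmax := mul_nonneg (by positivity) (P.Rmax_nonneg hH)
    simp [upperV_last, lowerV_last, P.optV_last, this]
  | cast h ih =>
    constructor
    · intro s
      rw [upperV_castSucc, P.optV_castSucc]
      refine ⟨sub_nonneg.2 (P.conjugate_mono (hD.bellmanQ_le_upperQ hH hδ h ih.1 ih.2 s)),
        P.conjugate_sub_le fun a => ?_⟩
      linarith [(upperQ_mem (P := P) (δ := δ) (D := D) hH (upperV P δ D h.succ)
        (lowerV P δ D h.succ) h s a).2, P.bellmanQ_optV_nonneg p h s a]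
    · intro s
      rw [lowerV_castSucc, P.optV_castSucc]
      exact P.conjugate_mono (hD.lowerQ_le_bellmanQ hH hδ h ih.1 ih.2 s)

theorem bonusBern_nonneg (hH : 1 ≤ H) (hδ : δ ∈ Set.Ioo (0 : ℝ) 1) (V : S → ℝ) (h : Fin H)
    (s : S) (a : A) : 0 ≤ bonusBern P δ D V h s a := by
  have : Nonempty S := ⟨s⟩
  have := P.Rmax_nonneg hH
  have := betaKL_pos (S := S) (A := A) hH hδ (visits D h s a)
  unfold bonusBern
  positivity

theorem bonusEnt_nonneg (hH : 1 ≤ H) (hδ : δ ∈ Set.Ioo (0 : ℝ) 1) (h : Fin H)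
    (s : S) (a : A) : 0 ≤ bonusEnt δ D h s a := by
  have : Nonempty S := ⟨s⟩
  have := betaKL_pos (S := S) (A := A) hH hδ (visits D h s a)
  have h1 : 0 ≤ Real.log (Fintype.card S) := Real.log_natCast_nonneg _
  unfold bonusEnt
  positivity

/-- In the first bound the greedy policy for the upper Q-function is merely a competitor for the
lower one, in the second it is the policy evaluated; either way the regularizers cancel and
Q-functions are compared under `π`. The first comparison produces p̂ W with a factor 1 + 2/H, since
the correction bonus enters twice. In the second, one 1/H comes from the correction bonus, one from
the transfer of Bernstein's inequality, and one from moving V* - V^π from p to p̂ by the KL bound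
with θ = 1/H; this is the factor 1 + 3/H in the gap. Unvisited pairs are covered by the default `H *
Rmax`. -/
theorem Confident.gap (hD : Confident P p δ D) (hH : 1 ≤ H) (hδ : δ ∈ Set.Ioo (0 : ℝ) 1)
    (h : Fin (H + 1)) : (∀ s, upperV P δ D h s - lowerV P δ D h s ≤ gapV P δ D h s) ∧
      ∀ s, upperV P δ D h s - P.polV p (optimisticPolicy P δ D) h s ≤ gapV P δ D h s := by
  have hH' : (1 : ℝ) ≤ H := by exact_mod_cast hH
  have hR := P.Rmax_nonneg hH
  have hHR : 0 ≤ H * P.Rmax := mul_nonneg (by positivity) hR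
  induction h using Fin.reverseInduction with
  | last => simp [upperV_last, lowerV_last, P.polV_last, gapV_last]
  | cast h ih =>
    set π := optimisticPolicy P δ D with hπ
    have hW0 : ∀ s, gapV P δ D h.succ s ∈ Set.Icc 0 (H * P.Rmax) := gapV_mem hH _
    have hopt := hD.optimism hH hδ h.succ
    have hup : ∀ s, upperV P δ D h.castSucc s = mean (π h s)
        (upperQ P δ D (upperV P δ D h.succ) (lowerV P δ D h.succ) h s) -
        P.lam * P.Φ (π h s) := fun s => by
      rw [upperV_castSucc, P.conjugate_eq]; rfl
    constructor
    · intro s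
      have h1 := P.le_conjugate (lowerQ P δ D (upperV P δ D h.succ) (lowerV P δ D h.succ) h s)
        (π h s)
      rw [← lowerV_castSucc] at h1
      rw [hup, gapV_castSucc]
      have key : mean (π h s) (fun a =>
          upperQ P δ D (upperV P δ D h.succ) (lowerV P δ D h.succ) h s a -
          lowerQ P δ D (upperV P δ D h.succ) (lowerV P δ D h.succ) h s a) ≤
          mean (π h s) (gapQ P δ D (gapV P δ D h.succ) h s) := by
        refine mean_mono (π h s).2.1 fun a => ?_
        have m1 := upperQ_mem (P := P) (δ := δ) (D := D) hH (upperV P δ D h.succ)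
          (lowerV P δ D h.succ) h s a
        have m2 := lowerQ_mem (P := P) (δ := δ) (D := D) hH (upperV P δ D h.succ)
          (lowerV P δ D h.succ) h s a
        unfold gapQ
        split_ifs with hn
        · linarith [m1.2, m2.1]
        refine le_clip ?_ (by linarith [m1.2, m2.1])
        unfold upperQ lowerQ
        rw [if_neg hn, if_neg hn]
        have : Nonempty S := ⟨s⟩
        have hb := bonusBern_nonneg (P := P) (D := D) hH hδ (upperV P δ D h.succ) h s a
        have he := mul_nonneg P.kap_nonneg (bonusEnt_nonneg (D := D) hH hδ h s a)
        have hk : 0 ≤ 4 * (H : ℝ) ^ 2 * P.Rmax * betaKL S A H δ (visits D h s a) /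
            (visits D h s a : ℝ) := by
          have := betaKL_pos (S := S) (A := A) hH hδ (visits D h s a)
          positivity
        have hq := (empirical_mem D h s a).1
        have hm : mean (empirical D h s a) (fun x => upperV P δ D h.succ x - lowerV P δ D h.succ x)
            ≤ mean (empirical D h s a) (gapV P δ D h.succ) := mean_mono hq ih.1
        have hW := mean_nonneg hq fun x => (hW0 x).1
        have hm' := mul_le_mul_of_nonneg_left hm (by positivity : 0 ≤ 1 / (H : ℝ))
        have hW' := mul_nonneg (by positivity : 0 ≤ 1 / (H : ℝ)) hW
        have e : (1 + 3 / (H : ℝ)) * mean (empirical D h s a) (gapV P δ D h.succ) =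
          mean (empirical D h s a) (gapV P δ D h.succ) +
          3 * (1 / H * mean (empirical D h s a) (gapV P δ D h.succ)) := by ring
        have hsub := mean_sub (empirical D h s a) (upperV P δ D h.succ) (lowerV P δ D h.succ)
        change _ ≤ 2 * bonusBern P δ D (upperV P δ D h.succ) h s a + _ + _ + _
        refine clip_sub_clip_le ?_ hHR (by rw [e]; linarith)
        rw [e]
        simp only [bonusTrans]
        linarith
      rw [mean_sub] at key
      change mean (π h s) (upperQ P δ D (upperV P δ D h.succ) (lowerV P δ D h.succ) h s) -
        mean (π h s) (lowerQ P δ D (upperV P δ D h.succ) (lowerV P δ D h.succ) h s) ≤ _ at key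
      linarith
    · intro s
      rw [hup, gapV_castSucc, P.polV_castSucc]
      have key : mean (π h s) (fun a =>
          upperQ P δ D (upperV P δ D h.succ) (lowerV P δ D h.succ) h s a -
          P.bellmanQ p (P.polV p π h.succ) h s a) ≤
          mean (π h s) (gapQ P δ D (gapV P δ D h.succ) h s) := by
        refine mean_mono (π h s).2.1 fun a => ?_
        have m1 := upperQ_mem (P := P) (δ := δ) (D := D) hH (upperV P δ D h.succ)
          (lowerV P δ D h.succ) h s a
        have m2 := P.bellmanQ_polV_nonneg p π h s a
        unfold gapQ
        split_ifs with hn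
        · linarith [m1.2]
        refine le_clip ?_ (by linarith [m1.2])
        unfold upperQ
        rw [if_neg hn]
        have : Nonempty S := ⟨s⟩
        have hn0 : (0 : ℝ) < visits D h s a := by exact_mod_cast Nat.pos_of_ne_zero hn
        set V := upperV P δ D h.succ
        set Vl := lowerV P δ D h.succ
        set Vs := P.optV p h.succ
        set Vp := P.polV p π h.succ
        set W := gapV P δ D h.succ
        set q := empirical D h s a
        have hq := empirical_mem D h s a
        have hb := bonusBern_nonneg (P := P) (D := D) hH hδ V h s a
        have he := mul_nonneg P.kap_nonneg (bonusEnt_nonneg (D := D) hH hδ h s a)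
        have hβ := betaKL_pos (S := S) (A := A) hH hδ (visits D h s a)
        set k := betaKL S A H δ (visits D h s a) / (visits D h s a : ℝ) with hk
        have hk0 : 0 ≤ k := by positivity
        have hVp : ∀ x, Vs x - Vp x ∈ Set.Icc 0 (H * P.Rmax) := fun x =>
          ⟨sub_nonneg.2 (P.polV_le_optV p π _ x), by
            linarith [P.optV_le_mul hH p h.succ x, P.polV_nonneg p π h.succ x]⟩
        have h1 : mean q Vs - mean (p h s a) Vs ≤
            bonusBern P δ D V h s a + 1 / H * mean q (fun x => V x - Vs x) :=
          (abs_le.1 (hD.abs_sub_le hH hδ h hopt.1 s a hn)).2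
        have h2 : P.kap * entropy q - P.kap * entropy (p h s a) ≤ P.kap * bonusEnt δ D h s a :=
          (abs_le.1 (hD.kap_ent hn)).2
        -- The function V* - V^π depends on the data through the policy, so the Bernstein bound is
        -- of no use here; the KL bound holds for all functions at once.
        have h3 : mean (p h s a) (fun x => Vs x - Vp x) ≤ (1 + 1 / H) *
            (mean q (fun x => Vs x - Vp x) + H * P.Rmax * k / (1 / (H : ℝ))) := (hD.kl h s a hn).le_mean (θ := 1 / H) (p h s a).2 hq
          (fun x => (hVp x).1) (fun x => (hVp x).2) hHR (by positivity)
          (by rw [div_le_one (by linarith)]; exact hH')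
        have e1 : H * P.Rmax * k / (1 / (H : ℝ)) = H ^ 2 * P.Rmax * k := by field_simp
        have hθ : 1 / (H : ℝ) ≤ 1 := by rw [div_le_one (by linarith)]; exact hH'
        have hX : 0 ≤ H ^ 2 * P.Rmax * k := by positivity
        have hM0 : 0 ≤ mean q (fun x => Vs x - Vp x) := mean_nonneg hq.1 fun x => (hVp x).1
        rw [e1] at h3
        have h4 : mean (p h s a) (fun x => Vs x - Vp x) ≤ mean q (fun x => Vs x - Vp x) +
            1 / H * mean q (fun x => Vs x - Vp x) + 2 * (H ^ 2 * P.Rmax * k) := by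
          have := mul_le_mul_of_nonneg_right hθ hX
          linarith
        have hWV : mean q (fun x => V x - Vl x) ≤ mean q W := mean_mono hq.1 ih.1
        have hWP : mean q (fun x => V x - Vp x) ≤ mean q W := mean_mono hq.1 ih.2
        have hWS : mean q (fun x => V x - Vs x) ≤ mean q W := mean_mono hq.1 fun x => by
          linarith [ih.2 x, (hVp x).1]
        have hWD : mean q (fun x => Vs x - Vp x) ≤ mean q W := mean_mono hq.1 fun x => by
          linarith [ih.2 x, (hopt.1 x).1]
        have hW := mean_nonneg hq.1 fun x => (hW0 x).1
        have i0 : 0 ≤ 1 / (H : ℝ) := by positivity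
        have j1 := mul_le_mul_of_nonneg_left hWV i0
        have j2 := mul_le_mul_of_nonneg_left hWS i0
        have j3 := mul_le_mul_of_nonneg_left hWD i0
        have j4 := mul_nonneg i0 hW
        rw [mean_sub q V Vp] at hWP
        rw [mean_sub (p h s a) Vs Vp, mean_sub q Vs Vp] at h4
        rw [mean_sub q Vs Vp] at j3
        have e : (1 + 3 / (H : ℝ)) * mean q W = mean q W + 3 * (1 / H * mean q W) := by ring
        have e2 : 4 * (H : ℝ) ^ 2 * P.Rmax * betaKL S A H δ (visits D h s a) /
            (visits D h s a : ℝ) = 4 * (H ^ 2 * P.Rmax * k) := by rw [hk]; ring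
        change _ ≤ 2 * bonusBern P δ D V h s a + _ + _ + _
        rw [e, e2]
        have hc : clip (empiricalReward P D h s a + mean q V + bonusTrans P δ D V Vl h s a +
            P.kap * bonusEnt δ D h s a) 0 (H * P.Rmax) ≤
            max (empiricalReward P D h s a + mean q V + bonusTrans P δ D V Vl h s a +
            P.kap * bonusEnt δ D h s a) 0 := max_le_max (min_le_left _ _) le_rfl
        rw [sub_le_iff_le_add]
        refine hc.trans (max_le ?_ (by linarith))
        simp only [Problem.bellmanQ, Problem.augReward, empiricalReward, bonusTrans]
        linarith
      rw [mean_sub] at key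
      change mean (π h s) (upperQ P δ D (upperV P δ D h.succ) (lowerV P δ D h.succ) h s) -
        mean (π h s) (P.bellmanQ p (P.polV p π h.succ) h s) ≤ _ at key
      linarith

end GoodEvent

/-! ### Expectations along an episode -/

section Episodes

variable {S A : Type*} [Fintype S] [Fintype A] {H : ℕ}

theorem episodeProb_mem (s₁ : S) (p : Transitions S A H) (π : Policy S A H) :
    episodeProb s₁ p π ∈ stdSimplex ℝ (Episode S A H) :=
  ⟨episodeProb_nonneg s₁ p π, sum_episodeProb s₁ p π⟩

open Classical in
/-- Expectation over the states and actions of an episode. -/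
def pathMean (s₁ : S) (n : ℕ) (p : Transitions S A n) (π : Policy S A n)
    (G : (Fin (n + 1) → S) → (Fin n → A) → ℝ) : ℝ :=
  ∑ st : Fin (n + 1) → S, ∑ ac : Fin n → A, ((if st 0 = s₁ then (1 : ℝ) else 0) *
    ∏ h, π h (st h.castSucc) (ac h) * p h (st h.castSucc) (ac h) (st h.succ)) * G st ac

theorem mean_episodeProb (s₁ : S) (p : Transitions S A H) (π : Policy S A H)
    (G : (Fin (H + 1) → S) → (Fin H → A) → ℝ) :
    mean (episodeProb s₁ p π) (fun e => G e.1 e.2) = pathMean s₁ H p π G := by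
  classical
  unfold pathMean mean
  rw [← Fintype.sum_prod_type']
  rfl

theorem pathMean_succ (s₁ : S) (n : ℕ) (p : Transitions S A (n + 1)) (π : Policy S A (n + 1))
    (G : (Fin (n + 2) → S) → (Fin (n + 1) → A) → ℝ) :
    pathMean s₁ (n + 1) p π G =
      pathMean s₁ n (fun h => p h.castSucc) (fun h => π h.castSucc) fun st ac =>
        mean (π (Fin.last n) (st (Fin.last n))) fun a =>
          mean (p (Fin.last n) (st (Fin.last n)) a) fun x => G (Fin.snoc st x) (Fin.snoc ac a) := by
  classical
  unfold pathMean
  rw [← (Fin.snocEquiv fun _ => S).sum_comp, Fintype.sum_prod_type_right]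
  refine Finset.sum_congr rfl fun st _ => ?_
  rw [Finset.sum_comm, ← (Fin.snocEquiv fun _ => A).sum_comp, Fintype.sum_prod_type_right]
  refine Finset.sum_congr rfl fun ac _ => ?_
  have h0 : ∀ s' : S, (Fin.snoc st s' : Fin (n + 2) → S) 0 = st 0 := fun s' =>
    Fin.snoc_castSucc (α := fun _ => S) s' st 0
  simp only [Fin.snocEquiv, Equiv.coe_fn_mk, Fin.prod_univ_castSucc, Fin.snoc_castSucc,
    Fin.snoc_last, Fin.succ_castSucc, Fin.succ_last, h0, mean]
  rw [Finset.mul_sum]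
  refine Finset.sum_congr rfl fun a _ => ?_
  rw [Finset.mul_sum, Finset.mul_sum]
  exact Finset.sum_congr rfl fun s' _ => by ring

/-- The Markov property. Steps after h are peeled off from the end and integrate to one; when h is
the last step, the peeled factor is precisely the conditional mean. -/
theorem pathMean_step (s₁ : S) (n : ℕ) (p : Transitions S A n) (π : Policy S A n) (h : Fin n)
    (F : S → A → S → ℝ) :
    pathMean s₁ n p π (fun st ac => F (st h.castSucc) (ac h) (st h.succ)) =
      pathMean s₁ n p π fun st _ => mean (π h (st h.castSucc)) fun a =>
        mean (p h (st h.castSucc) a) (F (st h.castSucc) a) := by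
  induction n with
  | zero => exact h.elim0
  | succ n ih =>
    rw [pathMean_succ, pathMean_succ]
    induction h using Fin.lastCases with
    | last =>
      simp only [Fin.snoc_castSucc, Fin.snoc_last, Fin.succ_last]
      congr 1; funext st ac
      simp only [mean_const_apply]
    | cast h =>
      simp only [Fin.snoc_castSucc, Fin.succ_castSucc]
      refine Eq.trans ?_ ((ih (fun h => p h.castSucc) (fun h => π h.castSucc) h).trans ?_)
      · congr 1; funext st ac
        simp only [mean_const_apply]
      · congr 1; funext st ac
        simp only [mean_const_apply]

theorem pathMean_start (s₁ : S) (p : Transitions S A H) (π : Policy S A H) (g : S → ℝ) :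
    pathMean s₁ H p π (fun st _ => g (st 0)) = g s₁ := by
  classical
  have : pathMean s₁ H p π (fun st _ => g (st 0)) = pathMean s₁ H p π (fun _ _ => g s₁) := by
    unfold pathMean
    refine Finset.sum_congr rfl fun st _ => Finset.sum_congr rfl fun ac _ => ?_
    by_cases h : st 0 = s₁ <;> simp [h]
  rw [this, ← mean_episodeProb]
  exact mean_const (episodeProb_mem s₁ p π) _

/-- The expected sum of `f_h(s_h, a_h)` over the steps `h, …, H` of an episode. -/
def evalV (p : Transitions S A H) (π : Policy S A H) (f : Fin H → S → A → ℝ) :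
    Fin (H + 1) → S → ℝ :=
  backward (fun h W s => mean (π h s) fun a => f h s a + mean (p h s a) W) fun _ => 0

theorem evalV_last (p : Transitions S A H) (π : Policy S A H) (f : Fin H → S → A → ℝ) (s : S) :
    evalV p π f (Fin.last H) s = 0 := by
  rw [evalV, backward_last]

theorem evalV_castSucc (p : Transitions S A H) (π : Policy S A H) (f : Fin H → S → A → ℝ)
    (h : Fin H) (s : S) : evalV p π f h.castSucc s =
      mean (π h s) fun a => f h s a + mean (p h s a) (evalV p π f h.succ) := by
  rw [evalV, backward_castSucc]

/-- By the Bellman equation the mean of f_h(s_h, a_h) equals the mean of W_h(s_h) minus that of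
W_{h+1}(s_{h+1}), where W = `evalV`; the sum over h telescopes. -/
theorem mean_episodeProb_sum (s₁ : S) (p : Transitions S A H) (π : Policy S A H)
    (f : Fin H → S → A → ℝ) :
    mean (episodeProb s₁ p π) (fun e => ∑ h, f h (e.state h) (e.action h)) =
      evalV p π f 0 s₁ := by
  set μ := episodeProb s₁ p π with hμ
  have hstep : ∀ h : Fin H, mean μ (fun e => f h (e.state h) (e.action h)) =
      mean μ (fun e => evalV p π f h.castSucc (e.1 h.castSucc)) -
        mean μ (fun e => evalV p π f h.succ (e.1 h.succ)) := by
    intro h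
    rw [eq_sub_iff_add_eq, ← mean_add]
    have := pathMean_step s₁ H p π h fun s a x => f h s a + evalV p π f h.succ x
    rw [← mean_episodeProb, ← mean_episodeProb] at this
    refine this.trans ?_
    congr 1; funext e
    rw [evalV_castSucc]
    congr 1; funext a
    rw [mean_add _ (fun _ => _), mean_const_apply]
  have hsum : mean μ (fun e => ∑ h, f h (e.state h) (e.action h)) =
      ∑ h, mean μ (fun e => f h (e.state h) (e.action h)) := by
    simp only [mean, Finset.mul_sum]
    exact Finset.sum_comm
  rw [hsum, Finset.sum_congr rfl fun h _ => hstep h]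
  set g : Fin (H + 1) → ℝ := fun h => mean μ fun e => evalV p π f h (e.1 h) with hg
  have h1 := Fin.sum_univ_castSucc g
  have h2 := Fin.sum_univ_succ g
  have h3 : g (Fin.last H) = 0 := by simp [hg, mean, evalV_last]
  have h4 : g 0 = evalV p π f 0 s₁ := by
    rw [← pathMean_start s₁ p π (evalV p π f 0), ← mean_episodeProb]
  rw [Finset.sum_sub_distrib]
  change ∑ h : Fin H, g h.castSucc - ∑ h : Fin H, g h.succ = _
  linarith

open Classical in
/-- The probability that `(s, a)` is visited at step `h`. -/
def occupancy (s₁ : S) (p : Transitions S A H) (π : Policy S A H) (h : Fin H) (s : S) (a : A) :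
    ℝ :=
  mean (episodeProb s₁ p π) fun e => if e.state h = s ∧ e.action h = a then 1 else 0

theorem occupancy_nonneg (s₁ : S) (p : Transitions S A H) (π : Policy S A H) (h : Fin H) (s : S)
    (a : A) : 0 ≤ occupancy s₁ p π h s a :=
  mean_nonneg (episodeProb_nonneg s₁ p π) fun e => by split_ifs <;> norm_num

theorem occupancy_le_one (s₁ : S) (p : Transitions S A H) (π : Policy S A H) (h : Fin H) (s : S)
    (a : A) : occupancy s₁ p π h s a ≤ 1 :=
  mean_le (episodeProb_mem s₁ p π) fun e => by split_ifs <;> norm_num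

theorem sum_occupancy_mul (s₁ : S) (p : Transitions S A H) (π : Policy S A H)
    (f : Fin H → S → A → ℝ) :
    ∑ h, ∑ s, ∑ a, occupancy s₁ p π h s a * f h s a = evalV p π f 0 s₁ := by
  classical
  rw [← mean_episodeProb_sum]
  simp only [occupancy, mean, Finset.sum_mul, Finset.mul_sum]
  have h1 : ∀ h s, ∑ a, ∑ e : Episode S A H, episodeProb s₁ p π e *
      (if e.state h = s ∧ e.action h = a then 1 else 0) * f h s a =
      ∑ e : Episode S A H, ∑ a, episodeProb s₁ p π e *
      (if e.state h = s ∧ e.action h = a then 1 else 0) * f h s a := fun h s => Finset.sum_comm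
  have h2 : ∀ h, ∑ s, ∑ e : Episode S A H, ∑ a, episodeProb s₁ p π e *
      (if e.state h = s ∧ e.action h = a then 1 else 0) * f h s a =
      ∑ e : Episode S A H, ∑ s, ∑ a, episodeProb s₁ p π e *
      (if e.state h = s ∧ e.action h = a then 1 else 0) * f h s a := fun h => Finset.sum_comm
  simp only [h1, h2]
  rw [Finset.sum_comm]
  refine Finset.sum_congr rfl fun e _ => Finset.sum_congr rfl fun h _ => ?_
  rw [Finset.sum_eq_single (e.state h), Finset.sum_eq_single (e.action h)]
  · simp
  · intro a _ ha; simp [ha.symm]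
  · simp
  · intro s _ hs; exact Finset.sum_eq_zero fun a _ => by simp [hs.symm]
  · simp

open Classical in
-- Given a visit to (s, a), the next state has law p_h(s, a); this feeds the supermartingales of the
-- counts.
theorem mean_visit (s₁ : S) (p : Transitions S A H) (π : Policy S A H) (h : Fin H) (s : S)
    (a : A) (g : S → ℝ) :
    mean (episodeProb s₁ p π)
        (fun e => if e.state h = s ∧ e.action h = a then g (e.next h) else 0) =
      occupancy s₁ p π h s a * mean (p h s a) g := by
  classical
  have h1 := pathMean_step s₁ H p π h fun s' a' x => if s' = s ∧ a' = a then g x else 0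
  have h2 := pathMean_step s₁ H p π h fun s' a' _ =>
    if s' = s ∧ a' = a then mean (p h s a) g else 0
  rw [← mean_episodeProb, ← mean_episodeProb] at h1 h2
  have h3 : occupancy s₁ p π h s a * mean (p h s a) g = mean (episodeProb s₁ p π)
      fun e => if e.state h = s ∧ e.action h = a then mean (p h s a) g else 0 := by
    rw [occupancy, mul_comm, ← mean_const_mul]
    congr 1; funext e; simp
  rw [h3]
  refine Eq.trans ?_ ((h1.trans ?_).trans h2.symm)
  · congr 1
  congr 1; funext e; congr 1; funext a'
  by_cases hs : e.1 h.castSucc = s ∧ a' = a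
  · obtain ⟨hs, ha⟩ := hs
    subst ha
    simp only [hs, and_self, if_true]
    exact (mean_const_apply _ _).symm
  · simp only [hs, if_false, mean_const_apply]

end Episodes

/-! ### Values as solutions of the Bellman recursion -/

namespace Problem

variable {S A : Type*} [Fintype S] [Fintype A] [Nonempty A] {H : ℕ} (P : Problem S A H)

/-- The regularizer does not depend on the action drawn, so it may be counted as part of the reward.
-/
theorem polV_eq_evalV (p : Transitions S A H) (π : Policy S A H) : P.polV p π =
    evalV p π fun h s a => P.augReward p h s a - P.lam * P.Φ (π h s) := by
  funext h
  induction h using Fin.reverseInduction with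
  | last => funext s; rw [polV_last, evalV_last]
  | cast h ih =>
    funext s
    rw [polV_castSucc, evalV_castSucc, ih, sub_eq_add_neg, ← mean_add_const_apply]
    congr 1; funext a
    simp only [bellmanQ]
    ring

theorem value_eq (p : Transitions S A H) (π : Policy S A H) :
    P.value p π = P.polV p π 0 P.start := by
  rw [polV_eq_evalV, ← mean_episodeProb_sum]
  rfl

theorem optValue_le (p : Transitions S A H) : P.optValue p ≤ P.optV p 0 P.start :=
  haveI : Nonempty (Policy S A H) := ⟨fun _ _ => Classical.arbitrary _⟩
  ciSup_le fun π => (P.value_eq p π).trans_le (P.polV_le_optV p π 0 P.start)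

end Problem

/-- On the confidence event, the gap bounds the suboptimality of the optimistic policy. -/
theorem Confident.optValue_sub_value_le {S A : Type*} [Fintype S] [Fintype A] [Nonempty A]
    {H t : ℕ} {P : Problem S A H} {p : Transitions S A H} {δ : ℝ} {D : Data S A H t}
    (hD : Confident P p δ D) (hH : 1 ≤ H) (hδ : δ ∈ Set.Ioo (0 : ℝ) 1) :
    P.optValue p - P.value p (optimisticPolicy P δ D) ≤ gapV P δ D 0 P.start := by
  rw [P.value_eq]
  linarith [P.optValue_le p, ((hD.optimism hH hδ 0).1 P.start).1, (hD.gap hH hδ 0).2 P.start]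

/-! ### The law of the learning process and Ville's inequality -/

section Law

variable {S A : Type*} [Fintype S] [Fintype A] {H : ℕ}

theorem lintegral_episodeLaw (s₁ : S) (p : Transitions S A H) (π : Policy S A H)
    (F : Episode S A H → ENNReal) :
    ∫⁻ e, F e ∂(episodeLaw s₁ p π) = ∑ e, ENNReal.ofReal (episodeProb s₁ p π e) * F e := by
  rw [lintegral_fintype]
  refine Finset.sum_congr rfl fun e _ => ?_
  rw [mul_comm, episodeLaw, PMF.toMeasure_apply_singleton _ _ (MeasurableSet.of_discrete)]
  rfl

variable (alg : Algorithm S A H) (s₁ : S) (p : Transitions S A H)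

instance : IsProbabilityMeasure (alg.law s₁ p) := by
  unfold Algorithm.law; infer_instance

theorem map_eval_zero_law : (alg.law s₁ p).map (fun ω => ω 0) =
    episodeLaw s₁ p (alg.policy (t := 0) Fin.elim0) := by
  have h1 : (alg.law s₁ p).map (Preorder.frestrictLe 0) =
      (episodeLaw s₁ p (alg.policy (t := 0) Fin.elim0)).map
        (MeasurableEquiv.piUnique (fun i : Finset.Iic 0 => Episode S A H)).symm := by
    unfold Algorithm.law Kernel.trajMeasure
    rw [Measure.map_comp _ _ (by fun_prop), Kernel.traj_map_frestrictLe, Kernel.partialTraj_self,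
      Measure.id_comp]
  have h2 : (fun ω : ℕ → Episode S A H => ω 0) =
      (fun x : (i : Finset.Iic 0) → Episode S A H => x ⟨0, by simp⟩) ∘ Preorder.frestrictLe 0 := rfl
  rw [h2, ← Measure.map_map (by fun_prop) (by fun_prop), h1,
    Measure.map_map (by fun_prop) (by fun_prop)]
  exact Measure.map_id

/-- The conditional law of the next episode given the data, the form in which the trajectory measure
is used by the supermartingale arguments. The first episode is separate because it comes from the
initial measure and not from a kernel. -/
theorem lintegral_law_succ (t : ℕ) (F : Data S A H (t + 1) → ENNReal) :
    ∫⁻ ω, F (Algorithm.firstEpisodes ω (t + 1)) ∂(alg.law s₁ p) =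
      ∫⁻ ω, ∑ e, ENNReal.ofReal (episodeProb s₁ p
        (alg.policy (Algorithm.firstEpisodes ω t)) e) *
          F (Fin.snoc (Algorithm.firstEpisodes ω t) e) ∂(alg.law s₁ p) := by
  cases t with
  | zero =>
    have h0 : ∀ ω : ℕ → Episode S A H, Algorithm.firstEpisodes ω 0 = Fin.elim0 :=
      fun ω => funext fun i => i.elim0
    have h1 : ∀ ω : ℕ → Episode S A H, Algorithm.firstEpisodes ω 1 =
        Fin.snoc (Fin.elim0 : Data S A H 0) (ω 0) := fun ω => by
      funext i
      rw [Subsingleton.elim i (Fin.last 0), Fin.snoc_last]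
      rfl
    simp only [h0, h1]
    rw [lintegral_const, measure_univ, mul_one, ← lintegral_episodeLaw s₁ p _ fun e =>
      F (Fin.snoc (Fin.elim0 : Data S A H 0) e), ← map_eval_zero_law alg s₁ p,
      lintegral_map Measurable.of_discrete (by fun_prop)]
  | succ n =>
    let D : ((i : Finset.Iic n) → Episode S A H) → Data S A H (n + 1) :=
      fun x i => x ⟨i, Finset.mem_Iic.2 (Nat.lt_succ_iff.1 i.2)⟩
    have key := Kernel.map_frestrictLe_trajMeasure_compProd_eq_map_trajMeasure
      (X := fun _ => Episode S A H) (κ := alg.nextEpisode s₁ p)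
      (μ₀ := episodeLaw s₁ p (alg.policy (t := 0) Fin.elim0)) (a := n)
    have h1 : ∀ ω : ℕ → Episode S A H, Algorithm.firstEpisodes ω (n + 1 + 1) =
        Fin.snoc (D (Preorder.frestrictLe n ω)) (ω (n + 1)) := fun ω => by
      funext i
      induction i using Fin.lastCases with
      | last => rw [Fin.snoc_last]; rfl
      | cast i => rw [Fin.snoc_castSucc]; rfl
    have hF : Measurable fun x : ((i : Finset.Iic n) → Episode S A H) × Episode S A H =>
        F (Fin.snoc (D x.1) x.2) := measurable_of_countable _
    simp only [h1]
    have e1 : ∫⁻ ω, F (Fin.snoc (D (Preorder.frestrictLe n ω)) (ω (n + 1))) ∂(alg.law s₁ p) =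
        ∫⁻ x, F (Fin.snoc (D x.1) x.2) ∂((alg.law s₁ p).map
          fun ω => (Preorder.frestrictLe n ω, ω (n + 1))) := by
      rw [lintegral_map hF (by fun_prop)]
    rw [e1]
    have key' : (alg.law s₁ p).map (fun ω => (Preorder.frestrictLe n ω, ω (n + 1))) =
      (alg.law s₁ p).map (Preorder.frestrictLe n) ⊗ₘ alg.nextEpisode s₁ p n := key.symm
    rw [key', Measure.lintegral_compProd hF, lintegral_map (measurable_of_countable _)
      (by fun_prop)]
    refine lintegral_congr fun ω => ?_
    exact lintegral_episodeLaw s₁ p (alg.policy (D (Preorder.frestrictLe n ω))) _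

/-- Nonnegative supermartingales of the learning process, as functions of the data. -/
def IsSupermartingale (M : ∀ t, Data S A H t → ENNReal) : Prop :=
  ∀ t (D : Data S A H t), ∑ e, ENNReal.ofReal (episodeProb s₁ p (alg.policy D) e) *
    M (t + 1) (Fin.snoc D e) ≤ M t D

theorem sum_ofReal_episodeProb (π : Policy S A H) :
    ∑ e, ENNReal.ofReal (episodeProb s₁ p π e) = 1 := by
  rw [← ENNReal.ofReal_sum_of_nonneg fun e _ => episodeProb_nonneg s₁ p π e,
    sum_episodeProb, ENNReal.ofReal_one]

/-- The process `M` frozen once it has reached the level `c`. -/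
def frozen (M : ∀ t, Data S A H t → ENNReal) (c : ENNReal) : ∀ t, Data S A H t → ENNReal
  | 0, D => M 0 D
  | t + 1, D => open Classical in
      if c ≤ frozen M c t (Fin.init D) then frozen M c t (Fin.init D) else M (t + 1) D

theorem firstEpisodes_init (ω : ℕ → Episode S A H) (t : ℕ) :
    (Fin.init (Algorithm.firstEpisodes ω (t + 1)) : Data S A H t) =
      Algorithm.firstEpisodes ω t := rfl

theorem le_frozen {M : ∀ t, Data S A H t → ENNReal} {c : ENNReal} {ω : ℕ → Episode S A H} {t u : ℕ}
    (htu : t ≤ u) (h : c ≤ M t (Algorithm.firstEpisodes ω t)) :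
    c ≤ frozen M c u (Algorithm.firstEpisodes ω u) := by
  induction u, htu using Nat.le_induction with
  | base =>
    cases t with
    | zero => exact h
    | succ t =>
      rw [frozen]
      split_ifs with h1
      · exact h1
      · exact h
  | succ u _ ih =>
    rw [frozen, firstEpisodes_init, if_pos ih]
    exact ih

/-- Ville's inequality. -/
theorem IsSupermartingale.measure_le {M : ∀ t, Data S A H t → ENNReal}
    (hM : IsSupermartingale alg s₁ p M) (h0 : ∀ D, M 0 D ≤ 1) {c : ENNReal} (hc : c ≠ 0)
    (hc' : c ≠ ⊤) :
    alg.law s₁ p {ω | ∃ t, c ≤ M t (Algorithm.firstEpisodes ω t)} ≤ c⁻¹ := by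
  have hmeas : ∀ t (F : Data S A H t → ENNReal),
      Measurable fun ω : ℕ → Episode S A H => F (Algorithm.firstEpisodes ω t) := fun t F =>
    (measurable_of_countable F).comp (by unfold Algorithm.firstEpisodes; fun_prop)
  -- Freezing preserves the supermartingale property: either the value no longer moves, or the
  -- frozen process still coincides with `M`.
  have hint : ∀ t, ∫⁻ ω, frozen M c t (Algorithm.firstEpisodes ω t) ∂(alg.law s₁ p) ≤ 1 := by
    intro t
    induction t with
    | zero =>
      calc _ ≤ ∫⁻ ω, 1 ∂(alg.law s₁ p) := lintegral_mono fun ω => h0 _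
        _ = 1 := by simp
    | succ t ih =>
      rw [lintegral_law_succ]
      refine (lintegral_mono fun ω => ?_).trans ih
      simp only [frozen, Fin.init_snoc]
      split_ifs with h
      · rw [← Finset.sum_mul, sum_ofReal_episodeProb, one_mul]
      · refine (hM t _).trans ?_
        have hD : ∀ t (D : Data S A H t), ¬ c ≤ frozen M c t D → M t D ≤ frozen M c t D := by
          intro t D hD
          cases t with
          | zero => rw [frozen]
          | succ t =>
            by_cases h1 : c ≤ frozen M c t (Fin.init D)
            · rw [frozen, if_pos h1] at hD
              exact absurd h1 hD
            · rw [frozen, if_neg h1]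
        exact hD _ _ h
  have hsub : {ω | ∃ t, c ≤ M t (Algorithm.firstEpisodes ω t)} ⊆
      ⋃ t, {ω | c ≤ frozen M c t (Algorithm.firstEpisodes ω t)} := by
    rintro ω ⟨t, ht⟩
    exact Set.mem_iUnion.2 ⟨t, le_frozen le_rfl ht⟩
  refine (measure_mono hsub).trans ?_
  -- Once frozen above the level, the process stays there, so the events increase with t; Markov's
  -- inequality at each fixed t then bounds their union.
  have hmono : Monotone fun t => {ω : ℕ → Episode S A H |
      c ≤ frozen M c t (Algorithm.firstEpisodes ω t)} := by
    refine monotone_nat_of_le_succ fun t ω hω => ?_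
    change c ≤ frozen M c (t + 1) _
    rw [frozen, firstEpisodes_init, if_pos (show c ≤ _ from hω)]
    exact hω
  rw [hmono.measure_iUnion]
  refine iSup_le fun t => ?_
  refine (meas_ge_le_lintegral_div (hmeas t _).aemeasurable hc hc').trans ?_
  rw [← one_div]
  exact ENNReal.div_le_div_right (hint t) c

end Law

/-! ### Supermartingales of the transition counts and the KL confidence region -/

section Counts

variable {S A : Type*} [Fintype S] [Fintype A] {H : ℕ}

open Classical in
-- At step h an episode visits (s, a) at most once. A visit samples the next state from p_h(s, a),
-- and otherwise nothing changes. Values in `ENNReal` are needed since the likelihood ratio below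
-- may be infinite.
theorem sum_visit_le (s₁ : S) (p : Transitions S A H) (π : Policy S A H) (h : Fin H) (s : S)
    (a : A) {G : S → ENNReal} {G₀ : ENNReal}
    (hG : ∑ x, ENNReal.ofReal (p h s a x) * G x ≤ G₀) :
    ∑ e : Episode S A H, ENNReal.ofReal (episodeProb s₁ p π e) *
      (if e.state h = s ∧ e.action h = a then G (e.next h) else G₀) ≤ G₀ := by
  set w := fun e => ENNReal.ofReal (episodeProb s₁ p π e) with hw
  set o := occupancy s₁ p π h s a with ho
  have h0 : ∀ e, 0 ≤ episodeProb s₁ p π e := episodeProb_nonneg s₁ p π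
  have h1 : ∀ x, ∑ e : Episode S A H, w e *
      (if e.state h = s ∧ e.action h = a then (if e.next h = x then 1 else 0) else 0) =
      ENNReal.ofReal o * ENNReal.ofReal (p h s a x) := by
    intro x
    have := mean_visit s₁ p π h s a fun y => if y = x then 1 else 0
    have e2 : mean (p h s a) (fun y => if y = x then 1 else 0) = p h s a x := by simp [mean]
    rw [e2] at this
    rw [← ENNReal.ofReal_mul (occupancy_nonneg ..), ← this, mean,
      ENNReal.ofReal_sum_of_nonneg fun e _ => mul_nonneg (h0 e) (by split_ifs <;> norm_num)]
    refine Finset.sum_congr rfl fun e _ => ?_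
    split_ifs <;> simp [hw]
  have h2 : ∑ e : Episode S A H, w e *
      (if e.state h = s ∧ e.action h = a then 0 else 1) = ENNReal.ofReal (1 - o) := by
    have e2 : 1 - o = mean (episodeProb s₁ p π)
        (fun e => if e.state h = s ∧ e.action h = a then 0 else 1) := by
      rw [ho, occupancy, sub_eq_iff_eq_add, ← mean_add, eq_comm]
      convert mean_const (episodeProb_mem s₁ p π) 1 using 2
      funext e; split_ifs <;> norm_num
    rw [e2, mean, ENNReal.ofReal_sum_of_nonneg fun e _ => mul_nonneg (h0 e)
      (by split_ifs <;> norm_num)]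
    refine Finset.sum_congr rfl fun e _ => ?_
    split_ifs <;> simp [hw]
  have h3 : ∀ e : Episode S A H, w e *
      (if e.state h = s ∧ e.action h = a then G (e.next h) else G₀) =
      ∑ x, w e * (if e.state h = s ∧ e.action h = a then (if e.next h = x then 1 else 0) else 0)
        * G x + w e * (if e.state h = s ∧ e.action h = a then 0 else 1) * G₀ := by
    intro e
    by_cases hv : e.state h = s ∧ e.action h = a <;> simp [hv]
  change ∑ e : Episode S A H, w e * _ ≤ _
  simp only [h3]
  rw [Finset.sum_add_distrib, Finset.sum_comm, ← Finset.sum_mul, h2]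
  simp only [← Finset.sum_mul, h1]
  calc ∑ x, ENNReal.ofReal o * ENNReal.ofReal (p h s a x) * G x + ENNReal.ofReal (1 - o) * G₀
      = ENNReal.ofReal o * ∑ x, ENNReal.ofReal (p h s a x) * G x
        + ENNReal.ofReal (1 - o) * G₀ := by simp only [Finset.mul_sum, mul_assoc]
    _ ≤ ENNReal.ofReal o * G₀ + ENNReal.ofReal (1 - o) * G₀ := by gcongr
    _ = G₀ := by
      rw [← add_mul, ← ENNReal.ofReal_add (occupancy_nonneg ..)
        (sub_nonneg.2 (occupancy_le_one ..))]
      simp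

theorem card_filter_snoc {t : ℕ} (D : Data S A H t) (e : Episode S A H)
    (Q : Episode S A H → Prop) [DecidablePred Q] :
    (Finset.univ.filter fun i => Q ((Fin.snoc D e : Data S A H (t + 1)) i)).card =
      (Finset.univ.filter fun i => Q (D i)).card + if Q e then 1 else 0 := by
  rw [Finset.card_filter, Fin.sum_univ_castSucc, Finset.card_filter]
  simp

open Classical in
theorem transits_snoc {t : ℕ} (D : Data S A H t) (e : Episode S A H) (h : Fin H) (s : S) (a : A) :
    transits (Fin.snoc D e : Data S A H (t + 1)) h s a =
      if e.state h = s ∧ e.action h = a then transits D h s a + Pi.single (e.next h) 1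
      else transits D h s a := by
  funext x
  unfold transits
  rw [card_filter_snoc D e fun e => e.state h = s ∧ e.action h = a ∧ e.next h = x]
  by_cases hv : e.state h = s ∧ e.action h = a
  · rw [if_pos hv]
    simp [hv.1, hv.2, Pi.single_apply, eq_comm]
  · have : ¬ (e.state h = s ∧ e.action h = a ∧ e.next h = x) := fun h' => hv ⟨h'.1, h'.2.1⟩
    rw [if_neg hv, if_neg this]; rfl

open Classical in
theorem visits_snoc {t : ℕ} (D : Data S A H t) (e : Episode S A H) (h : Fin H) (s : S) (a : A) :
    visits (Fin.snoc D e : Data S A H (t + 1)) h s a =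
      visits D h s a + if e.state h = s ∧ e.action h = a then 1 else 0 := by
  unfold visits
  rw [card_filter_snoc D e fun e => e.state h = s ∧ e.action h = a]

theorem mean_empirical {t : ℕ} (D : Data S A H t) (h : Fin H) (s : S) (a : A)
    (hn : visits D h s a ≠ 0) (g : S → ℝ) :
    visits D h s a * mean (empirical D h s a) g = ∑ x, (transits D h s a x : ℝ) * g x := by
  have : (visits D h s a : ℝ) ≠ 0 := by exact_mod_cast hn
  simp only [mean, Finset.mul_sum, empirical, if_neg hn]
  refine Finset.sum_congr rfl fun x _ => ?_
  field_simp

variable (alg : Algorithm S A H) (s₁ : S) (p : Transitions S A H)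

open Classical in
/-- A function of the transition counts of `(s, a)` at step `h` that is superharmonic for
`p_h(s, a)` is a supermartingale. -/
theorem measure_counts_le (h : Fin H) (s : S) (a : A) {Ψ : (S → ℕ) → ENNReal} (h0 : Ψ 0 ≤ 1)
    (hΨ : ∀ m, ∑ x, ENNReal.ofReal (p h s a x) * Ψ (m + Pi.single x 1) ≤ Ψ m) (b : ℝ) :
    alg.law s₁ p {ω | ∃ t, ENNReal.ofReal (Real.exp b) ≤
      Ψ (transits (Algorithm.firstEpisodes ω t) h s a)} ≤ ENNReal.ofReal (Real.exp (-b)) := by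
  have hM : IsSupermartingale alg s₁ p fun t D => Ψ (transits D h s a) := by
    intro t D
    refine le_trans (le_of_eq ?_) (sum_visit_le s₁ p (alg.policy D) h s a
      (G := fun x => Ψ (transits D h s a + Pi.single x 1)) (hΨ _))
    refine Finset.sum_congr rfl fun e _ => ?_
    change _ * Ψ (transits (Fin.snoc D e : Data S A H (t + 1)) h s a) =
      _ * if _ then _ else Ψ (transits D h s a)
    rw [transits_snoc]
    split_ifs <;> rfl
  have := hM.measure_le alg s₁ p (c := ENNReal.ofReal (Real.exp b)) (fun D => by
    have : transits D h s a = 0 := by funext x; simp [transits]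
    rw [this]; exact h0) (by simp [Real.exp_pos]) ENNReal.ofReal_ne_top
  rwa [← ENNReal.ofReal_inv_of_pos (Real.exp_pos b), ← Real.exp_neg] at this

theorem sum_add_single {X M : Type*} [Fintype X] [DecidableEq X] [AddCommMonoid M] (m : X → ℕ)
    (x : X) (F : X → ℕ → M) (u : M) (hF : F x (m x + 1) = F x (m x) + u) :
    ∑ y, F y ((m + Pi.single x 1 : X → ℕ) y) = ∑ y, F y (m y) + u := by
  rw [← Finset.add_sum_erase _ _ (Finset.mem_univ x),
    ← Finset.add_sum_erase _ (fun y => F y (m y)) (Finset.mem_univ x)]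
  have : ∑ y ∈ Finset.univ.erase x, F y ((m + Pi.single x 1 : X → ℕ) y) =
      ∑ y ∈ Finset.univ.erase x, F y (m y) :=
    Finset.sum_congr rfl fun y hy => by simp [Finset.ne_of_mem_erase hy]
  rw [this]
  simp only [Pi.add_apply, Pi.single_eq_same, hF]
  abel

theorem prod_add_single {X M : Type*} [Fintype X] [DecidableEq X] [CommMonoid M] (m : X → ℕ)
    (x : X) (F : X → ℕ → M) (u : M) (hF : F x (m x + 1) = F x (m x) * u) :
    ∏ y, F y ((m + Pi.single x 1 : X → ℕ) y) = (∏ y, F y (m y)) * u :=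
  sum_add_single (M := Additive M) m x F u hF

/-- Each visit multiplies exp(∑ m_x g_x) by a factor of mean at most 1. -/
theorem measure_exp_counts_le (h : Fin H) (s : S) (a : A) {g : S → ℝ}
    (hg : mean (p h s a) (fun x => Real.exp (g x)) ≤ 1) (b : ℝ) :
    alg.law s₁ p {ω | ∃ t, b ≤ ∑ x, (transits (Algorithm.firstEpisodes ω t) h s a x : ℝ) * g x} ≤
      ENNReal.ofReal (Real.exp (-b)) := by
  classical
  have := measure_counts_le alg s₁ p h s a
    (Ψ := fun m => ENNReal.ofReal (Real.exp (∑ x, (m x : ℝ) * g x))) (by simp) (fun m => by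
      have h1 : ∀ x, ∑ y, (((m + Pi.single x 1 : S → ℕ) y : ℕ) : ℝ) * g y =
          ∑ y, (m y : ℝ) * g y + g x := fun x =>
        sum_add_single m x (fun y k => (k : ℝ) * g y) (g x) (by push_cast; ring)
      simp only [h1, Real.exp_add]
      have h2 : ∑ x, ENNReal.ofReal (p h s a x) *
          ENNReal.ofReal (Real.exp (∑ y, (m y : ℝ) * g y) * Real.exp (g x)) =
          ENNReal.ofReal (Real.exp (∑ y, (m y : ℝ) * g y) *
            mean (p h s a) (fun x => Real.exp (g x))) := by
        rw [← mean_const_mul, mean, ENNReal.ofReal_sum_of_nonneg fun x _ =>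
          mul_nonneg (stdSimplex.zero_le _ x) (by positivity)]
        exact Finset.sum_congr rfl fun x _ => (ENNReal.ofReal_mul (stdSimplex.zero_le _ x)).symm
      rw [h2]
      exact ENNReal.ofReal_le_ofReal (mul_le_of_le_one_right (Real.exp_pos _).le hg)) b
  refine (measure_mono ?_).trans this
  rintro ω ⟨t, ht⟩
  exact ⟨t, ENNReal.ofReal_le_ofReal (Real.exp_le_exp.2 ht)⟩

/-- The normalized Dirichlet integral of the counts `m`. -/
def dirichletWeight {X : Type*} [Fintype X] (m : X → ℕ) : ℝ :=
  (∏ x, ((m x).factorial : ℝ)) * (Fintype.card X - 1).factorial /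
    ((∑ x, m x) + (Fintype.card X - 1)).factorial

theorem dirichletWeight_pos {X : Type*} [Fintype X] (m : X → ℕ) : 0 < dirichletWeight m := by
  unfold dirichletWeight
  have := Finset.prod_pos fun x (_ : x ∈ Finset.univ) =>
    (by exact_mod_cast Nat.factorial_pos (m x) : (0 : ℝ) < (m x).factorial)
  positivity

/-- Laplace's rule of succession: one more observation of x multiplies the weight by (m x + 1)/(N +
|X|), and these ratios sum to one. -/
theorem sum_dirichletWeight {X : Type*} [Fintype X] [Nonempty X] [DecidableEq X] (m : X → ℕ) :
    ∑ x, dirichletWeight (m + Pi.single x 1) = dirichletWeight m := by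
  have hc : 1 ≤ Fintype.card X := Fintype.card_pos
  set N := ∑ x, m x with hN
  have h1 : ∀ x, dirichletWeight (m + Pi.single x 1) =
      dirichletWeight m * ((m x + 1 : ℝ) / (N + Fintype.card X)) := by
    intro x
    have e1 := prod_add_single m x (fun _ k => ((k.factorial : ℕ) : ℝ)) (m x + 1 : ℝ)
      (by simp only [Nat.factorial_succ]; push_cast; ring)
    have e2 := sum_add_single m x (fun _ k => k) 1 rfl
    unfold dirichletWeight
    rw [e1, e2, ← hN, show N + 1 + (Fintype.card X - 1) = N + (Fintype.card X - 1) + 1 by ring,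
      Nat.factorial_succ]
    have e3 : ((N + (Fintype.card X - 1) + 1 : ℕ) : ℝ) = N + Fintype.card X := by
      rw [add_assoc, Nat.sub_add_cancel hc]; push_cast; ring
    rw [Nat.cast_mul, e3]
    have : (0 : ℝ) < N + Fintype.card X := by positivity
    field_simp
  simp only [h1, ← Finset.mul_sum, ← Finset.sum_div, Finset.sum_add_distrib]
  have : (0 : ℝ) < N + Fintype.card X := by positivity
  rw [← Nat.cast_sum, ← hN]
  simp [this.ne']

/-- Bounds a binomial coefficient polynomially; this is the cost of the mixture and the origin of S
log(1+n) in β^KL. -/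
theorem factorial_add_le (n k : ℕ) :
    (n + k).factorial ≤ n.factorial * k.factorial * (n + 1) ^ k := by
  induction k with
  | zero => simp
  | succ k ih =>
    rw [← add_assoc, Nat.factorial_succ, Nat.factorial_succ]
    calc (n + k + 1) * (n + k).factorial
        ≤ ((n + 1) * (k + 1)) * (n.factorial * k.factorial * (n + 1) ^ k) :=
          Nat.mul_le_mul (by nlinarith) ih
      _ = _ := by ring

theorem prod_pow_le_multinomial {X : Type*} [Fintype X] (m : X → ℕ) {w : X → ℝ}
    (hw : ∀ x, 0 ≤ w x) :
    ((∑ x, m x).factorial : ℝ) * ∏ x, w x ^ m x ≤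
      (∏ x, ((m x).factorial : ℝ)) * (∑ x, w x) ^ (∑ x, m x) := by
  classical
  rw [Finset.sum_pow_eq_sum_piAntidiag]
  have hm : m ∈ Finset.piAntidiag Finset.univ (∑ x, m x) := by simp
  have h1 := Finset.single_le_sum (f := fun k : X → ℕ =>
    (Nat.multinomial Finset.univ k : ℝ) * ∏ i, w i ^ k i)
    (fun k _ => mul_nonneg (by positivity) (Finset.prod_nonneg fun x _ => pow_nonneg (hw x) _)) hm
  have h2 : (∏ x, ((m x).factorial : ℝ)) * (Nat.multinomial Finset.univ m : ℝ) =
      (∑ x, m x).factorial := by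
    exact_mod_cast Nat.multinomial_spec Finset.univ m
  calc _ = (∏ x, ((m x).factorial : ℝ)) *
      ((Nat.multinomial Finset.univ m : ℝ) * ∏ i, w i ^ m i) := by rw [← mul_assoc, h2]
    _ ≤ _ := mul_le_mul_of_nonneg_left h1 (Finset.prod_nonneg fun x _ => by positivity)

/-- The likelihood ratio of the Laplace mixture against `p`. -/
def laplaceRatio {X : Type*} [Fintype X] (p : X → ℝ) (m : X → ℕ) : ENNReal :=
  ENNReal.ofReal (dirichletWeight m) * ∏ x, (ENNReal.ofReal (p x))⁻¹ ^ m x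

/-- The factors p x cancel and the rule of succession remains. Only an inequality holds, because p x
* (p x)⁻¹ is 0 when p x = 0. -/
theorem sum_laplaceRatio_le {X : Type*} [Fintype X] [Nonempty X] [DecidableEq X] (p : X → ℝ)
    (m : X → ℕ) :
    ∑ x, ENNReal.ofReal (p x) * laplaceRatio p (m + Pi.single x 1) ≤ laplaceRatio p m := by
  have h1 : ∀ x, ENNReal.ofReal (p x) * laplaceRatio p (m + Pi.single x 1) ≤
      ENNReal.ofReal (dirichletWeight (m + Pi.single x 1)) *
        ∏ x, (ENNReal.ofReal (p x))⁻¹ ^ m x := by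
    intro x
    unfold laplaceRatio
    rw [prod_add_single m x (fun y k => (ENNReal.ofReal (p y))⁻¹ ^ k) ((ENNReal.ofReal (p x))⁻¹)
      (pow_succ _ _)]
    calc _ = ENNReal.ofReal (dirichletWeight (m + Pi.single x 1)) *
          (∏ x, (ENNReal.ofReal (p x))⁻¹ ^ m x) *
          (ENNReal.ofReal (p x) * (ENNReal.ofReal (p x))⁻¹) := by ring
      _ ≤ _ := mul_le_of_le_one_right' (ENNReal.mul_inv_le_one _)
  refine (Finset.sum_le_sum fun x _ => h1 x).trans_eq ?_
  rw [← Finset.sum_mul, ← ENNReal.ofReal_sum_of_nonneg fun x _ => (dirichletWeight_pos _).le,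
    sum_dirichletWeight]
  rfl

/-- One term of the multinomial expansion of (∑ p e^g)^N, divided by ∏ p^m, bounds e^{∑ m g} by Z^N
(∏ m!/N!) ∏ p^{-m}, with Z the p-mean of e^g. Up to the factor (N+1)^{|X|-1}, ∏ m!/N! is the
Dirichlet weight, so the likelihood ratio appears. This yields the dual KL bound for all g at once,
without passing through the divergence itself. -/
theorem exp_sum_le_of_laplaceRatio_lt {X : Type*} [Fintype X] [Nonempty X] {p : X → ℝ}
    (hp : p ∈ stdSimplex ℝ X) {m : X → ℕ} {b : ℝ}
    (hm : laplaceRatio p m < ENNReal.ofReal (Real.exp b)) (g : X → ℝ) :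
    Real.exp (∑ x, (m x : ℝ) * g x) ≤ mean p (fun x => Real.exp (g x)) ^ (∑ x, m x) *
      ((∑ x, m x : ℕ) + 1 : ℝ) ^ (Fintype.card X - 1) * Real.exp b := by
  classical
  -- Finiteness of the likelihood ratio forces every observed x to have p x > 0, so that division by
  -- ∏ p^m is legitimate.
  have hne : ∏ x, (ENNReal.ofReal (p x))⁻¹ ^ m x ≠ ⊤ := by
    intro h
    rw [laplaceRatio, h, ENNReal.mul_top (by simp [dirichletWeight_pos])] at hm
    exact not_top_lt hm
  have hsupp : ∀ x, m x ≠ 0 → 0 < p x := by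
    intro x hx
    by_contra hpx
    apply hne
    have h0 : ENNReal.ofReal (p x) = 0 := ENNReal.ofReal_eq_zero.2 (not_lt.1 hpx)
    have : (ENNReal.ofReal (p x))⁻¹ ^ m x = ⊤ := by
      rw [h0, ENNReal.inv_zero, ENNReal.top_pow hx]
    rw [← Finset.mul_prod_erase _ _ (Finset.mem_univ x), this, ENNReal.top_mul]
    rw [Finset.prod_ne_zero_iff]
    intro y _
    exact pow_ne_zero _ (by simp)
  have hprod : ∏ x, (ENNReal.ofReal (p x))⁻¹ ^ m x = ENNReal.ofReal (∏ x, (p x)⁻¹ ^ m x) := by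
    rw [ENNReal.ofReal_prod_of_nonneg fun x _ => pow_nonneg (inv_nonneg.2 (hp.1 x)) _]
    refine Finset.prod_congr rfl fun x _ => ?_
    rcases eq_or_ne (m x) 0 with h | h
    · simp [h]
    · rw [ENNReal.ofReal_pow (inv_nonneg.2 (hp.1 x)), ENNReal.ofReal_inv_of_pos (hsupp x h)]
  rw [laplaceRatio, hprod, ← ENNReal.ofReal_mul (dirichletWeight_pos m).le,
    ENNReal.ofReal_lt_ofReal_iff (Real.exp_pos b)] at hm
  set N := ∑ x, m x with hN
  set K := Fintype.card X - 1
  have hfac := prod_pow_le_multinomial m (w := fun x => p x * Real.exp (g x))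
    fun x => mul_nonneg (hp.1 x) (Real.exp_pos _).le
  rw [← hN] at hfac
  change _ ≤ _ * (mean p fun x => Real.exp (g x)) ^ N at hfac
  set Z := mean p fun x => Real.exp (g x)
  have hZ : 0 < Z := mean_exp_pos hp g
  set F := ∏ x, ((m x).factorial : ℝ)
  have hF : 0 < F := Finset.prod_pos fun x _ => by positivity
  set I := ∏ x, (p x)⁻¹ ^ m x
  have hI : 0 ≤ I := Finset.prod_nonneg fun x _ => pow_nonneg (inv_nonneg.2 (hp.1 x)) _
  have e1 : Real.exp (∑ x, (m x : ℝ) * g x) = (∏ x, (p x * Real.exp (g x)) ^ m x) * I := by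
    rw [Real.exp_sum, ← Finset.prod_mul_distrib]
    refine Finset.prod_congr rfl fun x _ => ?_
    rcases eq_or_ne (m x) 0 with h | h
    · simp [h]
    · rw [mul_comm, Real.exp_mul, Real.rpow_natCast, ← mul_pow]
      congr 1
      have := (hsupp x h).ne'
      field_simp
  have hdw : dirichletWeight m = F * K.factorial / (N + K).factorial := rfl
  have hNK : ((N + K).factorial : ℝ) ≤ N.factorial * K.factorial * (N + 1) ^ K := by
    exact_mod_cast factorial_add_le N K
  have hN0 : (0 : ℝ) < N.factorial := by positivity
  rw [e1]
  have h3 : (∏ x, (p x * Real.exp (g x)) ^ m x) * I ≤ F * Z ^ N / N.factorial * I := by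
    refine mul_le_mul_of_nonneg_right ?_ hI
    rw [le_div_iff₀ hN0]
    linarith
  refine h3.trans ?_
  have h4 : F / N.factorial ≤ dirichletWeight m * (N + 1) ^ K := by
    rw [hdw, div_le_iff₀ hN0, div_mul_eq_mul_div, div_mul_eq_mul_div,
      le_div_iff₀ (by positivity)]
    calc F * ((N + K).factorial : ℝ) ≤ F * (N.factorial * K.factorial * (N + 1) ^ K) := by gcongr
      _ = _ := by ring
  calc F * Z ^ N / N.factorial * I = (F / N.factorial) * (Z ^ N * I) := by ring
    _ ≤ (dirichletWeight m * (N + 1) ^ K) * (Z ^ N * I) := by gcongr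
    _ = Z ^ N * (N + 1) ^ K * (dirichletWeight m * I) := by ring
    _ ≤ _ := by gcongr

theorem measure_not_klBound_le {δ : ℝ} (h : Fin H) (s : S) (a : A) :
    alg.law s₁ p {ω | ∃ t, visits (Algorithm.firstEpisodes ω t) h s a ≠ 0 ∧
      ¬ KLBound (empirical (Algorithm.firstEpisodes ω t) h s a) (p h s a)
        (betaKL S A H δ (visits (Algorithm.firstEpisodes ω t) h s a) /
          visits (Algorithm.firstEpisodes ω t) h s a)} ≤
      ENNReal.ofReal (Real.exp (-Real.log (4 * size S A H / δ))) := by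
  classical
  have : Nonempty S := ⟨s⟩
  refine (measure_mono ?_).trans (measure_counts_le alg s₁ p h s a (Ψ := laplaceRatio (p h s a))
    (by simp [laplaceRatio, dirichletWeight, Nat.factorial_ne_zero])
    (sum_laplaceRatio_le (p h s a)) _)
  rintro ω ⟨t, hn, hkl⟩
  refine ⟨t, ?_⟩
  by_contra hlt
  apply hkl
  intro g
  set D := Algorithm.firstEpisodes ω t
  have key := exp_sum_le_of_laplaceRatio_lt (p h s a).2 (not_le.1 hlt) g
  rw [sum_transits, ← mean_empirical D h s a hn] at key
  change _ ≤ mean (p h s a) _ ^ _ * _ * _ at key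
  have hZ : 0 < mean (p h s a) (fun x => Real.exp (g x)) := mean_exp_pos (p h s a).2 g
  set Z := mean (p h s a) (fun x => Real.exp (g x))
  set n := visits D h s a
  have hn0 : (0 : ℝ) < n := by exact_mod_cast Nat.pos_of_ne_zero hn
  have hl := Real.log_le_log (Real.exp_pos _) key
  rw [Real.log_exp, Real.log_mul (by positivity) (Real.exp_pos _).ne', Real.log_exp,
    Real.log_mul (by positivity) (by positivity), Real.log_pow, Real.log_pow] at hl
  have hlog := log_one_add_nonneg n
  have hcard : ((Fintype.card S - 1 : ℕ) : ℝ) ≤ Fintype.card S := by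
    exact_mod_cast Nat.sub_le _ _
  have h1 : ((Fintype.card S - 1 : ℕ) : ℝ) * Real.log ((n : ℝ) + 1) ≤
      (Fintype.card S : ℝ) * Real.log (Real.exp 1 * (1 + (n : ℝ))) := by
    rw [log_exp_one_mul, add_comm (n : ℝ) 1]
    exact mul_le_mul hcard (by linarith) hlog (by positivity)
  have h2 : (n : ℝ) * mean (empirical D h s a) g ≤ n * Real.log Z + betaKL S A H δ n := by
    unfold betaKL
    linarith
  rw [← sub_le_iff_le_add', le_div_iff₀ hn0]
  linarith

end Counts

/-! ### Exponential moments, and the bias and oscillation of the empirical entropy -/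

section Moments

variable {X : Type*} [Fintype X]

theorem nonneg_of_deriv_nonneg {f f' : ℝ → ℝ} (hf : ∀ y, HasDerivAt f (f' y) y) (h0 : f 0 = 0)
    (hf' : ∀ y, 0 ≤ y → 0 ≤ f' y) {y : ℝ} (hy : 0 ≤ y) : 0 ≤ f y := by
  have hmono : MonotoneOn f (Set.Ici 0) := by
    refine monotoneOn_of_deriv_nonneg (convex_Ici 0)
      (fun y _ => (hf y).continuousAt.continuousWithinAt)
      (fun y _ => (hf y).differentiableAt.differentiableWithinAt) fun y hy => ?_
    rw [interior_Ici] at hy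
    rw [(hf y).deriv]
    exact hf' y (le_of_lt hy)
  rw [← h0]
  exact hmono Set.self_mem_Ici hy hy

/-- Both sides vanish at 0. The derivative of the difference is (2/3)(y + 2 - 2e^y + y e^y), whose
bracket again vanishes at 0 and has derivative 1 - e^y + y e^y ≥ 0. -/
theorem exp_sub_mul_le {y : ℝ} (hy : 0 ≤ y) :
    (2 - 2 * y / 3) * (Real.exp y - 1 - y) ≤ y ^ 2 := by
  have h1 : ∀ y : ℝ, 0 ≤ y → 0 ≤ 1 - Real.exp y + y * Real.exp y := by
    intro y _
    have := Real.add_one_le_exp (-y)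
    have h2 : Real.exp (-y) * Real.exp y = 1 := by rw [← Real.exp_add]; simp
    nlinarith [Real.exp_pos y]
  have h2 : ∀ y : ℝ, 0 ≤ y → 0 ≤ y + 2 - 2 * Real.exp y + y * Real.exp y := fun y hy =>
    nonneg_of_deriv_nonneg (f' := fun y => 1 - Real.exp y + y * Real.exp y)
      (f := fun y => y + 2 - 2 * Real.exp y + y * Real.exp y) (fun y => by
        have := (((hasDerivAt_id y).add_const 2).sub ((Real.hasDerivAt_exp y).const_mul 2)).add
          ((hasDerivAt_id y).mul (Real.hasDerivAt_exp y))
        refine this.congr_deriv ?_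
        simp only [id]
        ring) (by simp) h1 hy
  have h3 := nonneg_of_deriv_nonneg
    (f' := fun y => 2 / 3 * (y + 2 - 2 * Real.exp y + y * Real.exp y))
    (f := fun y => y ^ 2 - (2 - 2 * y / 3) * (Real.exp y - 1 - y)) (fun y => by
      have := ((hasDerivAt_id y).pow 2).sub
        (((((hasDerivAt_id y).const_mul 2).div_const 3).const_sub 2).mul
          (((Real.hasDerivAt_exp y).sub_const 1).sub (hasDerivAt_id y)))
      refine this.congr_deriv ?_
      simp only [id, Pi.sub_apply]
      push_cast
      ring) (by simp) (fun y hy => by have := h2 y hy; positivity) hy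
  linarith

theorem exp_le_bernstein {y c : ℝ} (hy : y ≤ c) (hc0 : 0 ≤ c) (hc : c < 3) :
    Real.exp y ≤ 1 + y + y ^ 2 / (2 * (1 - c / 3)) := by
  have hc' : 0 < 2 * (1 - c / 3) := by linarith
  rcases le_total 0 y with h0 | h0
  · have h1 := exp_sub_mul_le h0
    have h2 : 0 ≤ Real.exp y - 1 - y := by linarith [Real.add_one_le_exp y]
    have : Real.exp y - 1 - y ≤ y ^ 2 / (2 * (1 - c / 3)) := by
      rw [le_div_iff₀ hc']
      nlinarith
    linarith
  · have h1 := exp_neg_le_one_sub_mul (u := -y) (θ := -y) (by linarith) le_rfl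
    rw [neg_neg] at h1
    have : y ^ 2 / 2 ≤ y ^ 2 / (2 * (1 - c / 3)) :=
      div_le_div_of_nonneg_left (sq_nonneg y) hc' (by linarith)
    nlinarith

/-- The exponent that yields Bernstein's inequality. -/
theorem exists_bernstein {p : X → ℝ} (hp : p ∈ stdSimplex ℝ X) {f : X → ℝ} {b β : ℝ} (hb : 0 < b)
    (hf : ∀ x, f x ∈ Set.Icc 0 b) (hβ : 0 ≤ β) : ∃ l ψ : ℝ, 0 ≤ l ∧
      mean p (fun x => Real.exp (l * (f x - mean p f) - ψ)) ≤ 1 ∧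
      β ≤ l * (√(2 * variance p f * β) + b * β / 3) - ψ := by
  have hV0 := variance_nonneg hp.1 f
  have hm : mean p f ∈ Set.Icc 0 b :=
    ⟨mean_nonneg hp.1 fun x => (hf x).1, RegMDP.mean_le hp fun x => (hf x).2⟩
  set V := variance p f with hV
  rcases hV0.eq_or_lt with h0 | h0
  -- If the variance vanishes, f equals its mean wherever p is positive, so any l is admissible; l =
  -- 3/b turns the linear term b β / 3 into β.
  · refine ⟨3 / b, 0, by positivity, ?_, ?_⟩
    · refine le_of_eq ?_
      rw [← hp.2]
      refine Finset.sum_congr rfl fun x _ => ?_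
      have := (Finset.sum_eq_zero_iff_of_nonneg fun x _ =>
        mul_nonneg (hp.1 x) (sq_nonneg (f x - mean p f))).1 h0.symm x (Finset.mem_univ x)
      rcases mul_eq_zero.1 this with h | h
      · simp [h]
      · simp [(pow_eq_zero_iff two_ne_zero).1 h]
    · rw [← h0]
      simp only [mul_zero, zero_mul, Real.sqrt_zero, zero_add, sub_zero]
      refine le_of_eq ?_
      field_simp
  -- With l = a/d the Bernstein denominator 1 - l b/3 becomes 1/d, the log-moment bound becomes ψ =
  -- β/d, and the last inequality is an equality.
  · set a := √(2 * β / V) with ha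
    have ha0 : 0 ≤ a := Real.sqrt_nonneg _
    have ha2 : a ^ 2 * V = 2 * β := by rw [ha, Real.sq_sqrt (by positivity)]; field_simp
    set d := 1 + b * a / 3 with hd
    have hd0 : 0 < d := by positivity
    have hs : √(2 * V * β) = a * V := by
      rw [show 2 * V * β = (a * V) ^ 2 by rw [mul_pow, sq V, ← mul_assoc, ha2]; ring]
      exact Real.sqrt_sq (by positivity)
    have hc : 1 - a / d * b / 3 = 1 / d := by
      field_simp
      rw [hd]; ring
    refine ⟨a / d, β / d, by positivity, ?_, ?_⟩
    · have h1 : ∀ x, Real.exp (a / d * (f x - mean p f)) ≤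
          a / d * (f x - mean p f) + ((a / d) ^ 2 * d / 2 * (f x - mean p f) ^ 2 + 1) := by
        intro x
        refine (exp_le_bernstein (c := a / d * b) ?_ (by positivity) ?_).trans_eq ?_
        · have : f x - mean p f ≤ b := by linarith [(hf x).2, hm.1]
          exact mul_le_mul_of_nonneg_left this (by positivity)
        · have : 0 < 1 / d := by positivity
          linarith
        · rw [hc]
          field_simp
          ring
      have h2 := mean_mono hp.1 h1
      rw [mean_add, mean_const_mul, mean_add_const hp, mean_const_mul, mean_sub p f (fun _ => _),
        mean_const hp] at h2
      have h3 : (a / d) ^ 2 * d / 2 * mean p (fun x => (f x - mean p f) ^ 2) = β / d := by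
        change (a / d) ^ 2 * d / 2 * V = β / d
        rw [show (a / d) ^ 2 * d / 2 * V = (a ^ 2 * V) / (2 * d) by field_simp, ha2]
        field_simp
      rw [h3] at h2
      have h4 : mean p (fun x => Real.exp (a / d * (f x - mean p f) - β / d)) =
          Real.exp (-(β / d)) * mean p (fun x => Real.exp (a / d * (f x - mean p f))) := by
        rw [← mean_const_mul]
        congr 1; funext x
        rw [← Real.exp_add]
        congr 1; ring
      rw [h4]
      calc _ ≤ Real.exp (-(β / d)) * Real.exp (β / d) := by
            refine mul_le_mul_of_nonneg_left ?_ (Real.exp_pos _).le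
            refine h2.trans ?_
            change a / d * (mean p f - mean p f) + _ ≤ _
            linarith [Real.add_one_le_exp (β / d)]
        _ = 1 := by rw [← Real.exp_add]; simp
    · rw [hs]
      refine le_of_eq ?_
      have : a / d * (a * V + b * β / 3) - β / d = (a ^ 2 * V + a * b * β / 3 - β) / d := by
        field_simp
      rw [this, ha2, eq_div_iff hd0.ne', hd]
      ring

/-- Hoeffding's lemma in terms of the oscillation, the only thing known about the increments of the
Doob martingale. -/
theorem mean_exp_le_of_osc {q : X → ℝ} (hq : q ∈ stdSimplex ℝ X) {f : X → ℝ} {c : ℝ}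
    (hf : ∀ x y, f x - f y ≤ c) (θ : ℝ) :
    mean q (fun x => Real.exp (θ * (f x - mean q f))) ≤ Real.exp (θ ^ 2 * c ^ 2 / 8) := by
  have hne : Nonempty X := by
    by_contra h
    rw [not_nonempty_iff] at h
    have := hq.2
    simp at this
  let _ : MeasurableSpace X := ⊤
  let P : PMF X := PMF.ofFintype (fun x => ENNReal.ofReal (q x)) (by
    rw [← ENNReal.ofReal_sum_of_nonneg fun x _ => hq.1 x, hq.2, ENNReal.ofReal_one])
  have hint : ∀ g : X → ℝ, ∫ x, g x ∂P.toMeasure = mean q g := by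
    intro g
    rw [PMF.integral_eq_sum]
    refine Finset.sum_congr rfl fun x _ => ?_
    rw [PMF.ofFintype_apply, ENNReal.toReal_ofReal (hq.1 x), smul_eq_mul]
  obtain ⟨x₀, hx₀⟩ := Finite.exists_min f
  have hc : 0 ≤ c := by simpa using hf x₀ x₀
  have := (hasSubgaussianMGF_of_mem_Icc (μ := P.toMeasure) (X := f) (a := f x₀) (b := f x₀ + c)
    (measurable_of_finite f).aemeasurable
    (Filter.Eventually.of_forall fun x => ⟨hx₀ x, by linarith [hf x x₀]⟩)).mgf_le θ
  rw [mgf, hint, hint] at this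
  refine this.trans_eq ?_
  congr 1
  push_cast
  rw [add_sub_cancel_left, Real.norm_eq_abs, abs_of_nonneg hc]
  ring

section IID

variable [DecidableEq X] (p : X → ℝ)

/-- The mean of `φ` over the counts obtained by adding `k` independent samples from `p`. -/
def iidMean (φ : (X → ℕ) → ℝ) : ℕ → (X → ℕ) → ℝ
  | 0, m => φ m
  | k + 1, m => mean p fun x => iidMean φ k (m + Pi.single x 1)

theorem sum_add_single_one (m : X → ℕ) (x : X) :
    ∑ y, (m + Pi.single x 1 : X → ℕ) y = ∑ y, m y + 1 :=
  sum_add_single m x (fun _ k => k) 1 rfl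

variable {p}

/-- Samples never leave the support of p, so the comparison is needed only on counts of the right
total that vanish where p does. -/
theorem iidMean_mono (hp : ∀ x, 0 ≤ p x) {φ φ' : (X → ℕ) → ℝ} {N : ℕ}
    (h : ∀ m : X → ℕ, ∑ x, m x = N → (∀ x, p x = 0 → m x = 0) → φ m ≤ φ' m) (k : ℕ) :
    ∀ m : X → ℕ, ∑ x, m x + k = N → (∀ x, p x = 0 → m x = 0) →
      iidMean p φ k m ≤ iidMean p φ' k m := by
  induction k with
  | zero => exact h
  | succ k ih =>
    intro m hm hs
    refine Finset.sum_le_sum fun x _ => ?_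
    rcases eq_or_ne (p x) 0 with hx | hx
    · simp [hx]
    refine mul_le_mul_of_nonneg_left (ih _ ?_ ?_) (hp x)
    · rw [sum_add_single_one]; omega
    · intro y hy
      have : y ≠ x := fun h => hx (h ▸ hy)
      simp [this, hs y hy]

/-- Coupling: the other samples are shared, so replacing one outcome still changes a single count
vector by one swap. -/
theorem iidMean_osc (hp : p ∈ stdSimplex ℝ X) {φ : (X → ℕ) → ℝ} {N : ℕ} {c : ℝ}
    (h : ∀ m : X → ℕ, ∑ x, m x = N → ∀ x y,
      φ (m + Pi.single x 1) - φ (m + Pi.single y 1) ≤ c) (k : ℕ) :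
    ∀ m : X → ℕ, ∑ x, m x + k = N → ∀ x y,
      iidMean p φ k (m + Pi.single x 1) - iidMean p φ k (m + Pi.single y 1) ≤ c := by
  induction k with
  | zero => exact h
  | succ k ih =>
    intro m hm x y
    simp only [iidMean]
    rw [← mean_sub]
    refine mean_le hp fun z => ?_
    rw [add_right_comm m, add_right_comm m (Pi.single y 1)]
    exact ih _ (by rw [sum_add_single_one]; omega) x y

theorem iidMean_const (hp : p ∈ stdSimplex ℝ X) (c : ℝ) (k : ℕ) (m : X → ℕ) :
    iidMean p (fun _ => c) k m = c := by
  induction k generalizing m with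
  | zero => rfl
  | succ k ih => simp only [iidMean, ih, mean_const hp]

/-- The final count of x is m x plus a binomial variable with parameters k and p x; the formula
collects its first two moments. -/
theorem iidMean_quadratic (hp : p ∈ stdSimplex ℝ X) (B C : X → ℝ) (k : ℕ) (m : X → ℕ) :
    iidMean p (fun m => ∑ x, (B x * m x + C x * (m x : ℝ) ^ 2)) k m =
      ∑ x, (B x * (m x + k * p x) + C x * ((m x : ℝ) ^ 2 + 2 * k * p x * m x + k * p x +
        k * (k - 1) * p x ^ 2)) := by
  induction k generalizing m with
  | zero => simp [iidMean]
  | succ k ih =>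
    have h1 := fun x => sum_add_single m x (fun y (j : ℕ) => B y * ((j : ℝ) + k * p y) +
      C y * ((j : ℝ) ^ 2 + 2 * k * p y * j + k * p y + k * (k - 1) * p y ^ 2))
      (B x + C x * (2 * m x + 1 + 2 * k * p x)) (by push_cast; ring)
    simp only [iidMean, ih, h1]
    rw [mean_add p (fun _ => _), mean_const hp, mean, ← Finset.sum_add_distrib]
    refine Finset.sum_congr rfl fun x _ => ?_
    push_cast
    ring

/-- The entropy of the empirical distribution with counts `m` out of `n` samples. -/
def countEntropy (n : ℕ) (m : X → ℕ) : ℝ := entropy fun x => (m x : ℝ) / n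

theorem countEntropy_nonneg {n : ℕ} {m : X → ℕ} (hm : ∑ x, m x = n) : 0 ≤ countEntropy n m := by
  refine Finset.sum_nonneg fun x _ => Real.negMulLog_nonneg (by positivity) ?_
  refine div_le_one_of_le₀ ?_ (by positivity)
  rw [← hm]
  exact_mod_cast Finset.single_le_sum (f := m) (fun _ _ => Nat.zero_le _) (Finset.mem_univ x)

/-- Entropy is at most the cross entropy relative to p, which is linear in the counts and has mean
entropy p. -/
theorem iidMean_countEntropy_le (hp : p ∈ stdSimplex ℝ X) {n : ℕ} (hn : n ≠ 0) :
    iidMean p (countEntropy n) n 0 ≤ entropy p := by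
  have hn' : (n : ℝ) ≠ 0 := by exact_mod_cast hn
  refine (iidMean_mono hp.1 (N := n) (φ' := fun m => ∑ x, ((-Real.log (p x) / n) * m x +
    0 * (m x : ℝ) ^ 2)) ?_ n 0 (by simp) (by simp)).trans ?_
  · intro m hm hs
    have h1 : ∀ x, Real.negMulLog ((m x : ℝ) / n) ≤
        (-Real.log (p x) / n) * m x + (p x - (m x : ℝ) / n) := by
      intro x
      rcases (hp.1 x).eq_or_lt with hx | hx
      · simp [hs x hx.symm, ← hx]
      rcases Nat.eq_zero_or_pos (m x) with h0 | h0
      · simp [h0, hx.le]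
      · set q := (m x : ℝ) / n with hq
        have hq0 : 0 < q := by positivity
        have := Real.log_le_sub_one_of_pos (div_pos hx hq0)
        rw [Real.log_div hx.ne' hq0.ne'] at this
        have h2 := mul_le_mul_of_nonneg_left this hq0.le
        have e1 : q * (p x / q - 1) = p x - q := by field_simp
        have e2 : (-Real.log (p x) / n) * m x = - Real.log (p x) * q := by rw [hq]; ring
        rw [e1] at h2
        rw [e2, Real.negMulLog]
        linarith
    refine (Finset.sum_le_sum fun x _ => h1 x).trans_eq ?_
    have e : ∑ x, (m x : ℝ) / n = 1 := by
      rw [← Finset.sum_div, ← Nat.cast_sum, hm, div_self hn']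
    rw [Finset.sum_add_distrib, Finset.sum_sub_distrib, hp.2, e]
    simp
  · rw [iidMean_quadratic hp]
    refine le_of_eq (Finset.sum_congr rfl fun x _ => ?_)
    simp only [Pi.zero_apply, Nat.cast_zero, Real.negMulLog]
    field_simp
    ring

/-- The log inequality log(q/p) ≤ q/p - 1 bounds the empirical entropy below by a quadratic in the
counts. Its mean loses (1 - p x)/n per outcome, the mean χ² distance, hence (|X| - 1)/n in total. -/
theorem entropy_sub_le_iidMean (hp : p ∈ stdSimplex ℝ X) {n : ℕ} (hn : n ≠ 0) :
    entropy p - (Fintype.card X - 1) / n ≤ iidMean p (countEntropy n) n 0 := by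
  have hn0 : (0 : ℝ) < n := by exact_mod_cast Nat.pos_of_ne_zero hn
  refine le_trans ?_ (iidMean_mono hp.1 (N := n) (φ := fun m => ∑ x,
    (((-Real.log (p x) + 1) / n) * m x + (-(p x * n ^ 2)⁻¹) * (m x : ℝ) ^ 2)) ?_ n 0
      (by simp) (by simp))
  · rw [iidMean_quadratic hp]
    have e : entropy p - (Fintype.card X - 1) / n =
        ∑ x, (Real.negMulLog (p x) - (1 - p x) / n) := by
      rw [Finset.sum_sub_distrib, ← Finset.sum_div, Finset.sum_sub_distrib, hp.2]
      simp [entropy]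
    rw [e]
    refine Finset.sum_le_sum fun x _ => ?_
    rcases (hp.1 x).eq_or_lt with hx | hx
    · rw [← hx]; simp
    · simp only [Pi.zero_apply, Nat.cast_zero, Real.negMulLog]
      refine le_of_eq ?_
      field_simp
      ring
  · intro m hm hs
    refine Finset.sum_le_sum fun x _ => ?_
    rcases (hp.1 x).eq_or_lt with hx | hx
    · simp [hs x hx.symm]
    rcases Nat.eq_zero_or_pos (m x) with h0 | h0
    · simp [h0]
    · set q := (m x : ℝ) / n with hq
      have hq0 : 0 < q := by positivity
      have := Real.log_le_sub_one_of_pos (div_pos hq0 hx)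
      rw [Real.log_div hq0.ne' hx.ne'] at this
      have h2 := mul_le_mul_of_nonneg_left this hq0.le
      have e1 : ((-Real.log (p x) + 1) / n) * m x + (-(p x * n ^ 2)⁻¹) * (m x : ℝ) ^ 2 =
          (-Real.log (p x) + 1) * q - q * (q / p x) := by rw [hq]; field_simp; ring
      rw [e1, Real.negMulLog]
      linarith

theorem mul_log_succ_le {k n : ℕ} (hk : k + 1 ≤ n) (hn : 2 ≤ n) :
    ((k : ℝ) + 1) * Real.log (k + 1) - k * Real.log k ∈ Set.Icc 0 (2 * Real.log n) := by
  have hkn : Real.log ((k : ℝ) + 1) ≤ Real.log n :=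
    Real.log_le_log (by positivity) (by exact_mod_cast hk)
  have hl2 : Real.log 2 ≤ Real.log n := Real.log_le_log (by norm_num) (by exact_mod_cast hn)
  have hl2' : 0 ≤ Real.log 2 := Real.log_nonneg (by norm_num)
  rcases Nat.eq_zero_or_pos k with h0 | h0
  · subst h0
    simp only [Nat.cast_zero, zero_add, Real.log_one, mul_zero, zero_mul, sub_zero]
    exact ⟨le_rfl, by linarith⟩
  have hk1 : (1 : ℝ) ≤ k := by exact_mod_cast h0
  have hlk : Real.log k ≤ Real.log (k + 1) := Real.log_le_log (by linarith) (by linarith)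
  have hl0 : 0 ≤ Real.log ((k : ℝ) + 1) := Real.log_nonneg (by linarith)
  constructor
  · nlinarith
  -- k log(1 + 1/k) ≤ 1 ≤ log n once n ≥ 3; for k = 1 the left side is log 2, which covers n = 2.
  have key : (k : ℝ) * (Real.log (k + 1) - Real.log k) ≤ Real.log n := by
    rcases Nat.eq_or_lt_of_le h0 with h1 | h1
    · have : k = 1 := h1.symm
      subst this
      simpa [show (1 : ℝ) + 1 = 2 by norm_num] using hl2
    · have h3 : Real.log (k + 1) - Real.log k ≤ 1 / k := by
        rw [← Real.log_div (by positivity) (by positivity)]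
        refine (Real.log_le_sub_one_of_pos (by positivity)).trans_eq ?_
        field_simp
        ring
      have h4 : (k : ℝ) * (Real.log (k + 1) - Real.log k) ≤ 1 := by
        refine (mul_le_mul_of_nonneg_left h3 (by positivity)).trans_eq ?_
        field_simp
      have h5 : 1 ≤ Real.log n := by
        rw [Real.le_log_iff_exp_le (by positivity)]
        have : (3 : ℝ) ≤ n := by exact_mod_cast (by omega : 3 ≤ n)
        linarith [Real.exp_one_lt_d9]
      linarith
  linarith

/-- Since n times the entropy is n log n - ∑ m log m, adding x rather than y only exchanges two
increments of k log k, each between 0 and 2 log n. -/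
theorem countEntropy_osc {n : ℕ} (hn : 2 ≤ n) {m : X → ℕ} (hm : ∑ x, m x = n - 1) (x y : X) :
    countEntropy n (m + Pi.single x 1) - countEntropy n (m + Pi.single y 1) ≤
      2 * Real.log n / n := by
  have hn0 : (0 : ℝ) < n := by positivity
  have h1 : ∀ k : ℕ, n * Real.negMulLog ((k : ℝ) / n) = k * Real.log n - k * Real.log k := by
    intro k
    rcases Nat.eq_zero_or_pos k with h0 | h0
    · simp [h0]
    · rw [Real.negMulLog, Real.log_div (by positivity) hn0.ne']
      field_simp
      ring
  have h2 : ∀ z, countEntropy n (m + Pi.single z 1) = countEntropy n m +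
      (Real.log n - ((m z + 1 : ℝ) * Real.log (m z + 1) - m z * Real.log (m z))) / n := by
    intro z
    refine sum_add_single m z (fun _ k => Real.negMulLog ((k : ℝ) / n)) _ ?_
    rw [← mul_right_inj' hn0.ne', mul_add, h1, h1, mul_div_cancel₀ _ hn0.ne']
    push_cast
    ring
  have h3 : ∀ z, m z + 1 ≤ n := fun z => by
    have := Finset.single_le_sum (f := m) (fun _ _ => Nat.zero_le _) (Finset.mem_univ z)
    omega
  rw [h2, h2, add_sub_add_left_eq_sub, ← sub_div]
  refine div_le_div_of_nonneg_right ?_ hn0.le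
  linarith [(mul_log_succ_le (h3 x) hn).1, (mul_log_succ_le (h3 y) hn).2]

end IID

end Moments

/-! ### The confidence regions hold simultaneously with probability at least 1 - δ -/

section Concentration

variable {S A : Type*} [Fintype S] [Fintype A] {H : ℕ}
variable (alg : Algorithm S A H) (s₁ : S) (p : Transitions S A H)

open Classical in
/-- McDiarmid's inequality for the counts at the visit of number `n`. -/
theorem measure_mcdiarmid_le (h : Fin H) (s : S) (a : A) {φ : (S → ℕ) → ℝ}
    {n : ℕ} {c : ℝ}
    (hφ : ∀ m : S → ℕ, ∑ x, m x = n - 1 → ∀ x y,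
      φ (m + Pi.single x 1) - φ (m + Pi.single y 1) ≤ c) (θ b : ℝ) :
    alg.law s₁ p {ω | ∃ t, visits (Algorithm.firstEpisodes ω t) h s a = n ∧
      b ≤ θ * (φ (transits (Algorithm.firstEpisodes ω t) h s a) - iidMean (p h s a) φ n 0) -
        n * (θ ^ 2 * c ^ 2 / 8)} ≤ ENNReal.ofReal (Real.exp (-b)) := by
  set q := p h s a with hq
  set Z := iidMean q φ n 0
  -- The exponential of the compensated Doob martingale of φ with n samples, killed after visit
  -- number n so that it is a supermartingale for all counts. At exactly n visits no samples remain
  -- and the conditional mean is φ itself.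
  have := measure_counts_le alg s₁ p h s a (Ψ := fun m => if ∑ x, m x ≤ n then
      ENNReal.ofReal (Real.exp (θ * (iidMean q φ (n - ∑ x, m x) m - Z) -
        (∑ x, m x : ℕ) * (θ ^ 2 * c ^ 2 / 8))) else 0) (by simp [Z]) (fun m => by
    rcases Nat.lt_or_ge (∑ x, m x) n with hm | hm
    · obtain ⟨k, hk⟩ := Nat.exists_eq_add_of_lt hm
      have e1 : ∀ x : S, ∑ y, (m + Pi.single x 1 : S → ℕ) y = ∑ y, m y + 1 :=
        sum_add_single_one m
      have e2 : n - (∑ y, m y + 1) = k := by omega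
      have e3 : n - ∑ y, m y = k + 1 := by omega
      simp only [e1, e2, e3, if_pos hm.le, if_pos (Nat.succ_le_of_lt hm)]
      set N := ∑ y, m y
      set F := fun x => iidMean q φ k (m + Pi.single x 1) with hF
      have e4 : iidMean q φ (k + 1) m = mean q F := rfl
      have hosc : ∀ x y, F x - F y ≤ c := by
        refine iidMean_osc (p h s a).2 hφ k m ?_
        change N + k = n - 1
        omega
      have hH := mean_exp_le_of_osc (p h s a).2 hosc θ
      change mean q (fun x => Real.exp (θ * (F x - mean q F))) ≤ _ at hH
      rw [e4]
      have e5 : ∀ x, θ * (F x - Z) - ((N + 1 : ℕ) : ℝ) * (θ ^ 2 * c ^ 2 / 8) =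
          (θ * (mean q F - Z) - N * (θ ^ 2 * c ^ 2 / 8) - θ ^ 2 * c ^ 2 / 8) +
          θ * (F x - mean q F) := fun x => by push_cast; ring
      have e6 : ∑ x, ENNReal.ofReal (q x) * ENNReal.ofReal (Real.exp (θ * (F x - Z) -
          ((N + 1 : ℕ) : ℝ) * (θ ^ 2 * c ^ 2 / 8))) =
          ENNReal.ofReal (Real.exp (θ * (mean q F - Z) - N * (θ ^ 2 * c ^ 2 / 8) -
            θ ^ 2 * c ^ 2 / 8) * mean q (fun x => Real.exp (θ * (F x - mean q F)))) := by
        rw [← mean_const_mul, mean, ENNReal.ofReal_sum_of_nonneg fun x _ =>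
          mul_nonneg (stdSimplex.zero_le _ x) (by positivity)]
        refine Finset.sum_congr rfl fun x _ => ?_
        rw [e5, Real.exp_add, ENNReal.ofReal_mul (stdSimplex.zero_le _ x)]
      refine e6.le.trans ?_
      refine ENNReal.ofReal_le_ofReal ?_
      calc _ ≤ Real.exp (θ * (mean q F - Z) - N * (θ ^ 2 * c ^ 2 / 8) -
            θ ^ 2 * c ^ 2 / 8) * Real.exp (θ ^ 2 * c ^ 2 / 8) :=
            mul_le_mul_of_nonneg_left hH (Real.exp_pos _).le
        _ = _ := by rw [← Real.exp_add]; congr 1; ring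
    · have e1 : ∀ x : S, ∑ y, (m + Pi.single x 1 : S → ℕ) y = ∑ y, m y + 1 :=
        sum_add_single_one m
      have e2 : ¬ (∑ y, m y + 1 ≤ n) := by omega
      simp only [e1, if_neg e2, mul_zero, Finset.sum_const_zero]
      exact zero_le) b
  refine (measure_mono ?_).trans this
  rintro ω ⟨t, hn, hb⟩
  refine ⟨t, ?_⟩
  simp only [sum_transits, hn, le_refl, if_true, Nat.sub_self, iidMean]
  exact ENNReal.ofReal_le_ofReal (Real.exp_le_exp.2 hb)

theorem measure_iUnion_le_of_sum {Ω : Type*} [MeasurableSpace Ω] (μ : Measure Ω)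
    {E : ℕ → Set Ω} {b : ℝ} {c : ℕ → ℝ} (hb : 0 ≤ b) (hc : ∀ k, 0 ≤ c k)
    (hE : ∀ k, μ (E k) ≤ ENNReal.ofReal (b * c k)) (hs : ∀ N, ∑ k ∈ Finset.range N, c k ≤ 1) :
    μ (⋃ k, E k) ≤ ENNReal.ofReal b := by
  refine (measure_iUnion_le _).trans ((ENNReal.tsum_le_tsum hE).trans ?_)
  refine ENNReal.tsum_le_of_sum_range_le fun N => ?_
  rw [← ENNReal.ofReal_sum_of_nonneg fun k _ => mul_nonneg hb (hc k), ← Finset.mul_sum]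
  exact ENNReal.ofReal_le_ofReal (mul_le_of_le_one_right hb (hs N))

theorem sum_one_div_le (N : ℕ) :
    ∑ k ∈ Finset.range N, 1 / (((k : ℝ) + 1) * (k + 2)) ≤ 1 := by
  have : ∑ k ∈ Finset.range N, 1 / (((k : ℝ) + 1) * (k + 2)) = 1 - 1 / (N + 1) := by
    induction N with
    | zero => simp
    | succ N ih => rw [Finset.sum_range_succ, ih]; push_cast; field_simp; ring
  rw [this]
  have : (0 : ℝ) ≤ 1 / (N + 1) := by positivity
  linarith

theorem sum_two_div_le (N : ℕ) :
    ∑ k ∈ Finset.range N, 2 / (((k : ℝ) + 2) * (k + 3)) ≤ 1 := by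
  have : ∑ k ∈ Finset.range N, 2 / (((k : ℝ) + 2) * (k + 3)) = 1 - 2 / (N + 2) := by
    induction N with
    | zero => simp
    | succ N ih => rw [Finset.sum_range_succ, ih]; push_cast; field_simp; ring
  rw [this]
  have : (0 : ℝ) ≤ 2 / (N + 2) := by positivity
  linarith

variable {δ : ℝ}

/-- The Bernstein exponent depends on the number n of visits, so there is one supermartingale per n
and a union bound, paid for by log(4en(2n+1)) in β^conc. The lower tail is the upper tail for b - f.
-/
theorem measure_not_conc_le (h : Fin H) (s : S) (a : A) [Nonempty A]
    (hδ : δ ∈ Set.Ioo (0 : ℝ) 1) {f : S → ℝ} {b : ℝ} (hf : ∀ x, f x ∈ Set.Icc 0 b) :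
    alg.law s₁ p {ω | ∃ t, visits (Algorithm.firstEpisodes ω t) h s a ≠ 0 ∧
      ¬ |mean (empirical (Algorithm.firstEpisodes ω t) h s a) f - mean (p h s a) f| ≤
        √(2 * variance (p h s a) f *
          (betaConc S A H δ (visits (Algorithm.firstEpisodes ω t) h s a) /
            visits (Algorithm.firstEpisodes ω t) h s a)) +
        b * (betaConc S A H δ (visits (Algorithm.firstEpisodes ω t) h s a) /
            visits (Algorithm.firstEpisodes ω t) h s a) / 3} ≤
      ENNReal.ofReal (Real.exp (-Real.log (4 * size S A H / δ))) := by
  have : Nonempty S := ⟨s⟩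
  have hH : 1 ≤ H := by have := h.2; omega
  set q := p h s a with hq
  -- For b = 0 the function vanishes and nothing can fail; the optimal exponent exists only for b >
  -- 0.
  rcases (le_trans (hf s).1 (hf s).2).eq_or_lt with hb | hb
  · refine le_trans (le_of_eq ?_) zero_le
    convert measure_empty (μ := alg.law s₁ p)
    refine Set.eq_empty_of_forall_notMem ?_
    rintro ω ⟨t, hn, hnot⟩
    apply hnot
    have : f = fun _ => 0 := funext fun x => le_antisymm ((hf x).2.trans_eq hb.symm) (hf x).1
    rw [this, ← hb]
    simp [mean, variance]
  have hβ0 : ∀ k : ℕ, 0 ≤ betaConc S A H δ (k + 1) := fun k =>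
    betaConc_nonneg hH hδ k.succ_ne_zero
  have one_side : ∀ (g : S → ℝ), (∀ x, g x ∈ Set.Icc 0 b) → ∀ k : ℕ, alg.law s₁ p
      {ω | ∃ t, visits (Algorithm.firstEpisodes ω t) h s a = k + 1 ∧
        √(2 * variance q g * (betaConc S A H δ (k + 1) / (k + 1 : ℕ))) +
          b * (betaConc S A H δ (k + 1) / (k + 1 : ℕ)) / 3 <
        mean (empirical (Algorithm.firstEpisodes ω t) h s a) g - mean q g} ≤
      ENNReal.ofReal (Real.exp (-betaConc S A H δ (k + 1))) := by
    intro g hg k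
    obtain ⟨l, ψ, hl, hmean, hβ⟩ := exists_bernstein (p h s a).2 hb hg
      (β := betaConc S A H δ (k + 1) / (k + 1 : ℕ)) (div_nonneg (hβ0 k) (by positivity))
    change _ ≤ l * (√(2 * variance q g * _) + _) - ψ at hβ
    refine (measure_mono ?_).trans (measure_exp_counts_le alg s₁ p h s a
      (g := fun x => l * (g x - mean q g) - ψ) hmean _)
    rintro ω ⟨t, hn, hgt⟩
    refine ⟨t, ?_⟩
    rw [← mean_empirical _ _ _ _ (by omega), hn]
    have hm : mean (empirical (Algorithm.firstEpisodes ω t) h s a)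
        (fun x => l * (g x - mean q g) - ψ) =
        l * (mean (empirical (Algorithm.firstEpisodes ω t) h s a) g - mean q g) - ψ := by
      have hmem := empirical_mem (Algorithm.firstEpisodes ω t) h s a
      rw [mean_sub _ (fun _ => _) (fun _ => ψ), mean_const hmem, mean_const_mul,
        mean_sub _ g (fun _ => _), mean_const hmem]
    rw [hm]
    have hk : (0 : ℝ) < (k + 1 : ℕ) := by positivity
    have h1 := hβ.trans (sub_le_sub_right (mul_le_mul_of_nonneg_left hgt.le hl) ψ)
    rwa [div_le_iff₀' hk] at h1
  refine (measure_mono (t := ⋃ k : ℕ, (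
      {ω | ∃ t, visits (Algorithm.firstEpisodes ω t) h s a = k + 1 ∧
        √(2 * variance q f * (betaConc S A H δ (k + 1) / (k + 1 : ℕ))) +
          b * (betaConc S A H δ (k + 1) / (k + 1 : ℕ)) / 3 <
        mean (empirical (Algorithm.firstEpisodes ω t) h s a) f - mean q f} ∪
      {ω | ∃ t, visits (Algorithm.firstEpisodes ω t) h s a = k + 1 ∧
        √(2 * variance q (fun x => b - f x) * (betaConc S A H δ (k + 1) / (k + 1 : ℕ))) +
          b * (betaConc S A H δ (k + 1) / (k + 1 : ℕ)) / 3 <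
        mean (empirical (Algorithm.firstEpisodes ω t) h s a) (fun x => b - f x) -
          mean q (fun x => b - f x)})) ?_).trans ?_
  · rintro ω ⟨t, hn, hnot⟩
    obtain ⟨k, hk⟩ := Nat.exists_eq_succ_of_ne_zero hn
    rw [Nat.succ_eq_add_one] at hk
    refine Set.mem_iUnion.2 ⟨k, ?_⟩
    rw [hk] at hnot
    rw [not_le, lt_abs] at hnot
    rcases hnot with hnot | hnot
    · exact Or.inl ⟨t, hk, hnot⟩
    · refine Or.inr ⟨t, hk, ?_⟩
      have e1 : variance q (fun x => b - f x) = variance q f := by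
        rw [show (fun x => b - f x) = fun x => - f x + b from funext fun x => by ring]
        exact (variance_add_const (p h s a).2 _ b).trans (variance_neg _ f)
      rw [e1, mean_sub _ (fun _ => b), mean_sub _ (fun _ => b), mean_const_apply,
        mean_const (empirical_mem _ h s a)]
      linarith
  · refine measure_iUnion_le_of_sum _ (c := fun k => 1 / (((k : ℝ) + 1) * (k + 2)))
      (Real.exp_pos _).le (fun k => by positivity) (fun k => ?_) sum_one_div_le
    refine (measure_union_le _ _).trans ((add_le_add (one_side f hf k)
      (one_side (fun x => b - f x) (fun x => ⟨sub_nonneg.2 (hf x).2, by linarith [(hf x).1]⟩)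
        k)).trans ?_)
    rw [← ENNReal.ofReal_add (Real.exp_pos _).le (Real.exp_pos _).le]
    refine ENNReal.ofReal_le_ofReal ?_
    rw [betaConc, neg_add, Real.exp_add, Real.exp_neg (Real.log (4 * Real.exp 1 * _ * _)),
      Real.exp_log (by positivity), ← two_mul, mul_left_comm]
    refine mul_le_mul_of_nonneg_left ?_ (Real.exp_pos _).le
    -- Two tails at n = k + 1 cost 2/(4en(2n+1)) ≤ 1/(n(n+1)), which telescopes to at most 1.
    rw [← div_eq_mul_inv, div_le_div_iff₀ (by positivity) (by positivity)]
    push_cast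
    have he := Real.add_one_le_exp 1
    have hk : (0 : ℝ) ≤ k := by positivity
    nlinarith [mul_le_mul_of_nonneg_right he
      (by positivity : 0 ≤ ((k : ℝ) + 1) * (2 * (k + 1) + 1)), mul_nonneg hk hk]

theorem abs_iidMean_countEntropy_sub_le [Nonempty S] [Nonempty A] [DecidableEq S] {q : S → ℝ}
    (hH : 1 ≤ H) (hδ : δ ∈ Set.Ioo (0 : ℝ) 1)
    (hq : q ∈ stdSimplex ℝ S) {n : ℕ} (hn : n ≠ 0) :
    |iidMean q (countEntropy n) n 0 - entropy q| ≤
      min (betaKL S A H δ n / n) (Real.log (Fintype.card S)) := by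
  have h1 := iidMean_countEntropy_le hq hn
  have h2 := entropy_sub_le_iidMean hq hn
  have hn0 : (0 : ℝ) < n := by exact_mod_cast Nat.pos_of_ne_zero hn
  have h3 : 0 ≤ iidMean q (countEntropy n) n 0 := by
    rw [← iidMean_const hq 0 n 0]
    exact iidMean_mono hq.1 (fun m hm _ => countEntropy_nonneg hm) n 0 (by simp) (by simp)
  rw [abs_of_nonpos (by linarith), neg_sub]
  refine le_min ?_ (by linarith [entropy_le_log_card hq])
  have h4 : (Fintype.card S - 1 : ℝ) / n ≤ betaKL S A H δ n / n := by
    refine div_le_div_of_nonneg_right ?_ hn0.le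
    have h5 := one_le_logSize (S := S) (A := A) hH hδ
    have h6 := log_one_add_nonneg n
    unfold betaKL
    rw [log_exp_one_mul]
    nlinarith [(Fintype.card S).cast_nonneg (α := ℝ)]
  linarith

theorem log_card_le_betaKL [Nonempty S] [Nonempty A] (hH : 1 ≤ H) (hδ : δ ∈ Set.Ioo (0 : ℝ) 1)
    (n : ℕ) : Real.log (Fintype.card S) ≤ betaKL S A H δ n := by
  have h1 := Real.log_le_sub_one_of_pos (x := (Fintype.card S : ℝ))
    (by exact_mod_cast Fintype.card_pos)
  have h2 := mul_nonneg ((Fintype.card S).cast_nonneg (α := ℝ)) (log_one_add_nonneg n)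
  have h3 := one_le_logSize (S := S) (A := A) hH hδ
  rw [betaKL, log_exp_one_mul, mul_add]
  linarith

/-- The deviation splits into a fluctuation, controlled by McDiarmid's inequality and the square
root in the bonus, and a bias, controlled by the minimum. For n = 1 the square root vanishes because
log 1 = 0, but the minimum equals log S and suffices by itself; the union bound therefore starts at
n = 2. -/
theorem measure_not_ent_le (h : Fin H) (s : S) (a : A) [Nonempty A]
    (hδ : δ ∈ Set.Ioo (0 : ℝ) 1) :
    alg.law s₁ p {ω | ∃ t, visits (Algorithm.firstEpisodes ω t) h s a ≠ 0 ∧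
      ¬ |entropy (empirical (Algorithm.firstEpisodes ω t) h s a) - entropy (p h s a)| ≤
        bonusEnt δ (Algorithm.firstEpisodes ω t) h s a} ≤
      ENNReal.ofReal (Real.exp (-Real.log (4 * size S A H / δ))) := by
  classical
  have : Nonempty S := ⟨s⟩
  have hH : 1 ≤ H := by have := h.2; omega
  set q := p h s a with hq
  set ℓ := Real.log (4 * size S A H / δ) with hℓ
  have hℓ1 : 1 ≤ ℓ := one_le_logSize hH hδ
  let w : ℕ → ℝ := fun k => √(2 * betaEnt S A H δ (k + 2) / (k + 2 : ℕ))
  let E : ℕ → Set (ℕ → Episode S A H) := fun k =>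
    {ω | ∃ t, visits (Algorithm.firstEpisodes ω t) h s a = k + 2 ∧
      w k < |countEntropy (k + 2) (transits (Algorithm.firstEpisodes ω t) h s a) -
        iidMean q (countEntropy (k + 2)) (k + 2) 0|}
  have hE : ∀ k, alg.law s₁ p (E k) ≤
      ENNReal.ofReal (Real.exp (-ℓ) * (2 / (((k : ℝ) + 2) * (k + 3)))) := by
    intro k
    set n := k + 2 with hn
    have hn2 : (2 : ℝ) ≤ n := by rw [hn]; push_cast; linarith [k.cast_nonneg (α := ℝ)]
    have hlog : 0 < Real.log n := Real.log_pos (by linarith)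
    set c := 2 * Real.log n / n with hc
    have hc0 : 0 < c := by positivity
    set β := ℓ + Real.log ((n : ℝ) * (n + 1)) with hβ
    have hβ0 : 0 ≤ β := add_nonneg (by linarith) (Real.log_nonneg (by nlinarith))
    have hbE : betaEnt S A H δ n = Real.log n ^ 2 * β := rfl
    have hw2 : w k ^ 2 = 2 * (Real.log n ^ 2 * β) / n := by
      change √(2 * betaEnt S A H δ n / n) ^ 2 = _
      rw [hbE, Real.sq_sqrt (by positivity)]
    have hw0 : 0 ≤ w k := Real.sqrt_nonneg _
    -- The maximizer of θ w - n θ² c²/8; the maximum 2w²/(n c²) is exactly β.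
    set θ := 4 * w k / (n * c ^ 2) with hθ
    have hθ0 : 0 ≤ θ := by positivity
    have hopt : θ * w k - n * (θ ^ 2 * c ^ 2 / 8) = β := by
      have : θ * w k - n * (θ ^ 2 * c ^ 2 / 8) = 2 * w k ^ 2 / (n * c ^ 2) := by
        rw [hθ]; field_simp; ring
      rw [this, hw2, hc]
      field_simp
    have hosc : ∀ m : S → ℕ, ∑ x, m x = n - 1 → ∀ x y,
        countEntropy n (m + Pi.single x 1) - countEntropy n (m + Pi.single y 1) ≤ c :=
      fun m hm x y => by convert countEntropy_osc (by omega) hm x y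
    have h1 := measure_mcdiarmid_le alg s₁ p h s a hosc θ β
    have h2 := measure_mcdiarmid_le alg s₁ p h s a hosc (-θ) β
    refine (measure_mono ?_).trans ((measure_union_le _ _).trans ((add_le_add h1 h2).trans ?_))
    · rintro ω ⟨t, hv, hlt⟩
      rcases lt_abs.1 hlt with hlt | hlt
      · refine Or.inl ⟨t, hv, ?_⟩
        have := mul_le_mul_of_nonneg_left hlt.le hθ0
        linarith
      · refine Or.inr ⟨t, hv, ?_⟩
        have := mul_le_mul_of_nonneg_left hlt.le hθ0
        rw [neg_sq]
        change β ≤ -θ * (countEntropy n _ - iidMean q (countEntropy n) n 0) - _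
        linarith
    · rw [← ENNReal.ofReal_add (Real.exp_pos _).le (Real.exp_pos _).le]
      refine ENNReal.ofReal_le_ofReal (le_of_eq ?_)
      rw [hβ, neg_add, Real.exp_add, Real.exp_neg (Real.log ((n : ℝ) * (n + 1))),
        Real.exp_log (by positivity), hn]
      push_cast
      field_simp
      ring
  refine (measure_mono (t := ⋃ k, E k) ?_).trans (measure_iUnion_le_of_sum _ (Real.exp_pos _).le
    (fun k => by positivity) hE sum_two_div_le)
  rintro ω ⟨t, hn, hnot⟩
  set D := Algorithm.firstEpisodes ω t
  have hemp : empirical D h s a = fun x => (transits D h s a x : ℝ) / visits D h s a := by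
    funext x; rw [empirical, if_neg hn]
  have hbias := abs_iidMean_countEntropy_sub_le (A := A) hH hδ (p h s a).2 hn
  change |iidMean q (countEntropy _) _ 0 - entropy q| ≤ _ at hbias
  by_cases h1 : visits D h s a = 1
  · exfalso
    apply hnot
    have e1 := entropy_nonneg (empirical_mem D h s a)
    have e2 := entropy_le_log_card (empirical_mem D h s a)
    have e3 : 0 ≤ entropy q := entropy_nonneg (p h s a).2
    have e4 : entropy q ≤ _ := entropy_le_log_card (p h s a).2
    have e5 : Real.log (Fintype.card S) ≤ betaKL S A H δ (visits D h s a) / visits D h s a := by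
      rw [h1]
      rw [Nat.cast_one, div_one]
      exact log_card_le_betaKL hH hδ 1
    rw [bonusEnt, min_eq_right e5]
    refine le_trans ?_ (le_add_of_nonneg_left (Real.sqrt_nonneg _))
    rw [abs_le]
    constructor <;> linarith
  · refine Set.mem_iUnion.2 ⟨visits D h s a - 2, t, by change visits D h s a = _; omega, ?_⟩
    have e : visits D h s a - 2 + 2 = visits D h s a := by omega
    by_contra hle
    apply hnot
    rw [not_lt] at hle
    simp only [w] at hle
    rw [e] at hle
    rw [bonusEnt]
    refine (abs_sub_le _ (iidMean q (countEntropy (visits D h s a)) (visits D h s a) 0) _).trans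
      (add_le_add ?_ hbias)
    rw [hemp]
    exact hle

/-- The expected numbers of visits under the policies played so far. -/
def expVisits (h : Fin H) (s : S) (a : A) : ∀ t, Data S A H t → ℝ
  | 0, _ => 0
  | t + 1, D => expVisits h s a t (Fin.init D) +
      occupancy s₁ p (alg.policy (t := t) (Fin.init D)) h s a

theorem expVisits_nonneg (h : Fin H) (s : S) (a : A) (t : ℕ) (D : Data S A H t) :
    0 ≤ expVisits alg s₁ p h s a t D := by
  induction t with
  | zero => exact le_rfl
  | succ t ih => exact add_nonneg (ih _) (occupancy_nonneg ..)

/-- With r = 1 - 1/e, a visit of probability o satisfies E[e^{-1_visit}] = 1 - r o ≤ e^{-r o}, so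
exp(r · expected visits - visits) is a supermartingale; r ≥ 1/2 gives the factor one half. -/
theorem measure_not_count_le (h : Fin H) (s : S) (a : A) (b : ℝ) :
    alg.law s₁ p {ω | ∃ t, visits (Algorithm.firstEpisodes ω t) h s a + b <
      expVisits alg s₁ p h s a t (Algorithm.firstEpisodes ω t) / 2} ≤
      ENNReal.ofReal (Real.exp (-b)) := by
  classical
  set r : ℝ := 1 - Real.exp (-1) with hr
  have hM : IsSupermartingale alg s₁ p fun t D => ENNReal.ofReal (Real.exp
      (r * expVisits alg s₁ p h s a t D - visits D h s a)) := by
    intro t D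
    set π := alg.policy D
    set o := occupancy s₁ p π h s a with ho
    set x := r * expVisits alg s₁ p h s a t D - visits D h s a with hx
    have h1 : ∀ e : Episode S A H, ENNReal.ofReal (episodeProb s₁ p π e) * ENNReal.ofReal (Real.exp
        (r * expVisits alg s₁ p h s a (t + 1) (Fin.snoc D e) -
          visits (Fin.snoc D e : Data S A H (t + 1)) h s a)) =
        ENNReal.ofReal (episodeProb s₁ p π e * (Real.exp (x + r * o) *
          (1 - r * if e.state h = s ∧ e.action h = a then 1 else 0))) := by
      intro e
      rw [← ENNReal.ofReal_mul (episodeProb_nonneg ..)]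
      congr 2
      rw [expVisits, visits_snoc, Fin.init_snoc]
      change Real.exp (r * (_ + o) - _) = _
      split_ifs
      · rw [show 1 - r * 1 = Real.exp (-1) by rw [hr]; ring, ← Real.exp_add]
        congr 1; push_cast; rw [hx]; ring
      · rw [mul_zero, sub_zero, mul_one]
        congr 1; push_cast; rw [hx]; ring
    simp only [h1]
    have hr1 : 0 ≤ 1 - r := by rw [hr]; simp [(Real.exp_pos _).le]
    rw [← ENNReal.ofReal_sum_of_nonneg fun e _ => mul_nonneg (episodeProb_nonneg ..)
      (mul_nonneg (Real.exp_pos _).le (by split_ifs <;> simp; linarith))]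
    refine ENNReal.ofReal_le_ofReal ?_
    change mean (episodeProb s₁ p π) (fun e => Real.exp (x + r * o) *
      (1 - r * if e.state h = s ∧ e.action h = a then 1 else 0)) ≤ _
    rw [mean_const_mul, mean_sub _ (fun _ => 1), mean_const (episodeProb_mem s₁ p π),
      mean_const_mul]
    change _ * (1 - r * o) ≤ _
    calc _ ≤ Real.exp (x + r * o) * Real.exp (-(r * o)) := by
          refine mul_le_mul_of_nonneg_left ?_ (Real.exp_pos _).le
          linarith [Real.add_one_le_exp (-(r * o))]
      _ = Real.exp x := by rw [← Real.exp_add]; congr 1; ring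
  have := hM.measure_le alg s₁ p (c := ENNReal.ofReal (Real.exp b)) (fun D => by
    simp [expVisits]) (by simp [Real.exp_pos]) ENNReal.ofReal_ne_top
  rw [← ENNReal.ofReal_inv_of_pos (Real.exp_pos b), ← Real.exp_neg] at this
  refine (measure_mono ?_).trans this
  rintro ω ⟨t, ht⟩
  refine ⟨t, ENNReal.ofReal_le_ofReal (Real.exp_le_exp.2 ?_)⟩
  have hr2 : 1 / 2 ≤ r := by
    have h2 : Real.exp (-1) * Real.exp 1 = 1 := by rw [← Real.exp_add]; simp
    have := Real.add_one_le_exp 1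
    rw [hr]
    nlinarith [Real.exp_pos (-1)]
  have := mul_le_mul_of_nonneg_right hr2
    (expVisits_nonneg alg s₁ p h s a t (Algorithm.firstEpisodes ω t))
  linarith

/-- All confidence regions hold after every number of episodes. -/
def goodEvent [Nonempty A] (P : Problem S A H) (δ : ℝ) : Set (ℕ → Episode S A H) :=
  {ω | ∀ t, Confident P p δ (Algorithm.firstEpisodes ω t) ∧ ∀ h s a,
    expVisits alg P.start p h s a t (Algorithm.firstEpisodes ω t) / 2 ≤
      visits (Algorithm.firstEpisodes ω t) h s a + Real.log (4 * size S A H / δ)}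

/-- Four failure events for each of the SAH triples, each of probability at most exp(-log(4SAH/δ)) =
δ/(4SAH). -/
theorem le_measure_goodEvent [Nonempty A] (P : Problem S A H) (hH : 1 ≤ H)
    (hδ : δ ∈ Set.Ioo (0 : ℝ) 1) :
    ENNReal.ofReal (1 - δ) ≤ alg.law P.start p (goodEvent alg p P δ) := by
  have : Nonempty S := ⟨P.start⟩
  set μ := alg.law P.start p
  set d := ENNReal.ofReal (Real.exp (-Real.log (4 * size S A H / δ))) with hd
  have hcompl : μ (goodEvent alg p P δ)ᶜ ≤ ENNReal.ofReal δ := by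
    refine (measure_mono (t := ⋃ i : Fin H × S × A,
      ({ω | ∃ t, visits (Algorithm.firstEpisodes ω t) i.1 i.2.1 i.2.2 ≠ 0 ∧
        ¬ KLBound (empirical (Algorithm.firstEpisodes ω t) i.1 i.2.1 i.2.2) (p i.1 i.2.1 i.2.2)
        (betaKL S A H δ (visits (Algorithm.firstEpisodes ω t) i.1 i.2.1 i.2.2) /
          visits (Algorithm.firstEpisodes ω t) i.1 i.2.1 i.2.2)} ∪
      {ω | ∃ t, visits (Algorithm.firstEpisodes ω t) i.1 i.2.1 i.2.2 ≠ 0 ∧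
        ¬ |mean (empirical (Algorithm.firstEpisodes ω t) i.1 i.2.1 i.2.2) (P.optV p i.1.succ) -
          mean (p i.1 i.2.1 i.2.2) (P.optV p i.1.succ)| ≤
        √(2 * variance (p i.1 i.2.1 i.2.2) (P.optV p i.1.succ) *
          (betaConc S A H δ (visits (Algorithm.firstEpisodes ω t) i.1 i.2.1 i.2.2) /
            visits (Algorithm.firstEpisodes ω t) i.1 i.2.1 i.2.2)) +
        H * P.Rmax * (betaConc S A H δ (visits (Algorithm.firstEpisodes ω t) i.1 i.2.1 i.2.2) /
            visits (Algorithm.firstEpisodes ω t) i.1 i.2.1 i.2.2) / 3} ∪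
      {ω | ∃ t, visits (Algorithm.firstEpisodes ω t) i.1 i.2.1 i.2.2 ≠ 0 ∧
        ¬ |entropy (empirical (Algorithm.firstEpisodes ω t) i.1 i.2.1 i.2.2) -
          entropy (p i.1 i.2.1 i.2.2)| ≤
        bonusEnt δ (Algorithm.firstEpisodes ω t) i.1 i.2.1 i.2.2} ∪
      {ω | ∃ t, visits (Algorithm.firstEpisodes ω t) i.1 i.2.1 i.2.2 +
        Real.log (4 * size S A H / δ) <
        expVisits alg P.start p i.1 i.2.1 i.2.2 t (Algorithm.firstEpisodes ω t) / 2})) ?_).trans ?_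
    · intro ω hω
      by_contra hnot
      apply hω
      simp only [Set.mem_iUnion, Set.mem_union, Set.mem_ofPred_eq, not_exists, not_or, not_and,
        not_not, not_lt, Prod.forall] at hnot
      exact fun t => ⟨⟨fun h s a => (hnot h s a).1.1.1 t, fun h s a => (hnot h s a).1.1.2 t,
        fun h s a => (hnot h s a).1.2 t⟩, fun h s a => (hnot h s a).2 t⟩
    · have hi : ∀ i : Fin H × S × A, _ := fun i =>
        (measure_union_le (μ := μ) _ _).trans (add_le_add ((measure_union_le _ _).trans (add_le_add
          ((measure_union_le _ _).trans (add_le_add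
            (measure_not_klBound_le alg P.start p (δ := δ) i.1 i.2.1 i.2.2)
            (measure_not_conc_le alg P.start p i.1 i.2.1 i.2.2 hδ (f := P.optV p i.1.succ)
              (b := H * P.Rmax) fun x => ⟨P.optV_nonneg p _ x, P.optV_le_mul hH p _ x⟩)))
          (measure_not_ent_le alg P.start p i.1 i.2.1 i.2.2 hδ)))
          (measure_not_count_le alg P.start p i.1 i.2.1 i.2.2 (Real.log (4 * size S A H / δ))))
      refine (measure_iUnion_fintype_le _ _).trans ((Finset.sum_le_sum fun i _ => hi i).trans ?_)
      have hs := one_le_size (S := S) (A := A) hH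
      have hs0 : 0 < size S A H := by linarith
      rw [Finset.sum_const, Finset.card_univ, Fintype.card_prod, Fintype.card_prod,
        Fintype.card_fin, Real.exp_neg, Real.exp_log (by have := hδ.1; positivity),
        ← ENNReal.ofReal_add (by have := hδ.1; positivity) (by have := hδ.1; positivity),
        ← ENNReal.ofReal_add (by have := hδ.1; positivity) (by have := hδ.1; positivity),
        ← ENNReal.ofReal_add (by have := hδ.1; positivity) (by have := hδ.1; positivity),
        ← ENNReal.ofReal_nsmul, nsmul_eq_mul]
      refine ENNReal.ofReal_le_ofReal (le_of_eq ?_)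
      have e : ((H * (Fintype.card S * Fintype.card A) : ℕ) : ℝ) = size S A H := by
        rw [size]; push_cast; ring
      rw [e, inv_div]
      field_simp
      ring
  -- Subadditivity suffices to pass to the complement, so measurability of the event is not needed.
  have huniv : 1 ≤ μ (goodEvent alg p P δ) + μ (goodEvent alg p P δ)ᶜ := by
    rw [← measure_univ (μ := μ), ← Set.union_compl_self (goodEvent alg p P δ)]
    exact measure_union_le _ _
  rw [ENNReal.ofReal_sub _ hδ.1.le, ENNReal.ofReal_one, tsub_le_iff_right]
  exact huniv.trans (add_le_add le_rfl hcompl)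

end Concentration

/-! ### The law of total variance along an episode -/

section TotalVariance

variable {S A : Type*} [Fintype S] [Fintype A] [Nonempty A] {H : ℕ}

theorem evalV_one (p : Transitions S A H) (π : Policy S A H) (h : Fin (H + 1)) :
    ∀ s, evalV p π (fun _ _ _ => 1) h s = (H : ℝ) - (h : ℕ) := by
  induction h using Fin.reverseInduction with
  | last => intro s; rw [evalV_last]; simp
  | cast h ih =>
    intro s
    have : evalV p π (fun _ _ _ => 1) h.succ = fun _ => (H : ℝ) - (h.succ : ℕ) := funext ih
    rw [evalV_castSucc, this]
    simp only [mean_const_apply, Fin.val_succ, Fin.val_castSucc]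
    push_cast
    ring

theorem mean_sub_sq_le {X : Type*} [Fintype X] {q : X → ℝ} (hq : q ∈ stdSimplex ℝ X) (y : X → ℝ)
    (B : ℝ) : mean q (fun x => 2 * B * y x - y x ^ 2) ≤ 2 * B * mean q y - mean q y ^ 2 := by
  have := variance_nonneg hq.1 y
  rw [variance_eq hq] at this
  rw [mean_sub q (fun x => 2 * B * y x), mean_const_mul]
  linarith

/-- The total variance of the value functions along an episode. -/
theorem evalV_variance_le (hH : 1 ≤ H) (P : Problem S A H) (p : Transitions S A H)
    (π : Policy S A H) (h : Fin (H + 1)) :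
    ∀ s, evalV p π (fun h s a => variance (p h s a) (P.polV p π h.succ)) h s ≤
      2 * (H * P.Rmax) * P.polV p π h s - P.polV p π h s ^ 2 := by
  induction h using Fin.reverseInduction with
  | last => intro s; rw [evalV_last, P.polV_last]; simp
  | cast h ih =>
    intro s
    rw [evalV_castSucc]
    set B := H * P.Rmax
    set V := P.polV p π h.succ with hV
    set y : A → ℝ := fun a => mean (p h s a) V with hy
    -- The potential 2BV - V² makes the induction close: the second moment p V² in the variance
    -- cancels against the induction hypothesis and leaves the concave function 2By - y² of y = p V.
    -- Jensen's inequality over actions and its monotonicity on [0, B] finish, as all regularized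
    -- rewards are nonnegative and hence π y ≤ V_h ≤ B.
    have h1 : ∀ a, variance (p h s a) V + mean (p h s a)
        (evalV p π (fun h s a => variance (p h s a) (P.polV p π h.succ)) h.succ) ≤
        2 * B * y a - y a ^ 2 := by
      intro a
      have e1 : variance (p h s a) V = mean (p h s a) (fun x => V x ^ 2) - y a ^ 2 :=
        variance_eq (p h s a).2 V
      have e2 := mean_mono (p h s a).2.1 ih
      have e3 : mean (p h s a) (fun x => 2 * B * V x - V x ^ 2) =
          2 * B * y a - mean (p h s a) (fun x => V x ^ 2) := by
        rw [mean_sub _ (fun x => 2 * B * V x), mean_const_mul]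
      change mean (p h s a) _ ≤ mean (p h s a) _ at e2
      rw [e3] at e2
      linarith
    have h2 : mean (π h s) y ≤ P.polV p π h.castSucc s := by
      rw [P.polV_castSucc]
      have e1 : mean (π h s) y ≤ mean (π h s) (P.bellmanQ p V h s) :=
        mean_mono (π h s).2.1 fun a => le_add_of_nonneg_left (P.augReward_nonneg p h s a)
      have e2 := mul_nonneg P.lam_pos.le (neg_nonneg.2 (P.Φ_apply_nonpos (π h s)))
      linarith
    have h3 : P.polV p π h.castSucc s ≤ B :=
      (P.polV_le_optV p π _ s).trans (P.optV_le_mul hH p _ s)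
    refine (mean_mono (π h s).2.1 h1).trans ((mean_sub_sq_le (π h s).2 y B).trans ?_)
    change 2 * B * mean (π h s) y - mean (π h s) y ^ 2 ≤ _
    nlinarith [mul_nonneg (sub_nonneg.2 h2) (sub_nonneg.2 (h2.trans h3)),
      mul_nonneg (sub_nonneg.2 h2) (sub_nonneg.2 h3)]

theorem sum_occupancy_mul_variance_le (hH : 1 ≤ H) (P : Problem S A H) (p : Transitions S A H)
    (π : Policy S A H) :
    ∑ h, ∑ s, ∑ a, occupancy P.start p π h s a * variance (p h s a) (P.polV p π h.succ) ≤
      (H * P.Rmax) ^ 2 := by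
  rw [sum_occupancy_mul P.start p π fun h s a => variance (p h s a) (P.polV p π h.succ)]
  refine (evalV_variance_le hH P p π 0 P.start).trans ?_
  nlinarith [sq_nonneg (H * P.Rmax - P.polV p π 0 P.start)]

theorem sum_occupancy (s₁ : S) (p : Transitions S A H) (π : Policy S A H) :
    ∑ h, ∑ s, ∑ a, occupancy s₁ p π h s a = H := by
  have := sum_occupancy_mul s₁ p π fun _ _ _ => 1
  rw [evalV_one] at this
  simpa using this

end TotalVariance

/-! ### Pigeonhole bounds for the expected visits -/

section Pigeonhole

/-- The partial sum agrees with N until N reaches b, and the step that crosses b overshoots by at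
most 1. -/
theorem sum_lt_le {o N : ℕ → ℝ} (ho : ∀ t, o t ∈ Set.Icc 0 1) (h0 : N 0 = 0)
    (hN : ∀ t, N (t + 1) = N t + o t) {b : ℝ} (hb : 0 ≤ b) (T : ℕ) :
    ∑ t ∈ Finset.range T, (if N t < b then o t else 0) ≤ b + 1 := by
  have key : ∑ t ∈ Finset.range T, (if N t < b then o t else 0) ≤ min (N T) (b + 1) := by
    induction T with
    | zero => simp only [Finset.range_zero, Finset.sum_empty, h0]; positivity
    | succ T ih =>
      rw [Finset.sum_range_succ, hN]
      have := (ho T).1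
      have := (ho T).2
      split_ifs with h
      · rw [min_eq_left (by linarith)] at ih ⊢
        linarith
      · rw [add_zero]
        exact ih.trans (min_le_min (by linarith) le_rfl)
  exact key.trans (min_le_right _ _)

theorem expected_le {o N : ℕ → ℝ} (ho : ∀ t, o t ∈ Set.Icc 0 1) (h0 : N 0 = 0)
    (hN : ∀ t, N (t + 1) = N t + o t) (T : ℕ) : N T ≤ T := by
  induction T with
  | zero => simp [h0]
  | succ T ih => rw [hN]; push_cast; linarith [(ho T).2]

/-- As o ≤ 1 ≤ N, one step at most doubles N, so o/N is at most twice the increment of log N. -/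
theorem sum_div_le {o N : ℕ → ℝ} (ho : ∀ t, o t ∈ Set.Icc 0 1) (h0 : N 0 = 0)
    (hN : ∀ t, N (t + 1) = N t + o t) {b : ℝ} (hb : 1 ≤ b) (T : ℕ) :
    ∑ t ∈ Finset.range T, (if N t < b then 0 else o t / N t) ≤ 2 * Real.log (1 + T) := by
  have key : ∑ t ∈ Finset.range T, (if N t < b then 0 else o t / N t) ≤
      2 * Real.log (max (N T) 1) := by
    induction T with
    | zero => simp [h0]
    | succ T ih =>
      rw [Finset.sum_range_succ, hN]
      have ho0 := (ho T).1
      have ho1 := (ho T).2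
      split_ifs with h
      · rw [add_zero]
        refine ih.trans (mul_le_mul_of_nonneg_left ?_ zero_le_two)
        exact Real.log_le_log (by positivity) (max_le_max (by linarith) le_rfl)
      · have h1 : 1 ≤ N T := hb.trans (not_lt.1 h)
        rw [max_eq_left h1] at ih
        rw [max_eq_left (by linarith)]
        have h2 := Real.one_sub_inv_le_log_of_pos (x := (N T + o T) / N T) (by positivity)
        rw [Real.log_div (by positivity) (by positivity), inv_div] at h2
        have h3 : o T / N T ≤ 2 * (1 - N T / (N T + o T)) := by
          have : 1 - N T / (N T + o T) = o T / (N T + o T) := by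
            have : N T + o T ≠ 0 := by positivity
            field_simp
            ring
          rw [this, ← mul_div_assoc, div_le_div_iff₀ (by positivity) (by positivity)]
          nlinarith
        linarith
  refine key.trans (mul_le_mul_of_nonneg_left ?_ zero_le_two)
  refine Real.log_le_log (by positivity) (max_le ?_ ?_)
  · linarith [expected_le ho h0 hN T]
  · linarith [T.cast_nonneg (α := ℝ)]

end Pigeonhole

/-! ### The gap recursion with true transitions and variances -/

section OneStep

/-- Passing from the empirical variance of the upper bound `g` to the true variance of `f`. -/
theorem bonus_transfer {X : Type*} [Fintype X] {q p f g W : X → ℝ} {k c H R : ℝ}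
    (hp : p ∈ stdSimplex ℝ X) (hq : q ∈ stdSimplex ℝ X) (h : KLBound q p k) (hk : 0 ≤ k)
    (hc : 0 ≤ c) (hck : c ≤ 2 * k) (hH : 1 ≤ H) (hR : 0 ≤ R)
    (hf : ∀ x, f x ∈ Set.Icc 0 (H * R)) (hfg : ∀ x, 0 ≤ g x - f x) (hgW : ∀ x, g x - f x ≤ W x)
    (hW : ∀ x, W x ≤ H * R) :
    2 * (3 * √(variance q g * c) + 9 * (H ^ 2 * R * k)) + 4 * (H ^ 2 * R * k) +
      (1 + 3 / H) * mean q W ≤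
      12 * √(variance p f * c) + 75 * (H ^ 2 * R * k) + (1 + 9 / H) * mean p W := by
  have hH0 : 0 < H := by linarith
  have hW0 : ∀ x, 0 ≤ W x := fun x => (hfg x).trans (hgW x)
  set M := mean q W with hM
  have hM0 : 0 ≤ M := mean_nonneg hq.1 hW0
  have hPW : 0 ≤ mean p W := mean_nonneg hp.1 hW0
  have hVp := variance_nonneg hp.1 f
  have h1 := h.variance_le hp hq hf
  have h2 := variance_le_two_mul hq g f
  have h3 : variance q (fun x => g x - f x) ≤ H * R * M :=
    (variance_le_mul_mean hq hfg fun x => (hgW x).trans (hW x)).trans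
      (mul_le_mul_of_nonneg_left (mean_mono hq.1 hgW) (by positivity))
  have e1 : variance q g * c ≤ (2 ^ 2 * (variance p f * c) + 2 * (H * R) ^ 2 * k * c) +
      2 * (H * R * M * c) := by
    have : variance q g ≤ 4 * variance p f + 2 * (H * R) ^ 2 * k + 2 * (H * R * M) := by linarith
    nlinarith
  have hX : 0 ≤ H * R := by positivity
  have e2 : √(2 ^ 2 * (variance p f * c)) = 2 * √(variance p f * c) := by
    rw [Real.sqrt_mul (by norm_num), Real.sqrt_sq (by norm_num)]
  have e3 : √(2 * (H * R) ^ 2 * k * c) ≤ 2 * (H * R * k) := by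
    rw [Real.sqrt_le_left (by positivity)]
    have := mul_le_mul_of_nonneg_left hck (by positivity : 0 ≤ 2 * (H * R) ^ 2 * k)
    nlinarith
  -- The arithmetic-geometric inequality again turns the cross term into M/H plus a lower-order
  -- term; this raises the factor 1 + 3/H to 1 + 4/H.
  have e4 : 6 * √(2 * (H * R * M * c)) ≤ M / H + 18 * (H ^ 2 * R * c) := by
    have e : 3 ^ 2 * (2 * (H * R * M * c)) = M / H * (18 * (H ^ 2 * R * c)) := by
      field_simp; ring
    have e' : 3 * √(2 * (H * R * M * c)) = √(3 ^ 2 * (2 * (H * R * M * c))) := by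
      rw [Real.sqrt_mul (by norm_num : (0 : ℝ) ≤ 3 ^ 2) (2 * (H * R * M * c)),
        Real.sqrt_sq (by norm_num)]
    have := sqrt_mul_le_add (a := M / H) (b := 18 * (H ^ 2 * R * c)) (by positivity)
      (by positivity)
    rw [← e, ← e'] at this
    linarith
  have e5 := Real.sqrt_le_sqrt e1
  have e6 := sqrt_add_le (2 ^ 2 * (variance p f * c) + 2 * (H * R) ^ 2 * k * c)
    (2 * (H * R * M * c)) (by positivity) (by positivity)
  have e7 := sqrt_add_le (2 ^ 2 * (variance p f * c)) (2 * (H * R) ^ 2 * k * c)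
    (by positivity) (by positivity)
  have e8 : H * R * k ≤ H ^ 2 * R * k := by
    have := mul_le_mul_of_nonneg_left hH (by positivity : 0 ≤ H * R * k)
    nlinarith
  have e9 : H ^ 2 * R * c ≤ 2 * (H ^ 2 * R * k) := by
    have := mul_le_mul_of_nonneg_left hck (by positivity : 0 ≤ H ^ 2 * R)
    linarith
  have hθ : 1 / H ≤ 1 := by rw [div_le_one hH0]; exact hH
  have hqW := h.mean_le hp hW0 hW hX (θ := 1 / H) (by positivity) hθ
  have e10 : H * R * k / (1 / H) = H ^ 2 * R * k := by field_simp
  rw [e10] at hqW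
  change M ≤ _ at hqW
  have hY : 0 ≤ H ^ 2 * R * k := by positivity
  -- (1 + 4/H)(1 + 1/H) ≤ 1 + 9/H. The 75 in the conclusion is 18 + 4 from the gap itself, 12 and 36
  -- from the two roots, and 5 from this step.
  have e11 : (1 + 4 / H) * M ≤ (1 + 9 / H) * mean p W + 5 * (H ^ 2 * R * k) := by
    have i0 : 0 ≤ 1 / H := by positivity
    have j1 := mul_le_mul_of_nonneg_left hqW (by positivity : 0 ≤ 1 + 4 * (1 / H))
    have j2 := mul_le_mul_of_nonneg_right hθ (mul_nonneg i0 hPW)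
    have j3 := mul_le_mul_of_nonneg_right hθ hY
    rw [show 1 + 4 / H = 1 + 4 * (1 / H) by ring, show 1 + 9 / H = 1 + 9 * (1 / H) by ring]
    nlinarith
  have e12 : (1 + 4 / H) * M = (1 + 3 / H) * M + M / H := by ring
  linarith

variable {S A : Type*} [Fintype S] [Fintype A] [Nonempty A] {H t : ℕ}
  {P : Problem S A H} {p : Transitions S A H} {δ : ℝ} {D : Data S A H t}

/-- The bonus contains the empirical variance of the upper bound. Since the gap dominates upper
bound minus V^π, that variance can be traded for the true variance of V^π, to which the law of total
variance applies. -/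
theorem Confident.gapQ_le (hD : Confident P p δ D) (hH : 1 ≤ H) (hδ : δ ∈ Set.Ioo (0 : ℝ) 1)
    (h : Fin H) (s : S) (a : A) (hn : visits D h s a ≠ 0) :
    gapQ P δ D (gapV P δ D h.succ) h s a ≤
      12 * √(variance (p h s a) (P.polV p (optimisticPolicy P δ D) h.succ) *
        (betaConc S A H δ (visits D h s a) / visits D h s a)) +
      2 * P.kap * √(2 * betaEnt S A H δ (visits D h s a) / visits D h s a) +
      (75 * (H ^ 2 * P.Rmax) + 2 * P.kap) *
        (betaKL S A H δ (visits D h s a) / visits D h s a) +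
      (1 + 9 / H) * mean (p h s a) (gapV P δ D h.succ) := by
  have : Nonempty S := ⟨s⟩
  have hH' : (1 : ℝ) ≤ H := by exact_mod_cast hH
  have hR := P.Rmax_nonneg hH
  have hn0 : (0 : ℝ) < visits D h s a := by exact_mod_cast Nat.pos_of_ne_zero hn
  have hopt := hD.optimism hH hδ h.succ
  have hgap := hD.gap hH hδ h.succ
  have hβ := betaKL_pos (S := S) (A := A) hH hδ (visits D h s a)
  set π := optimisticPolicy P δ D
  set k := betaKL S A H δ (visits D h s a) / (visits D h s a : ℝ) with hk
  have hk0 : 0 ≤ k := by positivity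
  have key := bonus_transfer (H := H) (R := P.Rmax) (p h s a).2 (empirical_mem D h s a)
    (hD.kl h s a hn) (f := P.polV p π h.succ) (g := upperV P δ D h.succ)
    (W := gapV P δ D h.succ)
    (c := betaConc S A H δ (visits D h s a) / visits D h s a)
    hk0 (div_nonneg (betaConc_nonneg hH hδ hn) hn0.le)
    (by rw [← mul_div_assoc]; gcongr; exact betaConc_le hH hδ hn) hH' hR
    (fun x => ⟨P.polV_nonneg p π _ x,
      (P.polV_le_optV p π _ x).trans (P.optV_le_mul hH p _ x)⟩)
    (fun x => by linarith [(hopt.1 x).1, P.polV_le_optV p π h.succ x]) hgap.2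
    (fun x => (gapV_mem hH _ x).2)
  have hent : bonusEnt δ D h s a ≤ √(2 * betaEnt S A H δ (visits D h s a) / visits D h s a) + k :=
    add_le_add le_rfl (min_le_left _ _)
  have hke := mul_le_mul_of_nonneg_left hent P.kap_nonneg
  have hW : 0 ≤ mean (p h s a) (gapV P δ D h.succ) :=
    mean_nonneg (p h s a).2.1 fun x => (gapV_mem hH _ x).1
  have hkap := P.kap_nonneg
  rw [gapQ, if_neg hn]
  refine clip_le ?_ (by positivity)
  have eb : bonusBern P δ D (confidenceV P δ D h.succ).1 h s a =
      3 * √(variance (empirical D h s a) (upperV P δ D h.succ) *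
        (betaConc S A H δ (visits D h s a) / visits D h s a)) + 9 * (H ^ 2 * P.Rmax * k) := by
    rw [bonusBern, upperV, hk]; ring
  have e2 : 4 * (H : ℝ) ^ 2 * P.Rmax * betaKL S A H δ (visits D h s a) /
      (visits D h s a : ℝ) = 4 * (H ^ 2 * P.Rmax * k) := by rw [hk]; ring
  rw [eb, e2]
  change _ ≤ 12 * √(variance (p h s a) _ * _) + 75 * _ + _ * mean (p h s a) _ at key
  linarith

/-- Unrolling costs one factor 1 + 9/H per remaining step, at most e^9 altogether. -/
theorem gapV_le_evalV (hH : 1 ≤ H) {x : Fin H → S → A → ℝ} (hx : ∀ h s a, 0 ≤ x h s a)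
    (hgap : ∀ h s a, gapQ P δ D (gapV P δ D h.succ) h s a ≤
      x h s a + (1 + 9 / H) * mean (p h s a) (gapV P δ D h.succ)) (h : Fin (H + 1)) :
    ∀ s, gapV P δ D h s ≤
      (1 + 9 / H) ^ (H - (h : ℕ)) * evalV p (optimisticPolicy P δ D) x h s := by
  induction h using Fin.reverseInduction with
  | last => intro s; rw [gapV_last, evalV_last]; simp
  | cast h ih =>
    intro s
    set ρ : ℝ := 1 + 9 / H with hρ
    have hρ1 : 1 ≤ ρ := by rw [hρ]; linarith [(by positivity : (0 : ℝ) ≤ 9 / H)]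
    have e : H - (h.castSucc : ℕ) = (H - (h.succ : ℕ)) + 1 := by
      simp only [Fin.val_castSucc, Fin.val_succ]; have := h.2; omega
    rw [gapV_castSucc, evalV_castSucc, ← mean_const_mul, e]
    refine mean_mono (optimisticPolicy P δ D h s).2.1 fun a => (hgap h s a).trans ?_
    have h1 : mean (p h s a) (gapV P δ D h.succ) ≤ ρ ^ (H - (h.succ : ℕ)) *
        mean (p h s a) (evalV p (optimisticPolicy P δ D) x h.succ) := by
      rw [← mean_const_mul]
      exact mean_mono (p h s a).2.1 ih
    have h2 := mul_le_mul_of_nonneg_left h1 (by linarith : 0 ≤ ρ)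
    have h3 : x h s a ≤ ρ ^ (H - (h.succ : ℕ) + 1) * x h s a :=
      le_mul_of_one_le_left (hx h s a) (one_le_pow₀ hρ1)
    rw [mul_add, pow_succ]
    rw [pow_succ] at h3
    linarith

theorem gapV_le_exp_mul (hH : 1 ≤ H) {x : Fin H → S → A → ℝ} (hx : ∀ h s a, 0 ≤ x h s a)
    (hgap : ∀ h s a, gapQ P δ D (gapV P δ D h.succ) h s a ≤
      x h s a + (1 + 9 / H) * mean (p h s a) (gapV P δ D h.succ)) :
    gapV P δ D 0 P.start ≤ Real.exp 9 *
      ∑ h, ∑ s, ∑ a, occupancy P.start p (optimisticPolicy P δ D) h s a * x h s a := by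
  have hH' : (0 : ℝ) < H := by exact_mod_cast hH
  rw [sum_occupancy_mul]
  refine (gapV_le_evalV (p := p) hH hx hgap 0 P.start).trans ?_
  refine mul_le_mul_of_nonneg_right ?_ ?_
  · calc (1 + 9 / (H : ℝ)) ^ (H - ((0 : Fin (H + 1)) : ℕ)) = (1 + 9 / (H : ℝ)) ^ H := by simp
      _ ≤ Real.exp (9 / H) ^ H := by
        gcongr
        rw [add_comm]
        exact Real.add_one_le_exp _
      _ = Real.exp 9 := by
        rw [← Real.exp_nat_mul]
        congr 1
        field_simp
  · rw [← sum_occupancy_mul]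
    exact Finset.sum_nonneg fun h _ => Finset.sum_nonneg fun s _ => Finset.sum_nonneg fun a _ =>
      mul_nonneg (occupancy_nonneg ..) (hx h s a)

end OneStep

/-! ### Summation over episodes -/

section Summation

/-- While a triple has few expected visits the trivial bound M is used, which the pigeonhole bound
limits to b + 1 expected visits. Afterwards o √(V c/N) = √(o V) √(c o/N), and Cauchy-Schwarz
separates the total variance from the logarithmic sum of o/N. The root with constant c₂ is treated
in the same way with V replaced by 1. -/
theorem sum_mul_ite_sqrt_le {ι : Type*} [Fintype ι] {o N V : ℕ → ι → ℝ}
    (ho : ∀ t i, o t i ∈ Set.Icc 0 1) (h0 : ∀ i, N 0 i = 0)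
    (hN : ∀ t i, N (t + 1) i = N t i + o t i) (hV : ∀ t i, 0 ≤ V t i) {b M k c₁ c₂ c₃ v m : ℝ}
    (hb : 1 ≤ b) (hM : 0 ≤ M) (hk : 0 ≤ k) (hc₁ : 0 ≤ c₁) (hc₂ : 0 ≤ c₂) (hc₃ : 0 ≤ c₃)
    (hv : ∀ t, ∑ i, o t i * V t i ≤ v) (hm : ∀ t, ∑ i, o t i ≤ m) (T : ℕ) :
    ∑ t ∈ Finset.range T, ∑ i, o t i * (if N t i < b then M else
        √(V t i * (c₁ / N t i)) + k * √(c₂ / N t i) + c₃ / N t i) ≤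
      M * (Fintype.card ι * (b + 1)) +
        √(T * v) * √(c₁ * (Fintype.card ι * (2 * Real.log (1 + T)))) +
        k * (√(T * m) * √(c₂ * (Fintype.card ι * (2 * Real.log (1 + T))))) +
        c₃ * (Fintype.card ι * (2 * Real.log (1 + T))) := by
  set u : ℕ → ι → ℝ := fun t i => if N t i < b then 0 else o t i / N t i with hu
  have hu0 : ∀ t i, 0 ≤ u t i := by
    intro t i
    simp only [hu]
    split_ifs with h
    · exact le_rfl
    · exact div_nonneg (ho t i).1 (by linarith)
  have hsu : ∑ t ∈ Finset.range T, ∑ i, u t i ≤ Fintype.card ι * (2 * Real.log (1 + T)) := by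
    rw [Finset.sum_comm]
    refine (Finset.sum_le_card_nsmul _ _ _ fun i _ =>
      sum_div_le (fun t => ho t i) (h0 i) (fun t => hN t i) hb T).trans_eq ?_
    rw [nsmul_eq_mul, Finset.card_univ]
  have hsl : ∑ t ∈ Finset.range T, ∑ i, (if N t i < b then o t i else 0) ≤
      Fintype.card ι * (b + 1) := by
    rw [Finset.sum_comm]
    refine (Finset.sum_le_card_nsmul _ _ _ fun i _ =>
      sum_lt_le (fun t => ho t i) (h0 i) (fun t => hN t i) (by linarith) T).trans_eq ?_
    rw [nsmul_eq_mul, Finset.card_univ]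
  have cauchy : ∀ (y : ℕ → ι → ℝ) (w c : ℝ), 0 ≤ c → (∀ t i, 0 ≤ y t i) →
      (∀ t, ∑ i, y t i ≤ w) → ∑ t ∈ Finset.range T, ∑ i, √(y t i) * √(c * u t i) ≤
        √(T * w) * √(c * (Fintype.card ι * (2 * Real.log (1 + T)))) := by
    intro y w c hc hy hw
    rw [← Finset.sum_product']
    refine (Real.sum_sqrt_mul_sqrt_le _ (fun x : ℕ × ι => hy x.1 x.2)
      (fun x : ℕ × ι => mul_nonneg hc (hu0 x.1 x.2))).trans ?_
    rw [Finset.sum_product' (f := y), Finset.sum_product' (f := fun t i => c * u t i)]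
    refine mul_le_mul (Real.sqrt_le_sqrt ?_) (Real.sqrt_le_sqrt ?_) (Real.sqrt_nonneg _)
      (Real.sqrt_nonneg _)
    · refine (Finset.sum_le_card_nsmul _ _ _ fun t _ => hw t).trans_eq ?_
      rw [nsmul_eq_mul, Finset.card_range]
    · simp only [← Finset.mul_sum]
      exact mul_le_mul_of_nonneg_left hsu hc
  have hterm : ∀ t i, o t i * (if N t i < b then M else
      √(V t i * (c₁ / N t i)) + k * √(c₂ / N t i) + c₃ / N t i) =
      M * (if N t i < b then o t i else 0) + √(o t i * V t i) * √(c₁ * u t i) +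
        k * (√(o t i) * √(c₂ * u t i)) + c₃ * u t i := by
    intro t i
    simp only [hu]
    have h1 := (ho t i).1
    split_ifs with h
    · simp [mul_comm]
    · have hpos : 0 < N t i := by linarith
      have e1 : √(o t i * V t i) * √(c₁ * (o t i / N t i)) = o t i * √(V t i * (c₁ / N t i)) := by
        rw [← Real.sqrt_mul (mul_nonneg h1 (hV t i)), show o t i * V t i * (c₁ * (o t i / N t i)) =
          o t i ^ 2 * (V t i * (c₁ / N t i)) by ring, Real.sqrt_mul (sq_nonneg _),
          Real.sqrt_sq h1]
      have e2 : √(o t i) * √(c₂ * (o t i / N t i)) = o t i * √(c₂ / N t i) := by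
        rw [← Real.sqrt_mul h1, show o t i * (c₂ * (o t i / N t i)) =
          o t i ^ 2 * (c₂ / N t i) by ring, Real.sqrt_mul (sq_nonneg _), Real.sqrt_sq h1]
      rw [e1, e2]
      ring
  simp only [hterm, Finset.sum_add_distrib, ← Finset.mul_sum]
  have t1 := mul_le_mul_of_nonneg_left hsl hM
  have t2 := cauchy (fun t i => o t i * V t i) v c₁ hc₁
    (fun t i => mul_nonneg (ho t i).1 (hV t i)) hv
  have t3 := mul_le_mul_of_nonneg_left (cauchy o m c₂ hc₂ (fun t i => (ho t i).1) hm) hk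
  have t4 := mul_le_mul_of_nonneg_left hsu hc₃
  linarith

end Summation

/-! ### The cumulative gap -/

section GapBound

variable {S A : Type*} [Fintype S] [Fintype A] [Nonempty A] {H t : ℕ}
  {P : Problem S A H} {p : Transitions S A H} {δ : ℝ} {D : Data S A H t}

theorem visits_le (D : Data S A H t) (h : Fin H) (s : S) (a : A) : visits D h s a ≤ t := by
  classical
  exact (Finset.card_filter_le _ _).trans_eq (by simp)

/-- Replaces the random count n by N/4, with N the expected count, and all logarithms of n by Λ. `R`
is left free so that it can be `Rmax`, or `Rmax + kap` when κ is not controlled by `Rmax`. The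
constants: 48² = 12²·16, 10² ≥ 2²·24, and 316 = 4·79 with 79 = 75 + 2·2. -/
theorem Confident.gapQ_le_of_visits (hD : Confident P p δ D) (hH : 1 ≤ H)
    (hδ : δ ∈ Set.Ioo (0 : ℝ) 1) {R Λ N : ℝ} (hR : P.Rmax ≤ R) (hκ : P.kap ≤ 2 * R)
    (hΛ : 1 + Real.log (1 + t) ≤ Λ) (h : Fin H) (s : S) (a : A) (hN : 0 < N)
    (hn : N / 4 ≤ visits D h s a) :
    gapQ P δ D (gapV P δ D h.succ) h s a ≤
      (√(variance (p h s a) (P.polV p (optimisticPolicy P δ D) h.succ) *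
        (48 ^ 2 * (Real.log (4 * size S A H / δ) * Λ) / N)) +
      P.kap * √(10 ^ 2 * (Real.log (4 * size S A H / δ) * Λ ^ 3) / N) +
      316 * (H ^ 2 * R) * (Real.log (4 * size S A H / δ) + Fintype.card S * Λ) / N) +
      (1 + 9 / H) * mean (p h s a) (gapV P δ D h.succ) := by
  have : Nonempty S := ⟨s⟩
  set ℓ := Real.log (4 * size S A H / δ) with hℓ
  have hℓ1 : 1 ≤ ℓ := one_le_logSize hH hδ
  set n := visits D h s a with hn'
  have hnt : n ≤ t := visits_le D h s a
  have hnpos : (0 : ℝ) < n := lt_of_lt_of_le (by positivity) hn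
  have hn0 : n ≠ 0 := by rintro h0; rw [h0] at hnpos; simp at hnpos
  have hn1 : (1 : ℝ) ≤ n := by exact_mod_cast Nat.one_le_iff_ne_zero.2 hn0
  have hlog : Real.log (1 + n) ≤ Real.log (1 + t) :=
    Real.log_le_log (by positivity) (by gcongr)
  have hlog0 := log_one_add_nonneg n
  have hΛ1 : 1 ≤ Λ := by linarith
  have hH1 : (1 : ℝ) ≤ H := by exact_mod_cast hH
  have hR0 : 0 ≤ R := (P.Rmax_nonneg hH).trans hR
  have hℓΛ : ℓ ≤ ℓ * Λ := le_mul_of_one_le_right (by linarith) hΛ1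
  have hΛℓ : Λ ≤ ℓ * Λ := le_mul_of_one_le_left (by linarith) hℓ1
  have hdiv : ∀ {x y : ℝ}, x ≤ y → 0 ≤ y → x / n ≤ 4 * y / N := by
    intro x y hxy hy
    rw [div_le_div_iff₀ hnpos hN]
    have := mul_le_mul_of_nonneg_right hxy hN.le
    nlinarith
  have hconc : betaConc S A H δ n ≤ 4 * (ℓ * Λ) := by
    have h1 := log_conc_le hn0
    have h2 := log_four_le (S := S) (A := A) hH hδ
    unfold betaConc
    linarith
  have hent : 2 * betaEnt S A H δ n ≤ 6 * (ℓ * Λ ^ 3) := by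
    have h1 : Real.log (n * (n + 1)) ≤ 2 * Λ := by
      rw [Real.log_mul (by positivity) (by positivity)]
      have : Real.log n ≤ Real.log (1 + n) := Real.log_le_log hnpos (by linarith)
      rw [add_comm (n : ℝ) 1]
      linarith
    have h2 : Real.log n ^ 2 ≤ Λ ^ 2 := by
      have : Real.log n ≤ Real.log (1 + n) := Real.log_le_log hnpos (by linarith)
      exact pow_le_pow_left₀ (Real.log_nonneg hn1) (by linarith) 2
    have h3 : ℓ + Real.log (n * (n + 1)) ≤ 3 * (ℓ * Λ) := by linarith
    have h4 := mul_le_mul_of_nonneg_left h3 (sq_nonneg (Real.log n))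
    have h5 := mul_le_mul_of_nonneg_right h2 (by positivity : 0 ≤ 3 * (ℓ * Λ))
    unfold betaEnt
    nlinarith
  have hkl : betaKL S A H δ n ≤ ℓ + Fintype.card S * Λ := by
    unfold betaKL
    rw [log_exp_one_mul]
    gcongr
    linarith
  refine (hD.gapQ_le hH hδ h s a hn0).trans (add_le_add (add_le_add (add_le_add ?_ ?_) ?_) le_rfl)
  · have hV := variance_nonneg (p h s a).2.1 (P.polV p (optimisticPolicy P δ D) h.succ)
    change 0 ≤ variance (⇑(p h s a)) _ at hV
    have e : ∀ x : ℝ, 12 * √x = √(12 ^ 2 * x) := fun x => by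
      rw [Real.sqrt_mul (by norm_num : (0 : ℝ) ≤ 12 ^ 2) x, Real.sqrt_sq (by norm_num)]
    rw [e]
    refine Real.sqrt_le_sqrt ?_
    have := mul_le_mul_of_nonneg_left (hdiv hconc (by positivity)) hV
    calc _ ≤ 12 ^ 2 * (_ * (4 * (4 * (ℓ * Λ)) / N)) := by gcongr
      _ = _ := by ring
  · rw [mul_comm 2 P.kap, mul_assoc]
    refine mul_le_mul_of_nonneg_left ?_ P.kap_nonneg
    have h1 := hdiv hent (by positivity)
    calc 2 * √(2 * betaEnt S A H δ n / n) = √(2 ^ 2 * (2 * betaEnt S A H δ n / n)) := by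
          rw [Real.sqrt_mul (by norm_num : (0 : ℝ) ≤ 2 ^ 2), Real.sqrt_sq (by norm_num)]
      _ ≤ _ := by
          refine Real.sqrt_le_sqrt ?_
          have : (0 : ℝ) ≤ ℓ * Λ ^ 3 / N := by positivity
          calc 2 ^ 2 * (2 * betaEnt S A H δ n / n) ≤ 2 ^ 2 * (4 * (6 * (ℓ * Λ ^ 3)) / N) := by
                gcongr
            _ = 96 * (ℓ * Λ ^ 3 / N) := by ring
            _ ≤ 100 * (ℓ * Λ ^ 3 / N) := by gcongr; norm_num
            _ = _ := by ring
  · have h1 := hdiv hkl (by positivity)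
    have h2 : 75 * (H ^ 2 * P.Rmax) + 2 * P.kap ≤ 79 * (H ^ 2 * R) := by
      have h3 : H ^ 2 * P.Rmax ≤ H ^ 2 * R := by gcongr
      have h4 : R ≤ H ^ 2 * R := le_mul_of_one_le_left hR0 (one_le_pow₀ hH1)
      linarith
    have hb := betaKL_pos (S := S) (A := A) hH hδ n
    calc _ ≤ 79 * (H ^ 2 * R) * (4 * (ℓ + Fintype.card S * Λ) / N) :=
          mul_le_mul h2 h1 (by positivity) (by positivity)
      _ = _ := by ring

theorem sqrt_mul_sqrt_le {x y z c : ℝ} (hx : 0 ≤ x) (hc : 0 ≤ c) (h : x * y ≤ c ^ 2 * z) :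
    √x * √y ≤ c * √z := by
  rw [← Real.sqrt_mul hx]
  refine (Real.sqrt_le_sqrt h).trans_eq ?_
  rw [Real.sqrt_mul (sq_nonneg c), Real.sqrt_sq hc]

/-- The number `a` is a common bound that lets the variance term and the entropy term share one
square root √(T a). -/
theorem sum_gapV_le {ε : ℝ} {ω : ℕ → Episode S A H} (hω : ω ∈ goodEvent (ucbviEnt P ε δ) p P δ)
    (hH : 1 ≤ H) (hδ : δ ∈ Set.Ioo (0 : ℝ) 1) {R v a : ℝ} (hR : P.Rmax ≤ R)
    (hκ : P.kap ≤ 2 * R)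
    (hv : ∀ π, ∑ h, ∑ s, ∑ a, occupancy P.start p π h s a *
      variance (p h s a) (P.polV p π h.succ) ≤ v)
    (hva : v * size S A H * Real.log (4 * size S A H / δ) ≤ a)
    (hκa : P.kap ^ 2 * H * size S A H * Real.log (4 * size S A H / δ) ≤ 4 * a) (T : ℕ) :
    ∑ t ∈ Finset.range T, gapV P δ (Algorithm.firstEpisodes ω t) 0 P.start ≤
      Real.exp 9 * (110 * (√(T * a) * (1 + Real.log (1 + T)) ^ 2) +
        640 * (H ^ 2 * R * size S A H * (Real.log (4 * size S A H / δ) +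
          Fintype.card S * (1 + Real.log (1 + T))) * (1 + Real.log (1 + T)))) := by
  have : Nonempty S := ⟨P.start⟩
  set ℓ := Real.log (4 * size S A H / δ) with hℓ
  have hℓ1 : 1 ≤ ℓ := one_le_logSize hH hδ
  set Λ := 1 + Real.log (1 + (T : ℝ)) with hΛ
  have hlogT := log_one_add_nonneg T
  have hΛ1 : 1 ≤ Λ := by linarith
  have hH1 : (1 : ℝ) ≤ H := by exact_mod_cast hH
  have hR0 : 0 ≤ R := (P.Rmax_nonneg hH).trans hR
  have hs1 := one_le_size (S := S) (A := A) hH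
  set D : ∀ t, Data S A H t := Algorithm.firstEpisodes ω
  set o : ℕ → Fin H × S × A → ℝ := fun t i =>
    occupancy P.start p (optimisticPolicy P δ (D t)) i.1 i.2.1 i.2.2 with ho
  set N : ℕ → Fin H × S × A → ℝ := fun t i =>
    expVisits (ucbviEnt P ε δ) P.start p i.1 i.2.1 i.2.2 t (D t) with hN
  set V : ℕ → Fin H × S × A → ℝ := fun t i => variance (p i.1 i.2.1 i.2.2)
    (P.polV p (optimisticPolicy P δ (D t)) i.1.succ) with hV
  set c₁ := 48 ^ 2 * (ℓ * Λ) with hc₁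
  set c₂ := 10 ^ 2 * (ℓ * Λ ^ 3) with hc₂
  set c₃ := 316 * (H ^ 2 * R) * (ℓ + Fintype.card S * Λ) with hc₃
  have hcard : (Fintype.card (Fin H × S × A) : ℝ) = size S A H := by
    rw [Fintype.card_prod, Fintype.card_prod, Fintype.card_fin, size]; push_cast; ring
  have hV0 : ∀ t i, 0 ≤ V t i := fun t i => variance_nonneg (p i.1 i.2.1 i.2.2).2.1 _
  -- Beyond the threshold N ≥ 4ℓ, the count bound n ≥ N/2 - ℓ gives n ≥ N/4.
  have hgap : ∀ t ∈ Finset.range T, gapV P δ (D t) 0 P.start ≤ Real.exp 9 *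
      ∑ i, o t i * (if N t i < 4 * ℓ then H * R else
        √(V t i * (c₁ / N t i)) + P.kap * √(c₂ / N t i) + c₃ / N t i) := by
    intro t ht
    have htT : (t : ℝ) ≤ T := by exact_mod_cast (Finset.mem_range.1 ht).le
    have hκ0 := P.kap_nonneg
    set x : Fin H → S → A → ℝ := fun h s a => if N t (h, s, a) < 4 * ℓ then H * R else
      √(V t (h, s, a) * (c₁ / N t (h, s, a))) + P.kap * √(c₂ / N t (h, s, a)) +
        c₃ / N t (h, s, a) with hx
    have := gapV_le_exp_mul (P := P) (p := p) (δ := δ) (D := D t) hH (x := x) (fun h s a => ?_)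
      (fun h s a => ?_)
    · simpa only [Fintype.sum_prod_type] using this
    · simp only [hx]
      split_ifs with hb
      · positivity
      · have : 0 ≤ N t (h, s, a) := by linarith
        positivity
    · simp only [hx]
      have hW : 0 ≤ mean (p h s a) (gapV P δ (D t) h.succ) :=
        mean_nonneg (p h s a).2.1 fun x => (gapV_mem hH _ x).1
      split_ifs with hb
      · have h1 := (gapQ_mem (P := P) (δ := δ) (D := D t) hH (gapV P δ (D t) h.succ) h s a).2
        have h2 : H * P.Rmax ≤ H * R := by gcongr
        have h3 : 0 ≤ (1 + 9 / (H : ℝ)) * mean (p h s a) (gapV P δ (D t) h.succ) := by positivity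
        linarith
      · rw [not_lt] at hb
        have hcnt : N t (h, s, a) / 2 ≤ visits (D t) h s a + ℓ := (hω t).2 h s a
        refine (hω t).1.gapQ_le_of_visits hH hδ hR hκ ?_ h s a (by linarith) (by linarith)
        have : Real.log (1 + (t : ℝ)) ≤ Real.log (1 + T) :=
          Real.log_le_log (by positivity) (by linarith)
        linarith
  refine (Finset.sum_le_sum hgap).trans ?_
  rw [← Finset.mul_sum]
  refine mul_le_mul_of_nonneg_left ?_ (Real.exp_pos _).le
  refine (sum_mul_ite_sqrt_le (fun t i => ⟨occupancy_nonneg .., occupancy_le_one ..⟩)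
    (fun i => rfl) (fun t i => rfl) hV0 (by linarith) (by positivity) P.kap_nonneg
    (by positivity) (by positivity) (by positivity) (v := v) (m := H)
    (fun t => ?_) (fun t => ?_) T).trans ?_
  · simpa only [Fintype.sum_prod_type] using hv (optimisticPolicy P δ (D t))
  · have := (sum_occupancy P.start p (optimisticPolicy P δ (D t))).le
    simpa only [Fintype.sum_prod_type] using this
  · rw [hcard]
    have hv0 : 0 ≤ v := (Finset.sum_nonneg fun h _ => Finset.sum_nonneg fun s _ =>
      Finset.sum_nonneg fun a _ => mul_nonneg (occupancy_nonneg P.start p _ h s a)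
        (variance_nonneg (p h s a).2.1 _)).trans (hv (optimisticPolicy P δ (D 0)))
    have ha0 : 0 ≤ a := le_trans (by positivity) hva
    have hlog : size S A H * (2 * Real.log (1 + T)) ≤ size S A H * (2 * Λ) := by
      gcongr; linarith
    have hlog0 : 0 ≤ size S A H * (2 * Real.log (1 + T)) := by positivity
    set y := size S A H * (2 * Real.log (1 + T))
    set U := (H : ℝ) ^ 2 * R * size S A H * (ℓ + Fintype.card S * Λ) * Λ with hU
    have t1 : H * R * (size S A H * (4 * ℓ + 1)) ≤ 5 * U := by
      have e1 : (H : ℝ) * R * size S A H * ℓ ≤ U := by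
        have : ℓ ≤ (ℓ + Fintype.card S * Λ) * Λ := by
          have h1 : 0 ≤ Fintype.card S * Λ := by positivity
          nlinarith
        rw [hU, mul_assoc _ _ Λ]
        gcongr
        nlinarith
      have e2 : H * R * (size S A H * (4 * ℓ + 1)) ≤ H * R * (size S A H * (5 * ℓ)) := by
        gcongr; linarith
      linarith
    have t2 : √(T * v) * √(c₁ * y) ≤ 72 * Λ ^ 2 * √(T * a) := by
      refine sqrt_mul_sqrt_le (by positivity) (by positivity) ?_
      calc T * v * (c₁ * y) ≤ T * v * (c₁ * (size S A H * (2 * Λ))) := by gcongr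
        _ = 2 * 48 ^ 2 * (T * (v * size S A H * ℓ)) * Λ ^ 2 := by rw [hc₁]; ring
        _ ≤ 72 ^ 2 * (T * a) * Λ ^ 4 := by
          gcongr ?_ * (T * ?_) * ?_
          · norm_num
          · exact pow_le_pow_right₀ hΛ1 (by norm_num)
        _ = _ := by ring
    have t3 : P.kap * (√(T * H) * √(c₂ * y)) ≤ 30 * Λ ^ 2 * √(T * a) := by
      have e : P.kap * √(T * H) = √(P.kap ^ 2 * (T * H)) := by
        rw [Real.sqrt_mul (sq_nonneg _), Real.sqrt_sq P.kap_nonneg]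
      rw [← mul_assoc, e]
      refine sqrt_mul_sqrt_le (by positivity) (by positivity) ?_
      calc P.kap ^ 2 * (T * H) * (c₂ * y)
          ≤ P.kap ^ 2 * (T * H) * (c₂ * (size S A H * (2 * Λ))) := by gcongr
        _ = 200 * (T * (P.kap ^ 2 * H * size S A H * ℓ)) * Λ ^ 4 := by rw [hc₂]; ring
        _ ≤ 200 * (T * (4 * a)) * Λ ^ 4 := by gcongr
        _ ≤ (30 * Λ ^ 2) ^ 2 * (T * a) := by
          have : 0 ≤ T * a * Λ ^ 4 := by positivity
          nlinarith
    have t4 : c₃ * y ≤ 632 * U := by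
      calc c₃ * y ≤ c₃ * (size S A H * (2 * Λ)) := by gcongr
        _ = 632 * U := by rw [hc₃, hU]; ring
    have hU0 : 0 ≤ U := by positivity
    have hsq : 0 ≤ √(T * a) * Λ ^ 2 := by positivity
    linarith

end GapBound

/-! ### Solving the inequality for the number of episodes -/

section Inversion

/-- The arithmetic-geometric inequality absorbs half of ε T from the term with √T. -/
theorem le_of_sum_le {ε T a b B Λ : ℝ} (hε : 0 < ε) (hT : 0 ≤ T) (ha : 0 ≤ a)
    (hB : 0 ≤ B) (h : ε * T ≤ B * (√(T * a) * Λ ^ 2) + b) :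
    T ≤ B ^ 2 * (a * Λ ^ 4 / ε ^ 2) + 2 * (b / ε) := by
  have h1 := sqrt_mul_le_add (a := ε * T) (b := B ^ 2 * (a * Λ ^ 4 / ε)) (by positivity)
    (by positivity)
  have e : √(ε * T * (B ^ 2 * (a * Λ ^ 4 / ε))) = B * (√(T * a) * Λ ^ 2) := by
    rw [show ε * T * (B ^ 2 * (a * Λ ^ 4 / ε)) = (B * Λ ^ 2) ^ 2 * (T * a) by field_simp,
      Real.sqrt_mul (sq_nonneg _), Real.sqrt_sq (by positivity)]
    ring
  rw [e] at h1
  have h2 : ε * T ≤ B ^ 2 * (a * Λ ^ 4 / ε) + 2 * b := by linarith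
  have h3 : T ≤ (B ^ 2 * (a * Λ ^ 4 / ε) + 2 * b) / ε := by rwa [le_div_iff₀' hε]
  refine h3.trans_eq ?_
  field_simp

/-- Taking logarithms gives Λ ≤ 1 + log C + 4 log Λ, and the tangent of the logarithm at 8 bounds 4
log Λ by Λ/2 plus a constant. -/
theorem one_add_log_le {T C : ℝ} (hT : 0 ≤ T) (hC : 0 < C)
    (h : 1 + T ≤ C * (1 + Real.log (1 + T)) ^ 4) :
    1 + Real.log (1 + T) ≤ 2 * Real.log C + 11 := by
  have hlog : 0 ≤ Real.log (1 + T) := Real.log_nonneg (by linarith)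
  set Λ := 1 + Real.log (1 + T) with hΛ
  have hΛ0 : 0 < Λ := by linarith
  have h1 := Real.log_le_log (by linarith) h
  rw [Real.log_mul hC.ne' (by positivity), Real.log_pow] at h1
  have h2 := Real.log_le_sub_one_of_pos (by positivity : 0 < Λ / 8)
  rw [Real.log_div hΛ0.ne' (by norm_num), show (8 : ℝ) = 2 ^ 3 by norm_num, Real.log_pow] at h2
  push_cast at h1 h2
  linarith [Real.log_two_lt_d9]

end Inversion

/-! ### Replacing log(1 + T) by the factor L -/

section Inversion

/-- log 4 + x ≤ e² max(1, x). This is where the iterated logarithm in L enters. -/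
theorem log_log_four_add_le {x : ℝ} (hx : 0 < x) :
    Real.log (Real.log 4 + x) ≤ 2 + max 0 (Real.log x) := by
  have h4 : Real.log 4 ≤ 1.4 := by
    have : Real.log 4 = 2 * Real.log 2 := by
      rw [show (4 : ℝ) = 2 ^ 2 by norm_num, Real.log_pow]; norm_num
    linarith [Real.log_two_lt_d9]
  have h4' := one_le_log_four
  have hm : Real.log (max 1 x) = max 0 (Real.log x) := by
    rcases le_total 1 x with h | h
    · rw [max_eq_right h, max_eq_right (Real.log_nonneg h)]
    · rw [max_eq_left h, max_eq_left (Real.log_nonpos hx.le h), Real.log_one]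
  have he := Real.add_one_le_exp (2 : ℝ)
  rw [← hm, ← Real.log_exp 2, ← Real.log_mul (Real.exp_pos _).ne' (by positivity)]
  refine Real.log_le_log (by positivity) ?_
  have h1 : 1 ≤ max 1 x := le_max_left _ _
  have h2 : x ≤ max 1 x := le_max_right _ _
  nlinarith

/-- Only the logarithm of a bound on T matters, so a crude polynomial one suffices: 1 + T ≤ 17 K
(Nρ)⁴ ℓ Λ⁴ with 17 = 12 + 4 + 1. -/
theorem one_add_log_le_mul_logFactor {T ε R N h s x K : ℝ} (hε : 0 < ε) (hR : 0 ≤ R)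
    (hs : 1 ≤ s) (hh : 1 ≤ h) (hsN : s ≤ N) (hhN : h ≤ N) (hx : 0 < x) (hK : 1 ≤ K) (hT0 : 0 ≤ T)
    (hT : T ≤ K * (12 * (h ^ 2 * N * R ^ 2 * x) * (1 + Real.log (1 + T)) ^ 4 / ε ^ 2 +
      h ^ 2 * (2 * R) * N * (Real.log 4 + x + s * (1 + Real.log (1 + T))) *
        (1 + Real.log (1 + T)) / ε)) :
    1 + Real.log (1 + T) ≤ (2 * Real.log (17 * K) + 23) *
      (1 + Real.log (N * max 1 (R / ε)) + max 0 (Real.log x)) := by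
  have hlog : 0 ≤ Real.log (1 + T) := Real.log_nonneg (by linarith)
  have hx4 := log_log_four_add_le hx
  have h4 := one_le_log_four
  set Λ := 1 + Real.log (1 + T) with hΛ
  set ℓ := Real.log 4 + x with hℓ
  set ρ := max 1 (R / ε) with hρ
  have hΛ1 : 1 ≤ Λ := by linarith
  have hN1 : 1 ≤ N := hs.trans hsN
  have hρ1 : 1 ≤ ρ := le_max_left _ _
  have hρR : R / ε ≤ ρ := le_max_right _ _
  have hRε : 0 ≤ R / ε := by positivity
  have hℓ1 : 1 ≤ ℓ := by linarith
  set Y := (N * ρ) ^ 4 * ℓ with hY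
  have hY1 : 1 ≤ Y := one_le_mul_of_one_le_of_one_le
    (one_le_pow₀ (one_le_mul_of_one_le_of_one_le hN1 hρ1)) hℓ1
  have hN3 : N ^ 3 ≤ N ^ 4 := pow_le_pow_right₀ hN1 (by norm_num)
  have hr2 : ρ ^ 2 ≤ ρ ^ 4 := pow_le_pow_right₀ hρ1 (by norm_num)
  have hr1 : ρ ≤ ρ ^ 4 := le_self_pow₀ hρ1 (by norm_num)
  have hL2 : Λ ^ 2 ≤ Λ ^ 4 := pow_le_pow_right₀ hΛ1 (by norm_num)
  have b1 : 12 * (h ^ 2 * N * R ^ 2 * x) * Λ ^ 4 / ε ^ 2 ≤ 12 * (Y * Λ ^ 4) := by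
    calc 12 * (h ^ 2 * N * R ^ 2 * x) * Λ ^ 4 / ε ^ 2
        = 12 * (h ^ 2 * N * (R / ε) ^ 2 * x * Λ ^ 4) := by field_simp
      _ ≤ 12 * (N ^ 2 * N * ρ ^ 2 * ℓ * Λ ^ 4) := by
        gcongr
        linarith
      _ = 12 * (N ^ 3 * ρ ^ 2 * ℓ * Λ ^ 4) := by ring
      _ ≤ 12 * (N ^ 4 * ρ ^ 4 * ℓ * Λ ^ 4) := by gcongr
      _ = _ := by rw [hY]; ring
  have b2 : h ^ 2 * (2 * R) * N * (ℓ + s * Λ) * Λ / ε ≤ 4 * (Y * Λ ^ 4) := by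
    have h1 : ℓ + s * Λ ≤ 2 * (N * ℓ * Λ) := by
      have e1 : ℓ ≤ N * ℓ * Λ := by
        have := one_le_mul_of_one_le_of_one_le hN1 hΛ1
        nlinarith
      have e2 : s * Λ ≤ N * ℓ * Λ := by
        have : s ≤ N * ℓ := hsN.trans (le_mul_of_one_le_right (by linarith) hℓ1)
        gcongr
      linarith
    calc h ^ 2 * (2 * R) * N * (ℓ + s * Λ) * Λ / ε
        = 2 * (h ^ 2 * N * (R / ε) * (ℓ + s * Λ) * Λ) := by field_simp
      _ ≤ 2 * (N ^ 2 * N * ρ * (2 * (N * ℓ * Λ)) * Λ) := by gcongr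
      _ = 4 * (N ^ 4 * ρ * ℓ * Λ ^ 2) := by ring
      _ ≤ 4 * (N ^ 4 * ρ ^ 4 * ℓ * Λ ^ 4) := by gcongr
      _ = _ := by rw [hY]; ring
  have hYΛ : 1 ≤ Y * Λ ^ 4 := one_le_mul_of_one_le_of_one_le hY1 (one_le_pow₀ hΛ1)
  have h1 : 1 + T ≤ 17 * K * Y * Λ ^ 4 := by
    have e1 := mul_le_mul_of_nonneg_left (add_le_add b1 b2) (by linarith : 0 ≤ K)
    have e2 : 1 ≤ K * (Y * Λ ^ 4) := one_le_mul_of_one_le_of_one_le hK hYΛ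
    calc 1 + T ≤ K * (Y * Λ ^ 4) + K * (12 * (Y * Λ ^ 4) + 4 * (Y * Λ ^ 4)) :=
          add_le_add e2 (hT.trans e1)
      _ = _ := by ring
  have h2 := one_add_log_le hT0 (by positivity) h1
  rw [Real.log_mul (x := 17 * K) (y := Y) (by positivity) (by positivity), hY,
    Real.log_mul (x := (N * ρ) ^ 4) (by positivity) (by positivity), Real.log_pow] at h2
  push_cast at h2
  have hK17 : 0 ≤ Real.log (17 * K) := Real.log_nonneg (by linarith)
  have hNρ : 0 ≤ Real.log (N * ρ) := Real.log_nonneg (one_le_mul_of_one_le_of_one_le hN1 hρ1)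
  have hmax : 0 ≤ max 0 (Real.log x) := le_max_left _ _
  change Λ ≤ _ at h2
  nlinarith [mul_nonneg hK17 hNρ, mul_nonneg hK17 hmax]

/-- Substitutes Λ ≤ M L into the bound on T. The log 4 in the second term is absorbed by s L ≥ 1;
the first term offers no such room, hence it is assumed with x alone. -/
theorem le_mul_rate {T ε R N h s x K : ℝ} (hε : 0 < ε) (hR : 0 ≤ R)
    (hs : 1 ≤ s) (hh : 1 ≤ h) (hsN : s ≤ N) (hhN : h ≤ N) (hx : 0 < x) (hK : 1 ≤ K) (hT0 : 0 ≤ T)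
    (hT : T ≤ K * (12 * (h ^ 2 * N * R ^ 2 * x) * (1 + Real.log (1 + T)) ^ 4 / ε ^ 2 +
      h ^ 2 * (2 * R) * N * (Real.log 4 + x + s * (1 + Real.log (1 + T))) *
        (1 + Real.log (1 + T)) / ε)) {M L : ℝ} (hM : M = 2 * Real.log (17 * K) + 23)
    (hL : L = 1 + Real.log (N * max 1 (R / ε)) + max 0 (Real.log x)) :
    T ≤ K * (12 * M ^ 4 + 2 * (2 + M) * M) *
      (h ^ 2 * N * R ^ 2 * x * L ^ 4 / ε ^ 2 + h ^ 2 * N * R * (x + s * L) * L / ε) := by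
  have hΛL := one_add_log_le_mul_logFactor hε hR hs hh hsN hhN hx hK hT0 hT
  rw [← hM, ← hL] at hΛL
  have hlog : 0 ≤ Real.log (1 + T) := Real.log_nonneg (by linarith)
  set Λ := 1 + Real.log (1 + T) with hΛ
  have hΛ1 : 1 ≤ Λ := by linarith
  have hN1 : 1 ≤ N := hs.trans hsN
  have hL1 : 1 ≤ L := by
    have h1 := Real.log_nonneg (one_le_mul_of_one_le_of_one_le hN1 (le_max_left 1 (R / ε)))
    have h2 := le_max_left 0 (Real.log x)
    linarith
  have hM0 : 0 ≤ M := by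
    have := Real.log_nonneg (by linarith : 1 ≤ 17 * K)
    linarith
  have h4 : Real.log 4 ≤ 2 := by
    have : Real.log 4 = 2 * Real.log 2 := by
      rw [show (4 : ℝ) = 2 ^ 2 by norm_num, Real.log_pow]; norm_num
    linarith [Real.log_two_lt_d9]
  have hsL : 1 ≤ s * L := one_le_mul_of_one_le_of_one_le hs hL1
  set X₁ := h ^ 2 * N * R ^ 2 * x * L ^ 4 / ε ^ 2 with hX₁
  set X₂ := h ^ 2 * N * R * (x + s * L) * L / ε with hX₂
  have hX₁0 : 0 ≤ X₁ := by positivity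
  have hX₂0 : 0 ≤ X₂ := by positivity
  have b1 : 12 * (h ^ 2 * N * R ^ 2 * x) * Λ ^ 4 / ε ^ 2 ≤ 12 * M ^ 4 * X₁ := by
    calc _ ≤ 12 * (h ^ 2 * N * R ^ 2 * x) * (M * L) ^ 4 / ε ^ 2 := by gcongr
      _ = _ := by rw [hX₁]; ring
  have b2 : h ^ 2 * (2 * R) * N * (Real.log 4 + x + s * Λ) * Λ / ε ≤ 2 * (2 + M) * M * X₂ := by
    have e : Real.log 4 + x + s * Λ ≤ (2 + M) * (x + s * L) := by
      have := mul_le_mul_of_nonneg_left hΛL (by linarith : 0 ≤ s)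
      nlinarith [mul_nonneg hM0 hx.le]
    calc _ ≤ h ^ 2 * (2 * R) * N * ((2 + M) * (x + s * L)) * (M * L) / ε := by gcongr
      _ = _ := by rw [hX₂]; ring
  refine (hT.trans (mul_le_mul_of_nonneg_left ?_ (by linarith))).trans_eq (mul_assoc _ _ _).symm
  have c1 : 0 ≤ 2 * (2 + M) * M * X₁ := by positivity
  have c2 : 0 ≤ 12 * M ^ 4 * X₂ := by positivity
  linarith

end Inversion

/-! ### The stopping time and the theorem -/

section Stopping

variable {S A : Type*} [Fintype S] [Fintype A] {H : ℕ}

theorem Algorithm.exists_stoppingTime_eq (alg : Algorithm S A H) {ω : ℕ → Episode S A H}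
    (h : ∃ t, alg.halts (Algorithm.firstEpisodes ω t)) :
    ∃ n : ℕ, alg.stoppingTime ω = n ∧ alg.halts (Algorithm.firstEpisodes ω n) ∧
      ∀ t < n, ¬ alg.halts (Algorithm.firstEpisodes ω t) := by
  classical
  refine ⟨Nat.find h, le_antisymm ?_ ?_, Nat.find_spec h, fun t ht => Nat.find_min h ht⟩
  · exact iInf₂_le (Nat.find h) (Nat.find_spec h)
  · exact le_iInf₂ fun t ht => by exact_mod_cast Nat.find_min' h ht

variable [Nonempty A] {P : Problem S A H} {p : Transitions S A H} {ε δ : ℝ}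
  {ω : ℕ → Episode S A H}

/-- Each of the first T gaps exceeds ε, so their sum is at least ε T. -/
theorem le_of_not_halts (hω : ω ∈ goodEvent (ucbviEnt P ε δ) p P δ)
    (hH : 1 ≤ H) (hδ : δ ∈ Set.Ioo (0 : ℝ) 1) (hε : 0 < ε) {R v a : ℝ} (hR : P.Rmax ≤ R)
    (hκ : P.kap ≤ 2 * R) (ha : 0 ≤ a)
    (hv : ∀ π, ∑ h, ∑ s, ∑ a, occupancy P.start p π h s a *
      variance (p h s a) (P.polV p π h.succ) ≤ v)
    (hva : v * size S A H * Real.log (4 * size S A H / δ) ≤ a)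
    (hκa : P.kap ^ 2 * H * size S A H * Real.log (4 * size S A H / δ) ≤ 4 * a) {T : ℕ}
    (hT : ∀ t < T, ¬ (ucbviEnt P ε δ).halts (Algorithm.firstEpisodes ω t)) :
    T ≤ (110 * Real.exp 9) ^ 2 * (a * (1 + Real.log (1 + T)) ^ 4 / ε ^ 2 +
      H ^ 2 * R * size S A H * (Real.log (4 * size S A H / δ) +
          Fintype.card S * (1 + Real.log (1 + T))) * (1 + Real.log (1 + T)) / ε) := by
  have : Nonempty S := ⟨P.start⟩
  have h1 := sum_gapV_le hω hH hδ hR hκ hv hva hκa T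
  have h2 : ε * T ≤ ∑ t ∈ Finset.range T, gapV P δ (Algorithm.firstEpisodes ω t) 0 P.start := by
    have := Finset.card_nsmul_le_sum (Finset.range T)
      (fun t => gapV P δ (Algorithm.firstEpisodes ω t) 0 P.start) ε
      fun t ht => (not_le.1 (hT t (Finset.mem_range.1 ht))).le
    rwa [Finset.card_range, nsmul_eq_mul, mul_comm] at this
  have hlog := log_one_add_nonneg T
  have hℓ1 := one_le_logSize (S := S) (A := A) hH hδ
  have hR0 : 0 ≤ R := (P.Rmax_nonneg hH).trans hR
  have hs1 := one_le_size (S := S) (A := A) hH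
  set b := H ^ 2 * R * size S A H * (Real.log (4 * size S A H / δ) +
    Fintype.card S * (1 + Real.log (1 + T))) * (1 + Real.log (1 + T)) with hb
  have hb0 : 0 ≤ b := by positivity
  have h3 := le_of_sum_le (ε := ε) (T := T) (a := a) (b := 640 * Real.exp 9 * b)
    (B := 110 * Real.exp 9) (Λ := 1 + Real.log (1 + T)) hε (by positivity) ha (by positivity)
    (h2.trans (h1.trans_eq (by ring)))
  refine h3.trans ?_
  have he : 1 ≤ Real.exp 9 := Real.one_le_exp (by norm_num)
  have h4 : 2 * (640 * Real.exp 9 * b / ε) ≤ (110 * Real.exp 9) ^ 2 * (b / ε) := by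
    have h5 : 0 ≤ b / ε := by positivity
    rw [mul_div_assoc, ← mul_assoc]
    refine mul_le_mul_of_nonneg_right ?_ h5
    nlinarith
  linarith

/-- Without stopping, T would be bounded by a fixed multiple of a power of log T for all T. -/
theorem exists_halts (hω : ω ∈ goodEvent (ucbviEnt P ε δ) p P δ)
    (hH : 1 ≤ H) (hδ : δ ∈ Set.Ioo (0 : ℝ) 1) (hε : 0 < ε) :
    ∃ t, (ucbviEnt P ε δ).halts (Algorithm.firstEpisodes ω t) := by
  by_contra! hnot
  have : Nonempty S := ⟨P.start⟩
  have hR0 := P.Rmax_nonneg hH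
  have hκ0 := P.kap_nonneg
  have hℓ1 := one_le_logSize (S := S) (A := A) hH hδ
  have hs1 := one_le_size (S := S) (A := A) hH
  have hH1 : (1 : ℝ) ≤ H := by exact_mod_cast hH
  -- For S = 1 and κ > 0 the entropy bonus need not be controlled by `Rmax`; adding κ restores κ ≤
  -- 2R, and finiteness needs no explicit rate.
  set R := P.Rmax + P.kap with hR
  set ℓ := Real.log (4 * size S A H / δ) with hℓ
  set a := (H * R) ^ 2 * size S A H * ℓ with ha
  have hbound : ∀ T : ℕ, _ := fun T : ℕ =>
    le_of_not_halts hω hH hδ hε (R := R) (v := (H * P.Rmax) ^ 2) (a := a) (by linarith)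
      (by linarith) (by positivity) (sum_occupancy_mul_variance_le hH P p)
      (by rw [ha]; gcongr; linarith)
      (by
        have h1 : P.kap ^ 2 ≤ R ^ 2 := by gcongr; linarith
        have h2 : (H : ℝ) ≤ H ^ 2 := le_self_pow₀ hH1 (by norm_num)
        have h3 : P.kap ^ 2 * H * size S A H * ℓ ≤ a := by
          rw [ha, mul_pow, mul_comm ((H : ℝ) ^ 2)]
          gcongr
        have : 0 ≤ a := by positivity
        linarith) (T := T) (fun t _ => hnot t)
  set C := (110 * Real.exp 9) ^ 2 * (a / ε ^ 2 + H ^ 2 * R * size S A H *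
    (ℓ + Fintype.card S) / ε) with hC
  have hC0 : 0 ≤ C := by positivity
  have key : ∀ T : ℕ, (1 : ℝ) + T ≤ (C + 1) * (2 * Real.log (C + 1) + 11) ^ 4 := by
    intro T
    have h0 := log_one_add_nonneg T
    have h1 : (1 : ℝ) + T ≤ (C + 1) * (1 + Real.log (1 + T)) ^ 4 := by
      have h2 := hbound T
      set Λ := 1 + Real.log (1 + (T : ℝ)) with hΛ
      have hΛ1 : 1 ≤ Λ := by linarith
      have h3 : (ℓ + Fintype.card S * Λ) * Λ ≤ (ℓ + Fintype.card S) * Λ ^ 4 := by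
        have e1 : ℓ * Λ ≤ ℓ * Λ ^ 4 := by
          gcongr; exact le_self_pow₀ hΛ1 (by norm_num)
        have e2 : Fintype.card S * Λ ^ 2 ≤ Fintype.card S * Λ ^ 4 :=
          mul_le_mul_of_nonneg_left (pow_le_pow_right₀ hΛ1 (by norm_num)) (by positivity)
        nlinarith
      have h4 : H ^ 2 * R * size S A H * (ℓ + Fintype.card S * Λ) * Λ / ε ≤
          H ^ 2 * R * size S A H * (ℓ + Fintype.card S) / ε * Λ ^ 4 := by
        calc _ = H ^ 2 * R * size S A H * ((ℓ + Fintype.card S * Λ) * Λ) / ε := by ring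
          _ ≤ H ^ 2 * R * size S A H * ((ℓ + Fintype.card S) * Λ ^ 4) / ε := by gcongr
          _ = _ := by ring
      have h5 : (T : ℝ) ≤ C * Λ ^ 4 := by
        have h6 := mul_le_mul_of_nonneg_left h4 (sq_nonneg (110 * Real.exp 9))
        calc (T : ℝ) ≤ _ := h2
          _ ≤ (110 * Real.exp 9) ^ 2 * (a * Λ ^ 4 / ε ^ 2) + (110 * Real.exp 9) ^ 2 *
              (H ^ 2 * R * size S A H * (ℓ + Fintype.card S) / ε * Λ ^ 4) := by
            rw [mul_add]
            exact add_le_add le_rfl h6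
          _ = C * Λ ^ 4 := by rw [hC]; ring
      have h6 : 1 ≤ Λ ^ 4 := one_le_pow₀ hΛ1
      linarith
    refine h1.trans ?_
    have := one_add_log_le (T := T) (by positivity) (by positivity) h1
    gcongr
  obtain ⟨T, hT⟩ := exists_nat_gt ((C + 1) * (2 * Real.log (C + 1) + 11) ^ 4)
  linarith [key T]

theorem ucbviEnt_isPAC (P : Problem S A H) (hH : 1 ≤ H) (hδ : δ ∈ Set.Ioo (0 : ℝ) 1)
    (hε : 0 < ε) : (ucbviEnt P ε δ).IsPAC P ε δ := by
  intro p
  refine (le_measure_goodEvent (ucbviEnt P ε δ) p P hH hδ).trans (measure_mono fun ω hω => ?_)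
  obtain ⟨n, hn, hhalt, -⟩ :=
    (ucbviEnt P ε δ).exists_stoppingTime_eq (exists_halts hω hH hδ hε)
  exact ⟨n, hn, ((hω n).1.optValue_sub_value_le hH hδ).trans hhalt⟩

/-- For S ≥ 2, κ log 2 ≤ κ log S ≤ R_max and log 2 ≥ 1/2. -/
theorem kap_le_two_mul_Rmax (P : Problem S A H) (hH : 1 ≤ H)
    (h : 2 ≤ Fintype.card S ∨ P.kap = 0) : P.kap ≤ 2 * P.Rmax := by
  rcases h with h | h
  · have h1 : Real.log 2 ≤ Real.log (Fintype.card S) :=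
      Real.log_le_log (by norm_num) (by exact_mod_cast h)
    have h2 := mul_le_mul_of_nonneg_left h1 P.kap_nonneg
    have h3 := mul_nonneg P.lam_pos.le P.RΦ_nonneg
    have h4 := P.rmax_nonneg hH
    have h5 := P.kap_nonneg
    rw [Problem.Rmax]
    nlinarith [Real.log_two_gt_d9]
  · rw [h]
    linarith [P.Rmax_nonneg hH]

theorem stoppingTime_le (hω : ω ∈ goodEvent (ucbviEnt P ε δ) p P δ)
    (hH : 1 ≤ H) (hδ : δ ∈ Set.Ioo (0 : ℝ) 1) (hε : 0 < ε)
    (h : 2 ≤ Fintype.card S ∨ P.kap = 0) {T : ℕ}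
    (hT : ∀ t < T, ¬ (ucbviEnt P ε δ).halts (Algorithm.firstEpisodes ω t)) {K M : ℝ}
    (hK : K = (110 * Real.exp 9) ^ 2) (hM : M = 2 * Real.log (17 * K) + 23) :
    T ≤ K * (12 * M ^ 4 + 2 * (2 + M) * M) * rate P ε δ := by
  have : Nonempty S := ⟨P.start⟩
  have hR0 := P.Rmax_nonneg hH
  have hs1 := one_le_size (S := S) (A := A) hH
  have hH1 : (1 : ℝ) ≤ H := by exact_mod_cast hH
  have hS1 : (1 : ℝ) ≤ Fintype.card S := by exact_mod_cast Fintype.card_pos (α := S)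
  have hA1 : (1 : ℝ) ≤ Fintype.card A := by exact_mod_cast Fintype.card_pos (α := A)
  have hδ0 := hδ.1
  have hN0 : 0 < size S A H := by linarith
  have hSN : (Fintype.card S : ℝ) ≤ size S A H := by
    rw [size, mul_assoc]
    exact le_mul_of_one_le_right (by linarith) (one_le_mul_of_one_le_of_one_le hA1 hH1)
  have hHN : (H : ℝ) ≤ size S A H :=
    le_mul_of_one_le_left (by linarith) (one_le_mul_of_one_le_of_one_le hS1 hA1)
  set N := size S A H with hN
  set x := Real.log (N / δ) with hx
  have hNδ : N < N / δ := by
    rw [lt_div_iff₀ hδ.1]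
    nlinarith [hδ.2]
  have hx0 : 0 < x := Real.log_pos (by linarith)
  have hℓ : Real.log (4 * N / δ) = Real.log 4 + x := by
    rw [mul_div_assoc, Real.log_mul (by norm_num) (by positivity)]
  have hℓ0 : 0 ≤ Real.log (4 * N / δ) := by linarith [one_le_log_four]
  have hκ := kap_le_two_mul_Rmax P hH h
  have hbound : (T : ℝ) ≤ K * (12 * (H ^ 2 * N * P.Rmax ^ 2 * x) * (1 + Real.log (1 + T)) ^ 4 /
      ε ^ 2 + H ^ 2 * (2 * P.Rmax) * N * (Real.log 4 + x + Fintype.card S *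
        (1 + Real.log (1 + T))) * (1 + Real.log (1 + T)) / ε) := by
    have ha : 0 ≤ 12 * (H ^ 2 * N * P.Rmax ^ 2 * x) := by positivity
    rw [hK, ← hℓ]
    -- The rate contains x = log(SAH/δ), not log(4SAH/δ), and their ratio is unbounded as SAH/δ
    -- tends to 1. For S ≥ 2, x ≥ log 2 gives log(4SAH/δ) ≤ 3x. For S = 1 all variances vanish and κ
    -- = 0, so nothing of order 1/ε² has to be bounded.
    rcases Nat.lt_or_ge (Fintype.card S) 2 with hS | hS
    · have hκ0 : P.kap = 0 := h.resolve_left (by omega)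
      have : Subsingleton S := Fintype.card_le_one_iff_subsingleton.1 (by omega)
      refine le_of_not_halts hω hH hδ hε (v := 0) (by linarith) (by linarith) ha
        (fun π => le_of_eq ?_) (by simpa using ha) (by rw [hκ0]; simpa using ha) hT
      exact Finset.sum_eq_zero fun h _ => Finset.sum_eq_zero fun s _ =>
        Finset.sum_eq_zero fun a _ =>
          mul_eq_zero_of_right _ (variance_of_subsingleton (p h s a).2 _)
    · have hN2 : (2 : ℝ) ≤ N := le_trans (by exact_mod_cast hS) hSN
      have hℓx : Real.log (4 * N / δ) ≤ 3 * x := by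
        have h1 : Real.log 2 ≤ x := Real.log_le_log (by norm_num) (by linarith)
        have h2 : Real.log 4 = 2 * Real.log 2 := by
          rw [show (4 : ℝ) = 2 ^ 2 by norm_num, Real.log_pow]; norm_num
        linarith
      refine le_of_not_halts hω hH hδ hε (by linarith) (by linarith) ha
        (sum_occupancy_mul_variance_le hH P p) ?_ ?_ hT
      · calc (H * P.Rmax) ^ 2 * N * Real.log (4 * N / δ) ≤ (H * P.Rmax) ^ 2 * N * (3 * x) := by
              gcongr
          _ = 3 * (H ^ 2 * N * P.Rmax ^ 2 * x) := by ring
          _ ≤ _ := by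
            have : 0 ≤ H ^ 2 * N * P.Rmax ^ 2 * x := by positivity
            linarith
      · have h1 : P.kap ^ 2 ≤ (2 * P.Rmax) ^ 2 := pow_le_pow_left₀ P.kap_nonneg hκ 2
        have h2 : (H : ℝ) ≤ H ^ 2 := le_self_pow₀ hH1 (by norm_num)
        calc P.kap ^ 2 * H * N * Real.log (4 * N / δ)
            ≤ (2 * P.Rmax) ^ 2 * H ^ 2 * N * (3 * x) := by gcongr
          _ = 12 * (H ^ 2 * N * P.Rmax ^ 2 * x) := by ring
          _ ≤ _ := by linarith
  have he : 1 ≤ Real.exp 9 := Real.one_le_exp (by norm_num)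
  refine (le_mul_rate hε hR0 hS1 hH1 hSN hHN hx0 (by rw [hK]; nlinarith) (by positivity)
    hbound hM (L := logFactor P ε δ) rfl).trans_eq ?_
  rw [rate, ← hN, ← hx, hN, size]
  ring

end Stopping

end RegMDP

end

theorem mainTheorem6 :
    ∃ C : ℝ, 0 < C ∧ ∀ (S : Type*) (A : Type*) [Fintype S] [Fintype A] [Nonempty A] (H : ℕ),
      1 ≤ H → ∀ (P : RegMDP.Problem S A H) (ε δ : ℝ), 0 < ε → δ ∈ Set.Ioo (0 : ℝ) 1 →
        (RegMDP.ucbviEnt P ε δ).IsPAC P ε δ ∧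
        (2 ≤ Fintype.card S ∨ P.kap = 0 →
          ∀ p : RegMDP.Transitions S A H,
            ENNReal.ofReal (1 - δ) ≤ (RegMDP.ucbviEnt P ε δ).law P.start p
              {ω | ∃ n : ℕ, (RegMDP.ucbviEnt P ε δ).stoppingTime ω = n ∧
                (n : ℝ) ≤ C * RegMDP.rate P ε δ}) := by
  have he : 1 ≤ Real.exp 9 := Real.one_le_exp (by norm_num)
  have hlog : 0 ≤ Real.log (17 * (110 * Real.exp 9) ^ 2) := Real.log_nonneg (by nlinarith)
  obtain ⟨K, hK⟩ : ∃ K, K = (110 * Real.exp 9) ^ 2 := ⟨_, rfl⟩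
  obtain ⟨M, hM⟩ : ∃ M, M = 2 * Real.log (17 * K) + 23 := ⟨_, rfl⟩
  have hK0 : 0 < K := by rw [hK]; positivity
  have hM0 : 0 < M := by rw [← hK] at hlog; linarith
  refine ⟨K * (12 * M ^ 4 + 2 * (2 + M) * M), by positivity, ?_⟩
  intro S A _ _ _ H hH P ε δ hε hδ
  refine ⟨RegMDP.ucbviEnt_isPAC P hH hδ hε, fun h p => ?_⟩
  refine (RegMDP.le_measure_goodEvent (RegMDP.ucbviEnt P ε δ) p P hH hδ).trans
    (measure_mono fun ω hω => ?_)
  obtain ⟨n, hn, -, hnot⟩ := (RegMDP.ucbviEnt P ε δ).exists_stoppingTime_eq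
    (RegMDP.exists_halts hω hH hδ hε)
  exact ⟨n, hn, RegMDP.stoppingTime_le hω hH hδ hε h hnot hK hM⟩
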